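/- Notation. Write $e(x)=e^{2\pi i x}$, $\tau=u+iv\in\mathbb H$, and identify $L'/L$ with $\mathbb Z/2\mathbb Z$, where $L'=\{\left(\begin{smallmatrix}-b/2&-c\\a&b/2\end{smallmatrix}\right):a,b,c\in\mathbb Z\}$, $L=\{b \text{ even}\}$ (the class is $b \bmod 2$), $Q(\lambda)=\det\lambda$, $(\lambda,\nu)=-\mathrm{tr}(\lambda\nu)$. Let $\mathfrak e_0,\mathfrak e_1$ be the standard basis of $\mathbb C[L'/L]$, and $\mathfrak e_n:=\mathfrak e_{n\bmod 2}$. Let $\widetilde\Gamma=\mathrm{Mp}_2(\mathbb Z)$ be the group of pairs $(\gamma,\phi)$ with $\gamma=\left(\begin{smallmatrix}a&b\\c&d\end{smallmatrix}\right)\in\mathrm{SL}_2(\mathbb Z)$ and $\phi:\mathbb H\to\mathbb C$ holomorphic with $\phi(\tau)^2=c\tau+d$; it is generated by $\widetilde T=(\left(\begin{smallmatrix}1&1\\0&1\end{smallmatrix}\right),1)$ and $\widetilde S=(\left(\begin{smallmatrix}0&-1\\1&0\end{smallmatrix}\right),\sqrt\tau)$; put $\widetilde\Gamma_\infty=\langle\widetilde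 T\rangle$. The Weil representation $\varrho_L$ of $\widetilde\Gamma$ on $\mathbb C[L'/L]$ is given by $\varrho_L(\widetilde T)\mathfrak e_\mu=e(Q(\mu))\mathfrak e_\mu$ and $\varrho_L(\widetilde S)\mathfrak e_\mu=\frac{\sqrt i}{\sqrt 2}\sum_{\nu}e(-(\mu,\nu))\mathfrak e_\nu$, and $f|(\gamma,\phi)(\tau)=\phi(\tau)^{-3}\varrho_L(\gamma,\phi)^{-1}f(\gamma\tau)$ is the slash operator of weight $\frac32$. For a positive discriminant $D$ (an integer $D>0$ with $D\equiv0,1\bmod 4$) and real $w\neq0$ put $$\mathcal K_w(v)=\frac{w^2}{v^{3/2}}\int_1^\infty \exp\Big(-\pi\Big(\frac{wt}{\sqrt v}-\sqrt v\Big)^2\Big)t\,dt,\qquad \widetilde g_D(\tau,w)=\frac14\sum_{\gamma\in\widetilde\Gamma_\infty\backslash\widetilde\Gamma}\Big(\mathcal K_w(Dv)\,e\big(-\tfrac{D\tau}4\big)\mathfrak e_D\Big)\Big|\gamma .$$ Let $K\subset\mathbb H\times\mathbb R^+$ be compact, $v_0=\min\{\operatorname{Im}\tau:(\tau,r)\in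 K\}$, and $$\widetilde G_D(\tau,w)=\widetilde g_D(\tau,w)-\frac14\sum_{\substack{\gamma\in\widetilde\Gamma_\infty\backslash\widetilde\Gamma\\ D\operatorname{Im}(\gamma\tau)\ge v_0}}\Big(e\big(-\tfrac{D\tau}4\big)\mathfrak e_D\Big)\Big|\gamma .$$ **Proposition.** The series $\widetilde g_D(\tau,w)$ converges absolutely for $\tau\in\mathbb H$ and $w\ne0$, the truncated sum in $\widetilde G_D$ is finite, and for every real $s\neq 0$ the function $(u,v,y)\mapsto\widetilde g_D(u+iv,sy)$ is smooth on $\{v>0,\ y>0\}$. For every positive discriminant $D$ and every compact $K\subset\mathbb H\times\mathbb R^+$, the following estimates hold uniformly for $(\tau,y)\in K$, with implied constants that depend only on $K$ and $D$: $$\sum_{n\mid m}\Big(\frac{D}{m/n}\Big)\,n\,\widetilde G_{Dn^2}(\tau,my)=O_K\big(m^4e^{\frac32\pi my}\big)\quad(m\to\infty),\qquad \widetilde g_D(\tau,my)=O_K\big(m^2e^{2\pi my}\big)\quad(m\to-\infty).$$ Here $m$ runs through the integers, $n$ through the positive divisors of $m$, and $\big(\frac{D}{\cdot}\big)$ is the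 Kronecker symbol. Moreover, for every $k\ge0$ there is an exponent $N$, depending only on $k$, such that the same two estimates, with $m^4$ and $m^2$ replaced by $|m|^N$ and with implied constants depending only on $K$, $D$ and $k$, hold for all iterated partial derivatives of order $k$ in $u,v,y$ of the two functions of $(\tau,y)$ on the left-hand sides. Here the truncated sums are differentiated termwise, that is, in the derivatives at a point $(\tau_0,y_0)\in K$ each truncated sum is taken over the fixed finite set of $\gamma$ with $Dn^2\operatorname{Im}(\gamma\tau_0)\ge v_0$. -/

import Mathlib

open scoped ContDiff

namespace KM

noncomputable section

section Metaplectic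

open UpperHalfPlane ModularGroup
open scoped MatrixGroups Manifold

/-- The metaplectic group `Mp₂(ℤ)`: pairs `(γ, φ)` with `γ = (a b; c d) ∈ SL₂(ℤ)` and
`φ : ℍ → ℂ` holomorphic with `φ(τ)² = cτ + d`. -/
@[ext]
structure Mp2Z where
  mat : SL(2, ℤ)
  root : ℍ → ℂ
  holo : MDifferentiable 𝓘(ℂ) 𝓘(ℂ) root
  sq : ∀ τ : ℍ, root τ ^ 2 = ((mat 1 0 : ℤ) : ℂ) * (τ : ℂ) + ((mat 1 1 : ℤ) : ℂ)

namespace Mp2Z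

theorem sq_eq_denom (g : Mp2Z) (τ : ℍ) : g.root τ ^ 2 = denom g.mat τ := by
  rw [g.sq, ModularGroup.denom_apply]

theorem root_ne_zero (g : Mp2Z) (τ : ℍ) : g.root τ ≠ 0 := by
  intro h
  have h1 := g.sq_eq_denom τ
  rw [h] at h1
  exact denom_ne_zero _ τ (by rw [← h1]; simp)

theorem mdiff_smul (g : SL(2, ℤ)) : MDifferentiable 𝓘(ℂ) 𝓘(ℂ) (fun τ : ℍ => g • τ) := by
  have := mdifferentiable_smul (g := (g : GL (Fin 2) ℝ)) (by simp)
  exact this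

theorem denom_mul_eq (g h : SL(2, ℤ)) (τ : ℍ) :
    denom (g * h : SL(2, ℤ)) τ = denom g (h • τ : ℍ) * denom h τ := by
  have := denom_cocycle (g : GL (Fin 2) ℝ) (h : GL (Fin 2) ℝ) (z := (τ : ℂ)) τ.im_ne_zero
  rw [sl_moeb, coe_smul_of_det_pos (by simp), ← this, ← map_mul, ← map_mul]

/-- `(γ, φ)(γ', φ') = (γγ', φ(γ'τ) φ'(τ))`. -/
instance : Mul Mp2Z where
  mul g h :=
    { mat := g.mat * h.mat
      root := fun τ => g.root (h.mat • τ) * h.root τ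
      holo := (g.holo.comp (mdiff_smul h.mat)).mul h.holo
      sq := fun τ => by
        rw [mul_pow, g.sq_eq_denom, h.sq_eq_denom, ← denom_mul_eq, ModularGroup.denom_apply] }

instance : One Mp2Z where
  one :=
    { mat := 1
      root := fun _ => 1
      holo := mdifferentiable_const
      sq := fun τ => by simp }

instance : Inv Mp2Z where
  inv g :=
    { mat := g.mat⁻¹
      root := fun τ => (g.root (g.mat⁻¹ • τ))⁻¹
      holo := by
        have h := g.holo.comp (mdiff_smul g.mat⁻¹)
        rw [mdifferentiable_iff] at h ⊢
        exact h.inv (fun z _ => g.root_ne_zero _)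
      sq := fun τ => by
        have h := denom_mul_eq g.mat g.mat⁻¹ τ
        rw [mul_inv_cancel] at h
        have h1 : denom (1 : SL(2, ℤ)) (τ : ℂ) = 1 := by simp
        rw [inv_pow, g.sq_eq_denom, ← ModularGroup.denom_apply]
        rw [h1] at h
        rw [eq_inv_of_mul_eq_one_left h.symm, inv_inv] }

@[simp] theorem mul_mat (g h : Mp2Z) : (g * h).mat = g.mat * h.mat := rfl
@[simp] theorem mul_root (g h : Mp2Z) (τ : ℍ) :
    (g * h).root τ = g.root (h.mat • τ) * h.root τ := rfl
@[simp] theorem one_mat : (1 : Mp2Z).mat = 1 := rfl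
@[simp] theorem one_root (τ : ℍ) : (1 : Mp2Z).root τ = 1 := rfl
@[simp] theorem inv_mat (g : Mp2Z) : g⁻¹.mat = g.mat⁻¹ := rfl
@[simp] theorem inv_root (g : Mp2Z) (τ : ℍ) : g⁻¹.root τ = (g.root (g.mat⁻¹ • τ))⁻¹ := rfl

instance : Group Mp2Z :=
  Group.ofLeftAxioms
    (fun a b c => by
      ext1
      · simp [mul_assoc]
      · funext τ; simp [mul_smul, mul_assoc])
    (fun a => by
      ext1
      · simp
      · funext τ; simp)
    (fun a => by
      ext1
      · simp
      · funext τ; simp [a.root_ne_zero])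

/-- The generator `T̃ = ((1 1; 0 1), 1)`. -/
def T : Mp2Z where
  mat := ModularGroup.T
  root := fun _ => 1
  holo := mdifferentiable_const
  sq := fun τ => by simp [ModularGroup.T]

/-- The generator `S̃ = ((0 -1; 1 0), √τ)`, principal branch. -/
def S : Mp2Z where
  mat := ModularGroup.S
  root := fun τ => (τ : ℂ) ^ (1 / 2 : ℂ)
  holo := by
    rw [mdifferentiable_iff]
    have h : DifferentiableOn ℂ (fun z : ℂ => z ^ (1 / 2 : ℂ)) {z | 0 < z.im} := fun z hz =>
      (DifferentiableAt.cpow (differentiableAt_id) (differentiableAt_const _)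
        (Or.inr (ne_of_gt hz))).differentiableWithinAt
    refine h.congr fun z hz => ?_
    simp [Function.comp, ofComplex_apply_of_im_pos hz]
  sq := fun τ => by
    rw [← Complex.cpow_nat_mul]
    simp [ModularGroup.S]

theorem S_root_sq (τ : ℍ) : S.root τ ^ 2 = τ := by
  rw [S.sq τ]
  simp [S, ModularGroup.S]

theorem S_pow_four_root (τ : ℍ) : (S ^ 4).root τ = -1 := by
  have e : S ^ 4 = (S * S) * (S * S) := by simp only [pow_succ, pow_zero, one_mul, mul_assoc]
  have hm : (S * S).mat • τ = τ := by
    have : (S * S).mat = -1 := by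
      show ModularGroup.S * ModularGroup.S = -1
      decide
    rw [this, ModularGroup.SL_neg_smul, one_smul]
  rw [e, mul_root (S * S), hm, mul_root, ← pow_two, mul_pow, S_root_sq, S_root_sq]
  show ((ModularGroup.S • τ : ℍ) : ℂ) * τ = -1
  have := ne_zero τ
  rw [modular_S_smul]
  simp [this]

theorem S_pow_four_mat : (S ^ 4).mat = 1 := by
  have e : S ^ 4 = (S * S) * (S * S) := by simp only [pow_succ, pow_zero, one_mul, mul_assoc]
  rw [e]
  show (ModularGroup.S * ModularGroup.S) * (ModularGroup.S * ModularGroup.S) = 1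
  decide

theorem eq_of_mat_eq_one (g : Mp2Z) (h : g.mat = 1) : g = 1 ∨ g = S ^ 4 := by
  have h1 : MDifferentiable 𝓘(ℂ) 𝓘(ℂ) (fun τ => g.root τ - 1) :=
    g.holo.sub mdifferentiable_const
  have h2 : MDifferentiable 𝓘(ℂ) 𝓘(ℂ) (fun τ => g.root τ + 1) :=
    g.holo.add mdifferentiable_const
  have h3 : (fun τ => g.root τ - 1) * (fun τ => g.root τ + 1) = 0 := by
    funext τ
    have := g.sq τ
    simp [h] at this
    rcases this with h | h <;> simp [h]
  rcases (mul_eq_zero_iff h1 h2).1 h3 with h4 | h4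
  · left
    ext1
    · simp [h]
    · funext τ
      have := congrFun h4 τ
      simpa [sub_eq_zero] using this
  · right
    ext1
    · rw [h, S_pow_four_mat]
    · funext τ
      have := congrFun h4 τ
      rw [S_pow_four_root]
      exact eq_neg_of_add_eq_zero_left this

/-- The projection `Mp₂(ℤ) → SL₂(ℤ)`. -/
def matHom : Mp2Z →* SL(2, ℤ) where
  toFun := mat
  map_one' := rfl
  map_mul' _ _ := rfl

/-- `Mp₂(ℤ)` is generated by `S̃` and `T̃`. -/
theorem closure_S_T : Subgroup.closure ({S, T} : Set Mp2Z) = ⊤ := by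
  rw [eq_top_iff]
  intro g _
  have h1 : (Subgroup.closure ({S, T} : Set Mp2Z)).map matHom = ⊤ := by
    rw [MonoidHom.map_closure, Set.image_pair, ← SpecialLinearGroup.SL2Z_generators]
    rfl
  have h2 : g.mat ∈ (Subgroup.closure ({S, T} : Set Mp2Z)).map matHom := by
    rw [h1]; trivial
  obtain ⟨k, hk, hkg⟩ := h2
  have hS : S ∈ Subgroup.closure ({S, T} : Set Mp2Z) := Subgroup.subset_closure (by simp)
  have h3 : (g * k⁻¹).mat = 1 := by
    have : k.mat = g.mat := hkg
    simp [this]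
  have h4 : g * k⁻¹ ∈ Subgroup.closure ({S, T} : Set Mp2Z) := by
    rcases eq_of_mat_eq_one _ h3 with h | h
    · rw [h]; exact one_mem _
    · rw [h]; exact pow_mem hS 4
  have := mul_mem h4 hk
  simpa using this
end Mp2Z

/-! The existence of the Weil representation with the prescribed values on the generators is
proved below from the transformation behaviour of the two theta functions
`∑ e(n² τ)` and `∑ e((n + 1/2)² τ)`. -/

theorem zmod_two_cases (i : ZMod 2) : i = 0 ∨ i = 1 := by revert i; decide

/-- The pair of theta functions `∑ e((n + μ/2)² τ)`, `μ = 0, 1`. -/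
def thetaVec (τ : ℍ) : ZMod 2 → ℂ :=
  fun μ => if μ = 0 then jacobiTheta₂ 0 (2 * τ) else
    Complex.exp (Real.pi * Complex.I * τ / 2) * jacobiTheta₂ τ (2 * τ)

theorem thetaVec_zero (τ : ℍ) : thetaVec τ 0 = jacobiTheta₂ 0 (2 * τ) := rfl
theorem thetaVec_one (τ : ℍ) : thetaVec τ 1 =
  Complex.exp (Real.pi * Complex.I * τ / 2) * jacobiTheta₂ τ (2 * τ) := rfl

theorem hasSum_even_odd {f : ℤ → ℂ} {a b : ℂ} (he : HasSum (fun k => f (2 * k)) a)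
    (ho : HasSum (fun k => f (2 * k + 1)) b) : HasSum f (a + b) := by
  have h := mul_right_injective₀ (two_ne_zero' ℤ)
  replace ho := ((add_left_injective 1).comp h).hasSum_range_iff.2 ho
  refine (h.hasSum_range_iff.2 he).add_isCompl ?_ ho
  have h2 : Set.range (fun x : ℤ => 2 * x) = {n | Even n} := by
    ext n; simp [even_iff_exists_two_mul]
  have h3 : Set.range ((fun x : ℤ => x + 1) ∘ fun x => 2 * x) = {n | Odd n} := by
    ext n; simp [Odd, eq_comm]
  rw [h2, h3]
  exact Int.isCompl_even_odd

theorem hasSum_congr_fun {f g : ℤ → ℂ} {a : ℂ} (h : HasSum f a) (e : ∀ n, g n = f n) :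
    HasSum g a := (funext e : g = f) ▸ h

theorem jacobi_split (z τ : ℂ) (h : 0 < τ.im) : jacobiTheta₂ z (τ / 2) =
    jacobiTheta₂ (2 * z) (2 * τ) + Complex.exp (2 * Real.pi * Complex.I * z) *
    (Complex.exp (Real.pi * Complex.I * τ / 2) * jacobiTheta₂ (2 * z + τ) (2 * τ)) := by
  have h2 : 0 < (2 * τ).im := by simpa using h
  have h3 := hasSum_jacobiTheta₂_term (2 * z) h2
  have h4 := (hasSum_jacobiTheta₂_term (2 * z + τ) h2).mul_left
    (Complex.exp (2 * Real.pi * Complex.I * z) * Complex.exp (Real.pi * Complex.I * τ / 2))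
  rw [← mul_assoc]
  refine HasSum.tsum_eq (hasSum_even_odd ?_ ?_)
  · refine hasSum_congr_fun h3 fun n => ?_
    simp only [jacobiTheta₂_term]
    push_cast
    ring_nf
  · refine hasSum_congr_fun h4 fun n => ?_
    simp only [jacobiTheta₂_term]
    rw [← Complex.exp_add, ← Complex.exp_add]
    push_cast
    ring_nf

theorem thetaVec_T (τ : ℍ) : thetaVec (Mp2Z.T.mat • τ) 0 = thetaVec τ 0 ∧
    thetaVec (Mp2Z.T.mat • τ) 1 = Complex.I * thetaVec τ 1 := by
  have h : ((Mp2Z.T.mat • τ : ℍ) : ℂ) = τ + 1 := by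
    show ((ModularGroup.T • τ : ℍ) : ℂ) = τ + 1
    rw [modular_T_smul, coe_vadd]; push_cast; ring
  have e : (2 * ((τ : ℂ) + 1)) = 2 * τ + 2 := by ring
  constructor
  · rw [thetaVec_zero, h, thetaVec_zero, e, jacobiTheta₂_add_right]
  · rw [thetaVec_one, h, thetaVec_one, e, jacobiTheta₂_add_right, jacobiTheta₂_add_left]
    have e2 : Real.pi * Complex.I * ((τ : ℂ) + 1) / 2 =
      Real.pi / 2 * Complex.I + Real.pi * Complex.I * τ / 2 := by ring
    rw [e2, Complex.exp_add, Complex.exp_pi_div_two_mul_I, mul_assoc]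

theorem mul_cpow_aux {x y : ℂ} (hx : x ≠ 0) (hy : y ≠ 0)
    (h : x.arg + y.arg ∈ Set.Ioc (-Real.pi) Real.pi) (r : ℂ) : (x * y) ^ r = x ^ r * y ^ r := by
  rw [Complex.cpow_def_of_ne_zero (mul_ne_zero hx hy), Complex.cpow_def_of_ne_zero hx,
    Complex.cpow_def_of_ne_zero hy, (Complex.log_mul_eq_add_log_iff hx hy).2 h, ← Complex.exp_add,
    add_mul]

theorem sqrt_aux (τ : ℍ) : (-Complex.I * (τ / 2)) ^ (1 / 2 : ℂ) =
    (τ : ℂ) ^ (1 / 2 : ℂ) * ((-Complex.I) ^ (1 / 2 : ℂ) / (√2 : ℝ)) := by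
  have h0 : (τ : ℂ) ≠ 0 := ne_zero τ
  have harg : (-Complex.I : ℂ).arg + (τ : ℂ).arg ∈ Set.Ioc (-Real.pi) Real.pi := by
    have h1 : 0 ≤ (τ : ℂ).arg := Complex.arg_nonneg_iff.2 τ.im_pos.le
    have h2 := Complex.arg_le_pi (τ : ℂ)
    have := Real.pi_pos
    rw [Complex.arg_neg_I]
    constructor <;> linarith
  have hm : (-Complex.I * τ) ^ (1 / 2 : ℂ) = (-Complex.I) ^ (1 / 2 : ℂ) * (τ : ℂ) ^ (1 / 2 : ℂ) :=
    mul_cpow_aux (by simp) h0 harg _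
  have e : -Complex.I * ((τ : ℂ) / 2) = ((1 / 2 : ℝ) : ℂ) * (-Complex.I * τ) := by
    push_cast; ring
  rw [e, mul_cpow_aux (by simp) (by simp [h0]) (by
    rw [Complex.arg_ofReal_of_nonneg (by norm_num), zero_add]
    exact ⟨Complex.neg_pi_lt_arg _, Complex.arg_le_pi _⟩), hm]
  have h2 : ((1 / 2 : ℝ) : ℂ) ^ (1 / 2 : ℂ) = 1 / (√2 : ℝ) := by
    rw [show (1 / 2 : ℂ) = ((1 / 2 : ℝ) : ℂ) by push_cast; rfl, ← Complex.ofReal_cpow (by norm_num),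
      ← Real.sqrt_eq_rpow]
    simp
  rw [h2]
  ring

theorem thetaVec_S (τ : ℍ) :
    thetaVec (Mp2Z.S.mat • τ) 0 = Mp2Z.S.root τ * ((-Complex.I) ^ (1 / 2 : ℂ) / (√2 : ℝ)) *
      (thetaVec τ 0 + thetaVec τ 1) ∧
    thetaVec (Mp2Z.S.mat • τ) 1 = Mp2Z.S.root τ * ((-Complex.I) ^ (1 / 2 : ℂ) / (√2 : ℝ)) *
      (thetaVec τ 0 - thetaVec τ 1) := by
  have h0 : (τ : ℂ) ≠ 0 := ne_zero τ
  have h : ((Mp2Z.S.mat • τ : ℍ) : ℂ) = -1 / τ := by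
    show ((ModularGroup.S • τ : ℍ) : ℂ) = _
    rw [modular_S_smul]
    simp [neg_div]
  have hr : Mp2Z.S.root τ * ((-Complex.I) ^ (1 / 2 : ℂ) / (√2 : ℝ)) =
      (-Complex.I * (τ / 2)) ^ (1 / 2 : ℂ) := (sqrt_aux τ).symm
  have hne : (-Complex.I * ((τ : ℂ) / 2)) ^ (1 / 2 : ℂ) ≠ 0 := by
    rw [Ne, Complex.cpow_eq_zero_iff]
    simp [h0]
  have e1 : (2 * (-1 / (τ : ℂ))) = -1 / (τ / 2) := by field_simp
  rw [hr]
  constructor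
  · have s0 := jacobi_split 0 τ τ.im_pos
    have f0 := jacobiTheta₂_functional_equation 0 (τ / 2)
    rw [thetaVec_zero, h, e1, thetaVec_zero, thetaVec_one]
    rw [f0] at s0
    simp only [mul_zero, Complex.exp_zero, one_mul, zero_add, zero_div,
      ne_eq, OfNat.ofNat_ne_zero, not_false_eq_true, zero_pow, mul_one] at s0
    rw [← s0]
    field_simp
  · have s1 := jacobi_split (1 / 2) τ τ.im_pos
    have f1 := jacobiTheta₂_functional_equation (1 / 2) (τ / 2)
    rw [thetaVec_one, h, e1, thetaVec_zero, thetaVec_one, ← jacobiTheta₂_neg_left]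
    rw [f1] at s1
    have a1 : (1 / 2 : ℂ) / (τ / 2) = -(-1 / τ) := by field_simp
    have a2 : -(Real.pi : ℂ) * Complex.I * (1 / 2) ^ 2 / (τ / 2) =
      Real.pi * Complex.I * (-1 / τ) / 2 := by field_simp
    have a3 : Complex.exp (2 * Real.pi * Complex.I * (1 / 2)) = -1 := by
      rw [← Complex.exp_pi_mul_I]; ring_nf
    have a4 : (2 * (1 / 2) : ℂ) = 1 := by norm_num
    have a5 : jacobiTheta₂ 1 (2 * τ) = jacobiTheta₂ 0 (2 * τ) := by
      simpa using jacobiTheta₂_add_left 0 (2 * τ)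
    have a6 : jacobiTheta₂ (1 + τ) (2 * τ) = jacobiTheta₂ τ (2 * τ) := by
      rw [add_comm, jacobiTheta₂_add_left]
    rw [a1, a2, a3, a4, a5, a6, neg_one_mul, ← sub_eq_add_neg] at s1
    rw [← s1]
    field_simp

theorem thetaVec_ne_zero (μ : ZMod 2) : thetaVec UpperHalfPlane.I μ ≠ 0 := by
  have key : ∀ z : ℂ, z.re = 0 → jacobiTheta₂ z (2 * Complex.I) ≠ 0 := by
    intro z hz
    have hs := hasSum_jacobiTheta₂_term z (τ := 2 * Complex.I) (by simp)
    have hs2 := Complex.hasSum_re hs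
    have hre : ∀ n : ℤ, 0 < (jacobiTheta₂_term n z (2 * Complex.I)).re := by
      intro n
      obtain ⟨w, rfl⟩ : ∃ w : ℝ, z = w * Complex.I := ⟨z.im, by
        apply Complex.ext <;> simp [hz]⟩
      have : jacobiTheta₂_term n (w * Complex.I) (2 * Complex.I) =
          ((Real.exp (-2 * Real.pi * n * w - 2 * Real.pi * n ^ 2) : ℝ) : ℂ) := by
        rw [jacobiTheta₂_term]
        push_cast
        congr 1
        linear_combination (2 * Real.pi * n * w + 2 * Real.pi * n ^ 2) * Complex.I_mul_I
      rw [this, Complex.ofReal_re]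
      exact Real.exp_pos _
    intro h0
    rw [h0] at hs2
    have := (hasSum_zero_iff_of_nonneg (fun n => (hre n).le)).1 (by simpa using hs2)
    exact (hre 0).ne' (congrFun this 0)
  have hI : ((UpperHalfPlane.I : ℍ) : ℂ) = Complex.I := rfl
  rcases zmod_two_cases μ with rfl | rfl
  · rw [thetaVec_zero, hI]
    exact key 0 rfl
  · rw [thetaVec_one, hI]
    exact mul_ne_zero (Complex.exp_ne_zero _) (key _ (by simp))

/-- The two theta functions are linearly independent. -/
theorem thetaVec_independent (a b : ℂ) (h : ∀ τ, a * thetaVec τ 0 + b * thetaVec τ 1 = 0) :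
    a = 0 ∧ b = 0 := by
  have h1 := h UpperHalfPlane.I
  have h2 := h (Mp2Z.T.mat • UpperHalfPlane.I)
  rw [(thetaVec_T _).1, (thetaVec_T _).2] at h2
  have h3 : (Complex.I - 1) * (b * thetaVec UpperHalfPlane.I 1) = 0 := by linear_combination h2 - h1
  have h4 : (Complex.I - 1 : ℂ) ≠ 0 := by
    intro h; simpa using congrArg Complex.im h
  have hb : b = 0 := by simpa [h4, thetaVec_ne_zero 1] using h3
  subst hb
  refine ⟨?_, rfl⟩
  simpa [thetaVec_ne_zero 0] using h1

open Matrix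

theorem sum_zmod_two (f : ZMod 2 → ℂ) : ∑ i, f i = f 0 + f 1 :=
  Fin.sum_univ_two (fun j : Fin 2 => f j)

theorem mulVec_eq_sum_two (M : Matrix (ZMod 2) (ZMod 2) ℂ) (x : ZMod 2 → ℂ) (i : ZMod 2) :
    (M *ᵥ x) i = M i 0 * x 0 + M i 1 * x 1 :=
  sum_zmod_two (fun j => M i j * x j)

/-- `A` is the matrix by which `(γ, φ)` transforms the vector of theta functions. -/
def ThetaRel (g : Mp2Z) (A : GL (ZMod 2) ℂ) : Prop :=
  ∀ τ : ℍ, thetaVec (g.mat • τ) = g.root τ • (A.1 *ᵥ thetaVec τ)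

theorem ThetaRel.mul {g h : Mp2Z} {A B : GL (ZMod 2) ℂ} (hg : ThetaRel g A) (hh : ThetaRel h B) :
    ThetaRel (g * h) (A * B) := by
  intro τ
  rw [Mp2Z.mul_mat, mul_smul, hg, hh, Mp2Z.mul_root, Units.val_mul, ← mulVec_mulVec, mulVec_smul,
    smul_smul]

theorem ThetaRel.inv {g : Mp2Z} {A : GL (ZMod 2) ℂ} (hg : ThetaRel g A) :
    ThetaRel g⁻¹ A⁻¹ := by
  intro τ
  have h := hg (g.mat⁻¹ • τ)
  rw [smul_inv_smul] at h
  rw [Mp2Z.inv_mat, Mp2Z.inv_root, h, mulVec_smul, mulVec_mulVec, ← Units.val_mul, inv_mul_cancel,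
    Units.val_one, one_mulVec, smul_smul, inv_mul_cancel₀ (g.root_ne_zero _), one_smul]

theorem ThetaRel.unique {g : Mp2Z} {A B : GL (ZMod 2) ℂ} (hA : ThetaRel g A) (hB : ThetaRel g B) :
    A = B := by
  have h : ∀ τ, A.1 *ᵥ thetaVec τ = B.1 *ᵥ thetaVec τ := fun τ => by
    have := (hA τ).symm.trans (hB τ)
    exact smul_right_injective _ (g.root_ne_zero τ) this
  have h2 : ∀ i, A.1 i 0 - B.1 i 0 = 0 ∧ A.1 i 1 - B.1 i 1 = 0 := fun i =>
    thetaVec_independent _ _ fun τ => by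
      have h3 := congrFun (h τ) i
      have e : ∀ M : Matrix (ZMod 2) (ZMod 2) ℂ, (M *ᵥ thetaVec τ) i =
          M i 0 * thetaVec τ 0 + M i 1 * thetaVec τ 1 := fun M => by
        rw [mulVec_eq_sum_two]
      rw [e, e] at h3
      linear_combination h3
  ext i j
  rcases zmod_two_cases j with rfl | rfl
  · exact sub_eq_zero.1 (h2 i).1
  · exact sub_eq_zero.1 (h2 i).2

open ComplexConjugate

/-- `e(x) = exp(2πix)`. -/
def e (x : ℂ) : ℂ := Complex.exp (2 * Real.pi * Complex.I * x)

/-- The vector `(-b/2  -c; a  b/2)` of the dual lattice `L'`; it lies in `L` iff `b` is even, so that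
the class in `L'/L ≅ ℤ/2ℤ` is `b mod 2`. -/
def dualVec (a b c : ℤ) : Matrix (Fin 2) (Fin 2) ℝ := !![-(b / 2), -c; a, b / 2]

/-- The quadratic form `Q(λ) = det λ`. -/
def latQ (l : Matrix (Fin 2) (Fin 2) ℝ) : ℝ := l.det

/-- The bilinear form `(λ, ν) = -tr(λν)`. -/
def latB (l n : Matrix (Fin 2) (Fin 2) ℝ) : ℝ := -(l * n).trace

/-- A representative in `L'` of the class `μ ∈ L'/L ≅ ℤ/2ℤ`. -/
def discRep (μ : ZMod 2) : Matrix (Fin 2) (Fin 2) ℝ := dualVec 0 (μ.val : ℤ) 0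

/-- `e_μ ↦ e(Q(μ)) e_μ`. -/
def weilT : Matrix (ZMod 2) (ZMod 2) ℂ := diagonal fun μ => e (latQ (discRep μ))

/-- `e_μ ↦ √i / √|L'/L| ∑_ν e(-(μ, ν)) e_ν`, as the matrix with entries in row `ν`, column `μ`. -/
def weilS : Matrix (ZMod 2) (ZMod 2) ℂ :=
  of fun ν μ => Complex.I ^ (1 / 2 : ℂ) / (√(Fintype.card (ZMod 2)) : ℝ) * 
    e (-latB (discRep μ) (discRep ν))

theorem e_add (x y : ℂ) : e (x + y) = e x * e y := by
  rw [e, e, e, ← Complex.exp_add]; ring_nf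

theorem e_int (n : ℤ) : e n = 1 := by
  rw [e, Complex.exp_eq_one_iff]; exact ⟨n, by ring⟩

theorem latQ_dualVec (a b c : ℤ) : latQ (dualVec a b c) = a * c - (b : ℝ) ^ 2 / 4 := by
  simp [latQ, dualVec, det_fin_two]; ring

theorem latB_dualVec (a b c a' b' c' : ℤ) : latB (dualVec a b c) (dualVec a' b' c') =
    a * c' + c * a' - (b : ℝ) * b' / 2 := by
  simp [latB, dualVec, Matrix.trace_fin_two]; ring

/-- `e(Q(λ))` depends only on the class of `λ ∈ L'` in `L'/L`. -/
theorem e_latQ_dualVec (a b c : ℤ) :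
    e (latQ (dualVec a b c)) = e (latQ (discRep (b : ZMod 2))) := by
  have h : ∃ k : ℤ, b = ((b : ZMod 2).val : ℤ) + 2 * k := by
    have h1 : (2 : ℤ) ∣ b - ((b : ZMod 2).val : ℤ) := by
      have h2 : ((b - ((b : ZMod 2).val : ℤ) : ℤ) : ZMod 2) = 0 := by simp
      exact (ZMod.intCast_zmod_eq_zero_iff_dvd _ 2).1 h2
    obtain ⟨k, hk⟩ := h1
    exact ⟨k, by linarith⟩
  obtain ⟨k, hk⟩ := h
  set r : ℤ := ((b : ZMod 2).val : ℤ) with hr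
  have h2 : (latQ (dualVec a b c) : ℂ) = (latQ (discRep (b : ZMod 2)) : ℂ) +
      ((a * c - r * k - k ^ 2 : ℤ) : ℂ) := by
    rw [discRep, ← hr, latQ_dualVec, latQ_dualVec, hk]
    push_cast
    ring
  rw [h2, e_add, e_int, mul_one]

theorem e_neg_quarter : e ((-1 / 4 : ℝ) : ℂ) = -Complex.I := by
  rw [e, ← Complex.exp_neg_pi_div_two_mul_I]; congr 1; push_cast; ring

theorem e_half : e ((1 / 2 : ℝ) : ℂ) = -1 := by
  rw [e, ← Complex.exp_pi_mul_I]; congr 1; push_cast; ring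

theorem e_zero : e 0 = 1 := by simp [e]

/-- `diag(1, x)`. -/
def diagTwo (x : ℂ) : Matrix (ZMod 2) (ZMod 2) ℂ := diagonal fun μ => if μ = 0 then 1 else x

/-- The matrix `(1 1; 1 -1)`. -/
def signMat : Matrix (ZMod 2) (ZMod 2) ℂ := of fun ν μ => if ν = 1 ∧ μ = 1 then -1 else 1

theorem weilT_eq : weilT = diagTwo (-Complex.I) := by
  rw [weilT, diagTwo]
  congr 1
  funext μ
  rcases zmod_two_cases μ with rfl | rfl
  · show e (latQ (dualVec 0 0 0)) = 1
    rw [latQ_dualVec]; simp [e_zero]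
  · show e (latQ (dualVec 0 1 0)) = -Complex.I
    rw [latQ_dualVec, ← e_neg_quarter]; norm_num

theorem weilS_eq : weilS = (Complex.I ^ (1 / 2 : ℂ) / (√2 : ℝ)) • signMat := by
  ext ν μ
  have h : (√(Fintype.card (ZMod 2)) : ℝ) = √2 := by norm_num [ZMod.card]
  rw [weilS, of_apply, h, Matrix.smul_apply, smul_eq_mul]
  congr 1
  rcases zmod_two_cases ν with rfl | rfl <;> rcases zmod_two_cases μ with rfl | rfl
  · show e (-latB (dualVec 0 0 0) (dualVec 0 0 0)) = 1
    rw [latB_dualVec]; simp [e_zero]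
  · show e (-latB (dualVec 0 1 0) (dualVec 0 0 0)) = 1
    rw [latB_dualVec]; simp [e_zero]
  · show e (-latB (dualVec 0 0 0) (dualVec 0 1 0)) = 1
    rw [latB_dualVec]; simp [e_zero]
  · show e (-latB (dualVec 0 1 0) (dualVec 0 1 0)) = -1
    rw [latB_dualVec, ← e_half]; norm_num

theorem conj_sqrt_I : conj ((-Complex.I) ^ (1 / 2 : ℂ)) = Complex.I ^ (1 / 2 : ℂ) := by
  have h := Complex.conj_cpow (-Complex.I) (1 / 2) (by
    rw [Complex.arg_neg_I]; have := Real.pi_pos; intro h; linarith)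
  have h2 : conj (1 / 2 : ℂ) = 1 / 2 := by
    rw [map_div₀, map_one, map_ofNat]
  rw [h2] at h
  rw [← h]
  simp

theorem diagTwo_mul (x y : ℂ) (h : x * y = 1) : diagTwo x * diagTwo y = 1 := by
  rw [diagTwo, diagTwo, diagonal_mul_diagonal, ← diagonal_one]
  congr 1
  funext i
  rcases zmod_two_cases i with rfl | rfl <;> simp [h]

theorem signMat_sq : signMat * signMat = (2 : ℂ) • 1 := by
  ext i j
  rw [mul_apply, sum_zmod_two]
  rcases zmod_two_cases i with rfl | rfl <;> rcases zmod_two_cases j with rfl | rfl <;>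
    norm_num [signMat]

/-- `√(-i) / √2`. -/
def sqrtFactor : ℂ := (-Complex.I) ^ (1 / 2 : ℂ) / (√2 : ℝ)

theorem sqrtFactor_ne_zero : sqrtFactor ≠ 0 := by
  rw [sqrtFactor, div_ne_zero_iff, Ne, Complex.cpow_eq_zero_iff]
  simp

theorem thetaRel_T : ThetaRel Mp2Z.T
    ⟨diagTwo Complex.I, diagTwo (-Complex.I), diagTwo_mul _ _ (by simp),
      diagTwo_mul _ _ (by simp)⟩ := by
  intro τ
  have h1 : Mp2Z.T.root τ = 1 := rfl
  funext μ
  rw [h1, one_smul, mulVec_eq_sum_two]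
  rcases zmod_two_cases μ with rfl | rfl
  · rw [(thetaVec_T τ).1]; simp [diagTwo]
  · rw [(thetaVec_T τ).2]; simp [diagTwo]

theorem thetaRel_S : ThetaRel Mp2Z.S
    ⟨sqrtFactor • signMat, (sqrtFactor⁻¹ / 2) • signMat,
      by
        have := sqrtFactor_ne_zero
        rw [smul_mul_smul_comm, signMat_sq, smul_smul]
        field_simp; simp,
      by
        have := sqrtFactor_ne_zero
        rw [smul_mul_smul_comm, signMat_sq, smul_smul]
        field_simp; simp⟩ := by
  intro τ
  funext μ
  rw [Pi.smul_apply, mulVec_eq_sum_two]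
  rcases zmod_two_cases μ with rfl | rfl
  · rw [(thetaVec_S τ).1]
    simp [signMat, sqrtFactor]
    ring
  · rw [(thetaVec_S τ).2]
    simp [signMat, sqrtFactor]
    ring

theorem exists_thetaRel (g : Mp2Z) : ∃ A, ThetaRel g A := by
  have hg : g ∈ Subgroup.closure ({Mp2Z.S, Mp2Z.T} : Set Mp2Z) := by
    rw [Mp2Z.closure_S_T]; trivial
  induction hg using Subgroup.closure_induction with
  | mem x hx =>
    rcases hx with rfl | rfl
    · exact ⟨_, thetaRel_S⟩
    · exact ⟨_, thetaRel_T⟩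
  | one => exact ⟨1, fun τ => by simp⟩
  | mul x y _ _ hx hy =>
    obtain ⟨A, hA⟩ := hx
    obtain ⟨B, hB⟩ := hy
    exact ⟨A * B, hA.mul hB⟩
  | inv x _ hx =>
    obtain ⟨A, hA⟩ := hx
    exact ⟨A⁻¹, hA.inv⟩

/-- There is a representation of `Mp₂(ℤ)` with the prescribed values on `T̃` and `S̃`. -/
theorem exists_weilRep : ∃ ρ : Mp2Z →* Matrix (ZMod 2) (ZMod 2) ℂ,
    ρ Mp2Z.T = weilT ∧ ρ Mp2Z.S = weilS := by
  choose A hA using exists_thetaRel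
  let ρ : Mp2Z →* GL (ZMod 2) ℂ :=
    { toFun := A
      map_one' := (hA 1).unique (fun τ => by simp)
      map_mul' := fun g h => (hA _).unique ((hA g).mul (hA h)) }
  refine ⟨((starRingEnd ℂ).mapMatrix.toMonoidHom).comp ((Units.coeHom _).comp ρ), ?_, ?_⟩
  · have h : A Mp2Z.T = _ := (hA _).unique thetaRel_T
    show (A Mp2Z.T).1.map conj = _
    rw [h, weilT_eq]
    ext i j
    rcases zmod_two_cases i with rfl | rfl <;> rcases zmod_two_cases j with rfl | rfl <;>
      simp [diagTwo]
  · have h : A Mp2Z.S = _ := (hA _).unique thetaRel_S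
    show (A Mp2Z.S).1.map conj = _
    rw [h, weilS_eq]
    ext i j
    have hc : conj sqrtFactor = Complex.I ^ (1 / 2 : ℂ) / (√2 : ℝ) := by
      rw [sqrtFactor, map_div₀, conj_sqrt_I, Complex.conj_ofReal]
    have hh : conj (signMat i j) = signMat i j := by
      simp only [signMat, of_apply]; split_ifs <;> simp
    simp only [map_apply, Matrix.smul_apply, smul_eq_mul, map_mul, hc, hh]

/-- A representation of `Mp₂(ℤ)` is determined by its values on `T̃` and `S̃`. -/
theorem weilRep_unique (ρ ρ' : Mp2Z →* Matrix (ZMod 2) (ZMod 2) ℂ)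
    (hT : ρ Mp2Z.T = ρ' Mp2Z.T) (hS : ρ Mp2Z.S = ρ' Mp2Z.S) : ρ = ρ' := by
  refine MonoidHom.eq_of_eqOn_dense Mp2Z.closure_S_T ?_
  rintro x (rfl | rfl)
  · exact hS
  · exact hT

/-- The Weil representation `ϱ_L` of `Mp₂(ℤ)` on `ℂ[L'/L] = ℂ^{ℤ/2ℤ}`. -/
def weilRep : Mp2Z →* Matrix (ZMod 2) (ZMod 2) ℂ := exists_weilRep.choose

theorem weilRep_T : weilRep Mp2Z.T = weilT := exists_weilRep.choose_spec.1
theorem weilRep_S : weilRep Mp2Z.S = weilS := exists_weilRep.choose_spec.2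

/-- The weight `3/2` slash operator `(f|(γ, φ))(τ) = φ(τ)⁻³ ϱ_L(γ, φ)⁻¹ f(γτ)`. -/
def slash (f : ℍ → ZMod 2 → ℂ) (g : Mp2Z) (τ : ℍ) : ZMod 2 → ℂ :=
  (g.root τ) ^ (-3 : ℤ) • (weilRep g⁻¹ *ᵥ f (g.mat • τ))

theorem slash_mul (f : ℍ → ZMod 2 → ℂ) (g h : Mp2Z) :
    slash f (g * h) = slash (slash f g) h := by
  funext τ
  simp only [slash, Mp2Z.mul_root, Mp2Z.mul_mat, _root_.mul_inv_rev, map_mul, mul_smul, mul_zpow,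
    mulVec_smul, mulVec_mulVec]
  rw [smul_comm]

theorem slash_one (f : ℍ → ZMod 2 → ℂ) : slash f 1 = f := by
  funext τ; simp [slash]

/-- The cosets `Γ̃_∞ \ Γ̃`, where `Γ̃_∞` is generated by `T̃`. -/
abbrev Coset : Type := Quotient (QuotientGroup.rightRel (Subgroup.zpowers Mp2Z.T))

theorem slash_zpow_T (f : ℍ → ZMod 2 → ℂ) (hf : slash f Mp2Z.T = f) (n : ℤ) :
    slash f (Mp2Z.T ^ n) = f := by
  have hinv : slash f Mp2Z.T⁻¹ = f := by
    conv_lhs => rw [← hf]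
    rw [← slash_mul, mul_inv_cancel, slash_one]
  induction n with
  | zero => rw [zpow_zero, slash_one]
  | succ n ih => rw [_root_.zpow_add, slash_mul, ih, zpow_one, hf]
  | pred n ih => rw [_root_.zpow_sub, slash_mul, ih, zpow_one, hinv]

/-- If `f|T̃ = f`, then `f|γ` depends only on the coset `Γ̃_∞ γ`. -/
theorem slash_out (f : ℍ → ZMod 2 → ℂ) (hf : slash f Mp2Z.T = f) (g : Mp2Z) :
    slash f (Quotient.mk _ g : Coset).out = slash f g := by
  have h : (QuotientGroup.rightRel (Subgroup.zpowers Mp2Z.T)).r _ g :=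
    Quotient.exact (Quotient.out_eq (Quotient.mk _ g : Coset))
  replace h := QuotientGroup.rightRel_apply.1 h
  obtain ⟨n, hn⟩ := h
  have hn : Mp2Z.T ^ n = _ := hn
  conv_rhs => rw [← inv_mul_cancel_right g (Quotient.mk _ g : Coset).out, ← hn, slash_mul,
    slash_zpow_T f hf]

/-- `𝒦_w(v) = w² v^{-3/2} ∫_1^∞ exp(-π (wt/√v - √v)²) t dt`. -/
def calK (w v : ℝ) : ℝ :=
  w ^ 2 / v ^ (3 / 2 : ℝ) *
    ∫ t in Set.Ioi (1 : ℝ), Real.exp (-Real.pi * (w * t / √v - √v) ^ 2) * t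

/-- `e(-Dτ/4) e_D`. -/
def holSeed (D : ℕ) (τ : ℍ) : ZMod 2 → ℂ :=
  e (-(D * τ / 4)) • Pi.single (D : ZMod 2) 1

/-- `𝒦_w(Dv) e(-Dτ/4) e_D`. -/
def nonholSeed (D : ℕ) (w : ℝ) (τ : ℍ) : ZMod 2 → ℂ :=
  (calK w (D * τ.im) : ℂ) • holSeed D τ

/-- `D` is a positive discriminant. -/
def IsPosDisc (D : ℕ) : Prop := 0 < D ∧ (D % 4 = 0 ∨ D % 4 = 1)

theorem slash_T_apply (f : ℍ → ZMod 2 → ℂ) (τ : ℍ) (μ : ZMod 2) :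
    slash f Mp2Z.T τ μ = (if μ = 0 then 1 else Complex.I) * f (Mp2Z.T.mat • τ) μ := by
  have h1 : Mp2Z.T.root τ = 1 := rfl
  have h2 : weilRep Mp2Z.T⁻¹ = diagTwo Complex.I := by
    have h3 : weilRep Mp2Z.T⁻¹ * diagTwo (-Complex.I) = 1 := by
      rw [← weilT_eq, ← weilRep_T, ← map_mul, inv_mul_cancel, map_one]
    calc weilRep Mp2Z.T⁻¹ = weilRep Mp2Z.T⁻¹ * (diagTwo (-Complex.I) * diagTwo Complex.I) := by
          rw [diagTwo_mul _ _ (by simp), mul_one]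
      _ = diagTwo Complex.I := by rw [← mul_assoc, h3, one_mul]
  rw [slash, h1, h2, _root_.one_zpow, one_smul, diagTwo, mulVec_diagonal]

theorem T_coe (τ : ℍ) : ((Mp2Z.T.mat • τ : ℍ) : ℂ) = τ + 1 := by
  show ((ModularGroup.T • τ : ℍ) : ℂ) = τ + 1
  rw [modular_T_smul, coe_vadd]; push_cast; ring

theorem holSeed_slash_T {D : ℕ} (hD : IsPosDisc D) : slash (holSeed D) Mp2Z.T = holSeed D := by
  funext τ μ
  rw [slash_T_apply]
  simp only [holSeed, Pi.smul_apply, smul_eq_mul, T_coe]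
  obtain ⟨k, hk⟩ : ∃ k : ℕ, D = 4 * k + D % 4 := ⟨D / 4, by omega⟩
  rcases hD.2 with h | h
  · have h0 : (D : ZMod 2) = 0 := by
      rw [ZMod.natCast_eq_zero_iff]; omega
    have he : e (-(D * ((τ : ℂ) + 1) / 4)) = e (-(D * (τ : ℂ) / 4)) := by
      have : -(D * ((τ : ℂ) + 1) / 4) = -(D * (τ : ℂ) / 4) + ((-k : ℤ) : ℂ) := by
        rw [hk, h]; push_cast; ring
      rw [this, e_add, e_int, mul_one]
    rw [he, h0]
    rcases zmod_two_cases μ with rfl | rfl <;> simp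
  · have h0 : (D : ZMod 2) = 1 := by
      have h1 : ((D : ℕ) : ZMod 2) = ((1 : ℕ) : ZMod 2) := by
        rw [ZMod.natCast_eq_natCast_iff']; omega
      simpa using h1
    have he : e (-(D * ((τ : ℂ) + 1) / 4)) = e (-(D * (τ : ℂ) / 4)) * -Complex.I := by
      have : -(D * ((τ : ℂ) + 1) / 4) =
          -(D * (τ : ℂ) / 4) + ((-k : ℤ) : ℂ) + ((-1 / 4 : ℝ) : ℂ) := by
        rw [hk, h]; push_cast; ring
      rw [this, e_add, e_add, e_int, mul_one, e_neg_quarter]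
    rw [he, h0]
    rcases zmod_two_cases μ with rfl | rfl
    · simp
    · simp only [one_ne_zero, if_false, Pi.single_eq_same, mul_one]
      linear_combination (-e (-(D * (τ : ℂ) / 4))) * Complex.I_mul_I

theorem nonholSeed_slash_T {D : ℕ} (hD : IsPosDisc D) (w : ℝ) :
    slash (nonholSeed D w) Mp2Z.T = nonholSeed D w := by
  funext τ
  have him : (Mp2Z.T.mat • τ : ℍ).im = τ.im := by
    rw [← coe_im, T_coe]; simp
  have h := congrFun (holSeed_slash_T hD) τ
  simp only [slash, nonholSeed, him, mulVec_smul] at h ⊢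
  rw [smul_comm, h]

/-- `g̃_D(τ, w) = ¼ ∑_{γ ∈ Γ̃_∞ \ Γ̃} (𝒦_w(Dv) e(-Dτ/4) e_D)|γ`. By `slash_out` and
`nonholSeed_slash_T` the choice of representatives does not matter. -/
def gTilde (D : ℕ) (τ : ℍ) (w : ℝ) : ZMod 2 → ℂ :=
  (1 / 4 : ℂ) • ∑' γ : Coset, slash (nonholSeed D w) γ.out τ

/-- The cosets `γ ∈ Γ̃_∞ \ Γ̃` with `D · Im(γσ) ≥ v₀`. -/
def truncSet (D : ℕ) (v₀ : ℝ) (σ : ℍ) : Set Coset :=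
  {γ | v₀ ≤ D * (γ.out.mat • σ : ℍ).im}

/-- `¼ ∑ (e(-Dτ/4) e_D)|γ (τ)` over the `γ ∈ Γ̃_∞ \ Γ̃` with `D · Im(γσ) ≥ v₀`. The truncated Poincaré
series at `τ` is the case `σ = τ`; with `σ` fixed and `τ` variable, its termwise derivatives at
`τ = σ` are the ordinary derivatives of this finite sum of smooth functions. -/
def truncPoincare (D : ℕ) (v₀ : ℝ) (σ τ : ℍ) : ZMod 2 → ℂ :=
  (1 / 4 : ℂ) • ∑' γ : truncSet D v₀ σ, slash (holSeed D) γ.1.out τ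

/-- `G̃_D(τ, w)`. -/
def GTilde (D : ℕ) (v₀ : ℝ) (τ : ℍ) (w : ℝ) : ZMod 2 → ℂ :=
  gTilde D τ w - truncPoincare D v₀ τ τ

/-- The Kronecker symbol `(D/n)` for `n ≥ 1`: multiplicative in `n`, with `(D/2) = 0, 1, -1` according
to `D` even, `D ≡ ±1 mod 8`, `D ≡ ±3 mod 8`, and the Jacobi symbol for odd `n`. -/
def kronecker (D : ℤ) (n : ℕ) : ℤ :=
  ZMod.χ₈ D ^ n.factorization 2 * jacobiSym D (n / 2 ^ n.factorization 2)

/-- `∑_{n ∣ m} (D/(m/n)) n G̃_{Dn²}(τ, my)`. -/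
def twistedSum (D : ℕ) (v₀ : ℝ) (m : ℕ) (τ : ℍ) (y : ℝ) : ZMod 2 → ℂ :=
  ∑ n ∈ m.divisors, ((kronecker D (m / n) : ℂ) * n) • GTilde (D * n ^ 2) v₀ τ (m * y)

/-- The point `τ = u + iv` for `p = (u, v, y)` (with `v > 0`). -/
def tauOf (p : ℝ × ℝ × ℝ) : ℍ := ofComplex ⟨p.1, p.2.1⟩

/-- The real coordinates `(u, v, y)` of `(τ, y)`, where `τ = u + iv`. -/
def coords (p : ℍ × ℝ) : ℝ × ℝ × ℝ := (p.1.re, p.1.im, p.2)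

/-- The twisted divisor sum in the real coordinates `(u, v, y)`, with the index sets of the truncated
Poincaré series kept fixed as those at the point `σ`. Its derivatives at a point above `τ = σ` are the
termwise derivatives of the twisted divisor sum there. -/
def twistedSumAt (D : ℕ) (v₀ : ℝ) (m : ℕ) (σ : ℍ) (p : ℝ × ℝ × ℝ) : ZMod 2 → ℂ :=
  ∑ n ∈ m.divisors, ((kronecker D (m / n) : ℂ) * n) •
    (gTilde (D * n ^ 2) (tauOf p) (m * p.2.2) - truncPoincare (D * n ^ 2) v₀ σ (tauOf p))

/-- `(u, v, y) ↦ g̃_D(u + iv, sy)`. -/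
def gTildeReal (D : ℕ) (s : ℝ) (p : ℝ × ℝ × ℝ) : ZMod 2 → ℂ :=
  gTilde D (tauOf p) (s * p.2.2)

/-- `v₀ = min {Im τ : (τ, r) ∈ K}`. -/
def minIm (K : Set (ℍ × ℝ)) : ℝ := sInf ((fun p : ℍ × ℝ => p.1.im) '' K)

theorem twistedSumAt_coords (D : ℕ) (v₀ : ℝ) (m : ℕ) (τ : ℍ) (y : ℝ) :
    twistedSumAt D v₀ m τ (coords (τ, y)) = twistedSum D v₀ m τ y := by
  have h : tauOf (coords (τ, y)) = τ := by
    have h2 : (⟨τ.re, τ.im⟩ : ℂ) = τ := rfl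
    simp only [tauOf, coords, h2, ofComplex_apply]
  rw [twistedSumAt, h]
  rfl

end Metaplectic

end

end KM

/-!
The terms of the series are continued to holomorphic functions of three complex variables near
`(u, v, y)`, and all derivatives are controlled by Cauchy's estimate, so that only the terms
themselves have to be bounded.

With `a = (w - V) / √V` and `V = D Im(γτ)`, substitution in the integral gives
`𝒦_w(V) = exp(-π a²) / (2π√V) + ∫_a^∞ exp(-π r²) dr`, minus `1` if `w < 0` (`calK_of_pos`,
`calK_of_neg`). Up to the constant `1`, the kernel therefore has size `exp(-π a²)`. Since
`-π a² + π V / 2 = -π w² / V + 2π w - π V / 2`, the inequality of arithmetic and geometric means shows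
that this Gaussian beats the growth `exp(π V / 2)` of `e(-Dγτ/4)`: the product is
`O(exp(π (2w - 0.9 |w|)))`, with a factor `exp(-π w² / (10 V))` to spare (`kernel_exponent_le`). That
factor decays like a Gaussian in `|cτ + d|`, which makes the sum over `γ` converge. The constant `1`
appears only in the range `w ≤ 2V` for a term that is not truncated, where `V` is bounded, and in the
range `V ≤ 1.2 w` for a truncated one, where `exp(π V / 2)` is itself small enough; in both cases `V`
is bounded below, and a factor `V²` gives convergence (`norm_termPlus_le`,
`norm_termMinus_le_of_pos`). For negative `w` it never appears.

All these inequalities have room to spare. They persist when `u`, `v`, `y` are moved into a complex ball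
whose radius is a small multiple of `v` and of `y`, because the relative change of `cτ + d`, of `V` and
of `w` is then small uniformly in `γ` (`near_imC`), and polynomial factors in `m` disappear in the
exponential (`pow_six_mul_exp_le`). The bounds are summable because a coset is determined by the bottom
row `(c, d)` and a sign, and `∑ max(|c|, |d|)⁻⁴` converges (`summable_cosetWeight`); the Weil
representation is unitary (`weilRep_mem_unitary`). Summation is handled in
`contDiffOn_tsum_of_norm_le_ball` and `exists_norm_iteratedFDeriv_coset_sum_le`.
-/

/-! ### Cauchy estimates for series of bounded holomorphic functions -/

namespace KM

open Metric Set Filter Topology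

section Cauchy

universe u

variable {E : Type u} [NormedAddCommGroup E] [NormedSpace ℂ E]

theorem norm_fderiv_le_of_norm_le_ball {G : Type*} [NormedAddCommGroup G] [NormedSpace ℂ G]
    {f : E → G} {c : E} {R M : ℝ} (hR : 0 < R) (hf : DifferentiableOn ℂ f (ball c R))
    (hM : ∀ z ∈ ball c R, ‖f z‖ ≤ M) : ‖fderiv ℂ f c‖ ≤ 2 * M / R := by
  refine Complex.norm_fderiv_le_div_of_mapsTo_ball hf (fun z hz => ?_) hR
  rw [mem_closedBall, dist_eq_norm]
  calc ‖f z - f c‖ ≤ ‖f z‖ + ‖f c‖ := norm_sub_le _ _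
    _ ≤ M + M := add_le_add (hM z hz) (hM c (mem_ball_self hR))
    _ = 2 * M := by ring

theorem norm_fderiv_le_of_dist_add_le {G : Type*} [NormedAddCommGroup G] [NormedSpace ℂ G]
    {f : E → G} {c z : E} {R r M : ℝ} (hr : 0 < r) (hf : DifferentiableOn ℂ f (ball c R))
    (hM : ∀ z ∈ ball c R, ‖f z‖ ≤ M) (hz : dist z c + r ≤ R) : ‖fderiv ℂ f z‖ ≤ 2 * M / r := by
  have hsub : ball z r ⊆ ball c R := ball_subset_ball' (by linarith)
  exact norm_fderiv_le_of_norm_le_ball hr (hf.mono hsub) fun w hw => hM w (hsub hw)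

/-- A series of holomorphic functions on a ball with a summable uniform bound has a sum that is as
often differentiable as one likes: by the Cauchy estimate the derivatives form a series of the
same kind on a smaller ball. -/
theorem contDiffOn_tsum_of_norm_le_ball {ι : Type*} (k : ℕ) :
    ∀ {G : Type u} [NormedAddCommGroup G] [NormedSpace ℂ G] [CompleteSpace G]
      {F : ι → E → G} {M : ι → ℝ} {c : E} {R : ℝ},
      (∀ i, ContDiffOn ℂ ∞ (F i) (ball c R)) → (∀ i, ∀ z ∈ ball c R, ‖F i z‖ ≤ M i) →
      Summable M → ContDiffOn ℂ k (fun z => ∑' i, F i z) (ball c R) := by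
  induction k with
  | zero =>
    intro G _ _ _ F M c R hF hM hs
    exact contDiffOn_zero.2 (continuousOn_tsum (fun i => (hF i).continuousOn) hs hM)
  | succ k ih =>
    intro G _ _ _ F M c R hF hM hs z hz
    obtain ⟨r, hr, hzr⟩ : ∃ r, 0 < r ∧ dist z c + r + r ≤ R :=
      ⟨(R - dist z c) / 2, by rw [mem_ball] at hz; linarith, by linarith⟩
    have hsub : ball z r ⊆ ball c R := ball_subset_ball' (by linarith)
    have hd : ∀ i, DifferentiableOn ℂ (F i) (ball c R) :=
      fun i => (hF i).differentiableOn (by simp)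
    have hM' : ∀ i, ∀ w ∈ ball z r, ‖fderiv ℂ (F i) w‖ ≤ 2 * M i / r := fun i w hw =>
      norm_fderiv_le_of_dist_add_le hr (hd i) (hM i) (by
        have := dist_triangle w z c
        rw [mem_ball] at hw
        linarith)
    have hs' : Summable fun i => 2 * M i / r := (hs.mul_left 2).div_const r
    have hderiv : ∀ w ∈ ball z r,
        HasFDerivAt (fun w => ∑' i, F i w) (∑' i, fderiv ℂ (F i) w) w := by
      intro w hw
      refine hasFDerivAt_tsum_of_isPreconnected hs' isOpen_ball
        (convex_ball z r).isPreconnected (fun i x hx => ?_) hM' hw ?_ hw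
      · exact ((hd i).differentiableAt (isOpen_ball.mem_nhds (hsub hx))).hasFDerivAt
      · exact .of_norm_bounded hs fun i => hM i w (hsub hw)
    have key : ContDiffOn ℂ ((k : ℕ∞ω) + 1) (fun w => ∑' i, F i w) (ball z r) := by
      rw [contDiffOn_succ_iff_fderiv_of_isOpen isOpen_ball]
      refine ⟨fun w hw => (hderiv w hw).differentiableAt.differentiableWithinAt, by simp, ?_⟩
      refine (ih (fun i => ?_) hM' hs').congr fun w hw => (hderiv w hw).fderiv
      exact ((hF i).mono hsub).fderiv_of_isOpen isOpen_ball (by simp)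
    exact ((key.contDiffAt (isOpen_ball.mem_nhds (mem_ball_self hr))).of_le
      (by simp)).contDiffWithinAt

/-- The Cauchy estimate for derivatives of order `k`. -/
theorem exists_norm_iteratedFDeriv_le (k : ℕ) : ∀ R : ℝ, 0 < R → ∃ B : ℝ, 0 ≤ B ∧
    ∀ {G : Type u} [NormedAddCommGroup G] [NormedSpace ℂ G] {f : E → G} {c : E} {M : ℝ},
      ContDiffOn ℂ ∞ f (ball c R) → (∀ z ∈ ball c R, ‖f z‖ ≤ M) →
      ‖iteratedFDeriv ℂ k f c‖ ≤ B * M := by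
  induction k with
  | zero =>
    intro R hR
    refine ⟨1, zero_le_one, fun {G} _ _ f c M _ hM => ?_⟩
    rw [norm_iteratedFDeriv_zero, one_mul]
    exact hM c (mem_ball_self hR)
  | succ k ih =>
    intro R hR
    obtain ⟨B, hB, h⟩ := ih (R / 2) (half_pos hR)
    refine ⟨B * (2 / (R / 2)), by positivity, fun {G} _ _ f c M hf hM => ?_⟩
    rw [← norm_iteratedFDeriv_fderiv]
    have hsub : ball c (R / 2) ⊆ ball c R := ball_subset_ball (by linarith)
    have := h (f := fderiv ℂ f) (c := c) (M := 2 * M / (R / 2))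
      ((hf.fderiv_of_isOpen isOpen_ball (by simp)).mono hsub) fun z hz =>
        norm_fderiv_le_of_dist_add_le (half_pos hR) (hf.differentiableOn (by simp)) hM (by
          rw [mem_ball] at hz; linarith)
    calc _ ≤ B * (2 * M / (R / 2)) := this
      _ = _ := by ring

end Cauchy

/-- The inclusion `ℝ³ → ℂ³`. -/
noncomputable def realIncl : ℝ × ℝ × ℝ →L[ℝ] ℂ × ℂ × ℂ :=
  Complex.ofRealCLM.prodMap (Complex.ofRealCLM.prodMap Complex.ofRealCLM)

theorem realIncl_apply (p : ℝ × ℝ × ℝ) :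
    realIncl p = ((p.1 : ℂ), (p.2.1 : ℂ), (p.2.2 : ℂ)) := rfl

theorem norm_realIncl_apply (p : ℝ × ℝ × ℝ) : ‖realIncl p‖ = ‖p‖ := by
  simp [realIncl_apply, Prod.norm_def]

theorem norm_realIncl_le : ‖realIncl‖ ≤ 1 :=
  ContinuousLinearMap.opNorm_le_bound _ zero_le_one fun p => by
    rw [norm_realIncl_apply, one_mul]

/-- Real derivatives of the restriction to `ℝ³` of a holomorphic function on a ball in `ℂ³`. -/
theorem norm_iteratedFDeriv_comp_realIncl_le {G : Type*} [NormedAddCommGroup G] [NormedSpace ℂ G]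
    {f : ℂ × ℂ × ℂ → G} {p : ℝ × ℝ × ℝ} (k : ℕ) (hf : ContDiffAt ℂ ∞ f (realIncl p)) :
    ContDiffAt ℝ ∞ (f ∘ realIncl) p ∧
    ‖iteratedFDeriv ℝ k (f ∘ realIncl) p‖ ≤ ‖iteratedFDeriv ℂ k f (realIncl p)‖ := by
  have hfr : ContDiffAt ℝ ∞ f (realIncl p) := hf.restrict_scalars ℝ
  refine ⟨hfr.comp p realIncl.contDiff.contDiffAt, ?_⟩
  have hfk : ContDiffAt ℂ k f (realIncl p) := hf.of_le (mod_cast le_top)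
  obtain ⟨s, hs, hso, hfs⟩ : ∃ s ∈ 𝓝 (realIncl p), IsOpen s ∧ ContDiffOn ℝ k f s := by
    obtain ⟨s, hs, hfs⟩ := (hfk.restrict_scalars ℝ).contDiffOn (m := k) le_rfl (by simp)
    obtain ⟨t, ht, hto, hpt⟩ := _root_.mem_nhds_iff.1 hs
    exact ⟨t, hto.mem_nhds hpt, hto, hfs.mono ht⟩
  have hps : realIncl p ∈ s := mem_of_mem_nhds hs
  have hso' : IsOpen (realIncl ⁻¹' s) := hso.preimage realIncl.continuous
  have h1 := realIncl.iteratedFDerivWithin_comp_right hfs hso.uniqueDiffOn hso'.uniqueDiffOn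
    hps le_rfl
  rw [iteratedFDerivWithin_of_isOpen k hso' hps, iteratedFDerivWithin_of_isOpen k hso hps] at h1
  rw [h1]
  refine (ContinuousMultilinearMap.norm_compContinuousLinearMap_le _ _).trans ?_
  rw [← hfk.restrictScalars_iteratedFDeriv (𝕜 := ℝ), Function.comp_apply,
    ContinuousMultilinearMap.norm_restrictScalars]
  refine mul_le_of_le_one_right (norm_nonneg _) ?_
  exact Finset.prod_le_one (fun _ _ => norm_nonneg _) fun _ _ => norm_realIncl_le

/-- A series of holomorphic functions on a ball around a real point, with a summable uniform bound,
has smooth restriction to `ℝ³`, and all derivatives of the sum at the centre are controlled by the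
sum of the bounds. -/
theorem exists_norm_iteratedFDeriv_tsum_le (k : ℕ) {R : ℝ} (hR : 0 < R) : ∃ B : ℝ, 0 ≤ B ∧
    ∀ {ι G : Type} [NormedAddCommGroup G] [NormedSpace ℂ G] [CompleteSpace G]
      {F : ι → ℂ × ℂ × ℂ → G} {M : ι → ℝ} {p : ℝ × ℝ × ℝ},
      (∀ i, ContDiffOn ℂ ∞ (F i) (ball (realIncl p) R)) →
      (∀ i, ∀ z ∈ ball (realIncl p) R, ‖F i z‖ ≤ M i) → Summable M →
      ContDiffAt ℝ ∞ (fun q => ∑' i, F i (realIncl q)) p ∧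
      ‖iteratedFDeriv ℝ k (fun q => ∑' i, F i (realIncl q)) p‖ ≤ B * ∑' i, M i := by
  obtain ⟨B, hB, h⟩ := exists_norm_iteratedFDeriv_le (E := ℂ × ℂ × ℂ) k R hR
  refine ⟨B, hB, fun {ι G} _ _ _ F M p hF hM hs => ?_⟩
  have hc : ContDiffOn ℂ ∞ (fun z => ∑' i, F i z) (ball (realIncl p) R) :=
    contDiffOn_infty.2 fun n => contDiffOn_tsum_of_norm_le_ball n hF hM hs
  have hb := h hc fun z hz =>
    tsum_of_norm_bounded hs.hasSum fun i => hM i z hz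
  have := norm_iteratedFDeriv_comp_realIncl_le k
    (hc.contDiffAt (isOpen_ball.mem_nhds (mem_ball_self hR)))
  exact ⟨this.1, this.2.trans hb⟩

end KM

/-! ### The incomplete Gaussian integral and the kernel `𝒦_w` -/

namespace KM

open Set Filter Topology MeasureTheory

theorem integrable_gauss_exp (b c : ℝ) (hb : 0 < b) :
    Integrable fun r : ℝ => Real.exp (-b * r ^ 2 + c * r) := by
  have h := (integrable_cexp_quadratic (b := (b : ℂ)) (by simpa using hb) (c : ℂ) 0).norm
  refine h.congr (ae_of_all _ fun r => ?_)
  simp only [Complex.norm_exp]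
  congr 1
  simp [← Complex.ofReal_pow]

/-- `∫_0^∞ exp(-π r² - 2π r z) dr`, so that `exp(-π z²)` times it is `∫_z^∞ exp(-π r²) dr`. -/
noncomputable def gaussTail (z : ℂ) : ℂ :=
  ∫ r in Ioi (0 : ℝ), Complex.exp (-Real.pi * r ^ 2 - 2 * Real.pi * r * z)

theorem norm_gaussTail_integrand (z : ℂ) (r : ℝ) :
    ‖Complex.exp (-Real.pi * r ^ 2 - 2 * Real.pi * r * z)‖ =
      Real.exp (-Real.pi * r ^ 2 + (-2 * Real.pi * z.re) * r) := by
  rw [Complex.norm_exp]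
  congr 1
  simp [← Complex.ofReal_pow]
  ring

theorem integrable_gaussTail_integrand (z : ℂ) :
    Integrable fun r : ℝ => Complex.exp (-Real.pi * r ^ 2 - 2 * Real.pi * r * z) := by
  refine (integrable_norm_iff (Continuous.aestronglyMeasurable (by fun_prop))).1 ?_
  simp_rw [norm_gaussTail_integrand]
  exact integrable_gauss_exp _ _ Real.pi_pos

theorem norm_gaussTail_le {z : ℂ} (hz : 0 ≤ z.re) : ‖gaussTail z‖ ≤ 1 / 2 := by
  have h := integral_gaussian_Ioi Real.pi
  rw [div_self Real.pi_ne_zero, Real.sqrt_one] at h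
  rw [gaussTail, ← h]
  refine norm_integral_le_of_norm_le (integrable_exp_neg_mul_sq Real.pi_pos).integrableOn ?_
  refine (ae_restrict_iff' measurableSet_Ioi).2 (ae_of_all _ fun r hr => ?_)
  rw [norm_gaussTail_integrand]
  refine Real.exp_le_exp.2 ?_
  have : 0 ≤ Real.pi * z.re * r := mul_nonneg (mul_nonneg Real.pi_pos.le hz) (le_of_lt hr)
  linarith

theorem gaussTail_add (z : ℂ) :
    Complex.exp (-Real.pi * z ^ 2) * (gaussTail z + gaussTail (-z)) = 1 := by
  have h1 : gaussTail (-z) =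
      ∫ r in Iic (0 : ℝ), Complex.exp (-Real.pi * r ^ 2 - 2 * Real.pi * r * z) := by
    have := integral_comp_neg_Ioi 0
      (fun r : ℝ => Complex.exp (-Real.pi * r ^ 2 - 2 * Real.pi * r * z))
    rw [neg_zero] at this
    rw [← this, gaussTail]
    refine integral_congr_ae (ae_of_all _ fun r => ?_)
    simp only
    push_cast
    ring_nf
  have h2 : gaussTail z + gaussTail (-z) =
      ∫ r : ℝ, Complex.exp (-Real.pi * r ^ 2 - 2 * Real.pi * r * z) := by
    rw [h1, gaussTail, add_comm]
    exact intervalIntegral.integral_Iic_add_Ioi (integrable_gaussTail_integrand z).integrableOn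
      (integrable_gaussTail_integrand z).integrableOn
  have hpi : (Real.pi : ℂ) ≠ 0 := by exact_mod_cast Real.pi_ne_zero
  have h3 := integral_cexp_quadratic (b := -(Real.pi : ℂ)) (by simpa using Real.pi_pos)
    (-2 * Real.pi * z) 0
  have h4 : (fun r : ℝ => Complex.exp (-Real.pi * r ^ 2 - 2 * Real.pi * r * z)) =
      fun r : ℝ => Complex.exp (-(Real.pi : ℂ) * r ^ 2 + -2 * Real.pi * z * r + 0) := by
    funext r; congr 1; ring
  rw [h2, h4, h3, neg_neg, div_self hpi, Complex.one_cpow, one_mul, ← Complex.exp_add]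
  have : -(Real.pi : ℂ) * z ^ 2 + (0 - (-2 * Real.pi * z) ^ 2 / (4 * -Real.pi)) = 0 := by
    field_simp; ring
  rw [this, Complex.exp_zero]

theorem differentiable_gaussTail : Differentiable ℂ gaussTail := by
  set μ : Measure ℝ := (volume.restrict (Ioi 0)).withDensity
    fun r => ENNReal.ofReal (Real.exp (-Real.pi * r ^ 2)) with hμ
  have hmeas : Measurable fun r : ℝ => Real.exp (-Real.pi * r ^ 2) := by fun_prop
  have h1 : gaussTail = fun z => ProbabilityTheory.complexMGF id μ (-2 * Real.pi * z) := by
    funext z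
    rw [ProbabilityTheory.complexMGF, hμ, gaussTail,
      integral_withDensity_eq_integral_toReal_smul (by fun_prop) (by simp)]
    refine integral_congr_ae (ae_of_all _ fun r => ?_)
    simp only [id]
    rw [ENNReal.toReal_ofReal (Real.exp_pos _).le, Complex.real_smul, Complex.ofReal_exp,
      ← Complex.exp_add]
    congr 1
    push_cast
    ring
  have h2 : ProbabilityTheory.integrableExpSet id μ = univ := by
    refine eq_univ_of_forall fun t => ?_
    show Integrable _ _
    rw [hμ, integrable_withDensity_iff_integrable_smul' (by fun_prop) (by simp)]
    refine (integrable_gauss_exp Real.pi t Real.pi_pos).integrableOn.congr (ae_of_all _ fun r => ?_)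
    simp only [id, smul_eq_mul]
    rw [ENNReal.toReal_ofReal (Real.exp_pos _).le, ← Real.exp_add]
  have h3 := ProbabilityTheory.differentiableOn_complexMGF (X := id) (μ := μ)
  rw [h2, interior_univ] at h3
  have h4 : Differentiable ℂ (ProbabilityTheory.complexMGF id μ) :=
    differentiableOn_univ.1 (h3.mono fun z _ => mem_univ _)
  rw [h1]
  exact h4.comp (by fun_prop)

/-- `exp(-π a²) (1/(2πs) + ∫_0^∞ exp(-π r² - 2π r a) dr)` with `a = w/s - s`. For positive `w` it is
`𝒦_w(s²)`. -/
noncomputable def kerPlus (w s : ℂ) : ℂ :=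
  Complex.exp (-Real.pi * (w / s - s) ^ 2) * (1 / (2 * Real.pi * s) + gaussTail (w / s - s))

/-- `exp(-π a²) (1/(2πs) - ∫_0^∞ exp(-π r² + 2π r a) dr)` with `a = w/s - s`. For negative `w` it is
`𝒦_w(s²)`, for positive `w` it is `𝒦_w(s²) - 1`. -/
noncomputable def kerMinus (w s : ℂ) : ℂ :=
  Complex.exp (-Real.pi * (w / s - s) ^ 2) * (1 / (2 * Real.pi * s) - gaussTail (-(w / s - s)))

theorem kerPlus_eq (w s : ℂ) : kerPlus w s = kerMinus w s + 1 := by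
  rw [kerPlus, kerMinus, ← gaussTail_add (w / s - s)]
  ring

/-- The real version of `gaussTail`. -/
noncomputable def gaussTailReal (b : ℝ) : ℝ :=
  ∫ r in Ioi (0 : ℝ), Real.exp (-Real.pi * r ^ 2 + (-2 * Real.pi * b) * r)

theorem gaussTail_ofReal (b : ℝ) : gaussTail b = gaussTailReal b := by
  rw [gaussTail, gaussTailReal, ← integral_complex_ofReal]
  refine integral_congr_ae (ae_of_all _ fun r => ?_)
  simp only
  push_cast
  ring_nf

theorem integrable_mul_gauss_exp (c : ℝ) :
    IntegrableOn (fun r : ℝ => r * Real.exp (-Real.pi * r ^ 2 + c * r)) (Ioi 0) := by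
  refine (integrable_gauss_exp Real.pi (c + 1) Real.pi_pos).integrableOn.mono'
    (Continuous.aestronglyMeasurable (by fun_prop)) ?_
  refine (ae_restrict_iff' measurableSet_Ioi).2 (ae_of_all _ fun r (hr : 0 < r) => ?_)
  rw [Real.norm_of_nonneg (by positivity)]
  calc r * Real.exp (-Real.pi * r ^ 2 + c * r)
      ≤ Real.exp r * Real.exp (-Real.pi * r ^ 2 + c * r) := by
        gcongr; linarith [Real.add_one_le_exp r]
    _ = _ := by rw [← Real.exp_add]; ring_nf

theorem integral_mul_gauss_exp (b : ℝ) :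
    ∫ r in Ioi (0 : ℝ), r * Real.exp (-Real.pi * r ^ 2 + (-2 * Real.pi * b) * r) =
      1 / (2 * Real.pi) - b * gaussTailReal b := by
  have hpi := Real.pi_pos
  set g : ℝ → ℝ := fun r => Real.exp (-Real.pi * r ^ 2 + (-2 * Real.pi * b) * r) with hg
  have hint1 : IntegrableOn (fun r => r * g r) (Ioi 0) := integrable_mul_gauss_exp _
  have hint2 : IntegrableOn (fun r => b * g r) (Ioi 0) :=
    ((integrable_gauss_exp _ _ hpi).const_mul b).integrableOn
  have hderiv : ∀ r ∈ Ici (0 : ℝ),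
      HasDerivAt (fun r => -(1 / (2 * Real.pi)) * g r) (r * g r + b * g r) r := by
    intro r _
    have h1 : HasDerivAt (fun r : ℝ => -Real.pi * r ^ 2 + (-2 * Real.pi * b) * r)
        (-Real.pi * (2 * r) + (-2 * Real.pi * b)) r := by
      have := ((hasDerivAt_pow 2 r).const_mul (-Real.pi)).add
        ((hasDerivAt_id r).const_mul (-2 * Real.pi * b))
      convert! this using 1
      simp
    convert! h1.exp.const_mul (-(1 / (2 * Real.pi))) using 1
    simp only [hg]
    field_simp
    ring
  have hlim : Tendsto (fun r => -(1 / (2 * Real.pi)) * g r) atTop (𝓝 0) := by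
    rw [← mul_zero (-(1 / (2 * Real.pi)))]
    refine Tendsto.const_mul _ (Real.tendsto_exp_atBot.comp ?_)
    have h2 : (fun r : ℝ => -Real.pi * r ^ 2 + (-2 * Real.pi * b) * r) =
        fun r => -((Real.pi * r + 2 * Real.pi * b) * r) := by funext r; ring
    rw [h2]
    refine tendsto_neg_atTop_atBot.comp (Tendsto.atTop_mul_atTop₀ ?_ tendsto_id)
    exact tendsto_atTop_add_const_right _ _ (tendsto_id.const_mul_atTop hpi)
  have h := integral_Ioi_of_hasDerivAt_of_tendsto' hderiv (hint1.add hint2) hlim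
  rw [integral_add hint1 hint2, integral_const_mul] at h
  have h0 : g 0 = 1 := by simp [hg]
  rw [h0] at h
  have h3 : gaussTailReal b = ∫ r in Ioi (0 : ℝ), g r := rfl
  rw [h3]
  linarith

/-- The substitution `t = 1 + √v r / |w|` in the integral defining `𝒦_w(v)`. -/
theorem calK_eq {w v σ : ℝ} (hσ : σ ^ 2 = 1) (hw : 0 < σ * w) (hv : 0 < v) :
    calK w v = Real.exp (-Real.pi * (w / √v - √v) ^ 2) *
      (1 / (2 * Real.pi * √v) + σ * gaussTailReal (σ * (w / √v - √v))) := by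
  set q := √v with hq
  have hq0 : 0 < q := Real.sqrt_pos.2 hv
  have hw0 : w ≠ 0 := by rintro rfl; simp at hw
  have hpi := Real.pi_pos
  set a := w / q - q with ha
  set k := q / (σ * w) with hk
  have hk0 : 0 < k := div_pos hq0 hw
  have hv3 : v ^ (3 / 2 : ℝ) = q ^ 3 := by
    rw [hq, Real.sqrt_eq_rpow, ← Real.rpow_natCast, ← Real.rpow_mul hv.le]; norm_num
  set f : ℝ → ℝ := fun t => Real.exp (-Real.pi * (w * t / q - q) ^ 2) * t with hf
  have h1 : ∫ t in Ioi (1 : ℝ), f t = ∫ t in Ioi (0 : ℝ), f (t + 1) := by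
    have := (measurePreserving_add_right volume (1 : ℝ)).setIntegral_preimage_emb
      (measurableEmbedding_addRight 1) f (Ioi 1)
    rw [← this]
    simp
  have h2 := integral_comp_mul_left_Ioi (fun t => f (t + 1)) 0 hk0
  rw [mul_zero, smul_eq_mul] at h2
  have h3 : ∀ r : ℝ, f (k * r + 1) = Real.exp (-Real.pi * a ^ 2) *
      (Real.exp (-Real.pi * r ^ 2 + (-2 * Real.pi * (σ * a)) * r) +
        k * (r * Real.exp (-Real.pi * r ^ 2 + (-2 * Real.pi * (σ * a)) * r))) := by
    intro r
    have h4 : w * (k * r + 1) / q - q = a + σ * r := by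
      have hσ0 : σ ≠ 0 := by rintro rfl; simp at hσ
      rw [hk, ha]
      field_simp
      linear_combination (-r * q) * hσ
    have h5 : -Real.pi * (a + σ * r) ^ 2 =
        -Real.pi * a ^ 2 + (-Real.pi * r ^ 2 + (-2 * Real.pi * (σ * a)) * r) := by
      linear_combination (-Real.pi * r ^ 2) * hσ
    simp only [hf]
    rw [h4, h5, Real.exp_add]
    ring
  simp_rw [h3] at h2
  rw [integral_const_mul, integral_add (integrable_gauss_exp _ _ hpi).integrableOn
    ((integrable_mul_gauss_exp _).const_mul k), integral_const_mul, integral_mul_gauss_exp] at h2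
  have h6 : ∫ t in Ioi (1 : ℝ), f t = k * (Real.exp (-Real.pi * a ^ 2) *
      (gaussTailReal (σ * a) + k * (1 / (2 * Real.pi) - σ * a * gaussTailReal (σ * a)))) := by
    rw [h1]
    have h7 : gaussTailReal (σ * a) =
      ∫ r in Ioi (0 : ℝ), Real.exp (-Real.pi * r ^ 2 + (-2 * Real.pi * (σ * a)) * r) := rfl
    rw [← h7] at h2
    rw [h2]
    field_simp
  rw [calK, hv3, ← hq]
  rw [h6]
  have hσ0 : σ ≠ 0 := by rintro rfl; simp at hσ
  generalize gaussTailReal (σ * a) = G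
  generalize Real.exp (-Real.pi * a ^ 2) = X
  rw [hk, ha]
  rcases (sq_eq_sq_iff_eq_or_eq_neg.1 (hσ.trans (one_pow 2).symm)) with rfl | rfl
  · field_simp
    ring
  · field_simp
    ring

theorem calK_of_pos {w v : ℝ} (hw : 0 < w) (hv : 0 < v) :
    (calK w v : ℂ) = kerPlus w (√v : ℝ) := by
  rw [calK_eq (σ := 1) (by norm_num) (by simpa using hw) hv, kerPlus, ← Complex.ofReal_div,
    ← Complex.ofReal_sub, gaussTail_ofReal]
  push_cast
  simp

theorem calK_of_neg {w v : ℝ} (hw : w < 0) (hv : 0 < v) :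
    (calK w v : ℂ) = kerMinus w (√v : ℝ) := by
  rw [calK_eq (σ := -1) (by norm_num) (by simpa using hw) hv, kerMinus, ← Complex.ofReal_div,
    ← Complex.ofReal_sub, ← Complex.ofReal_neg (w / √v - √v),
    gaussTail_ofReal, neg_one_mul]
  push_cast
  simp [sub_eq_add_neg]

end KM

/-! ### Cosets of `Γ̃_∞` and the Weil representation -/

namespace KM

open UpperHalfPlane Matrix
open scoped MatrixGroups

theorem Mp2Z.T_zpow_root (n : ℤ) (τ : ℍ) : (Mp2Z.T ^ n).root τ = 1 := by
  induction n generalizing τ with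
  | zero => rfl
  | succ n ih =>
    rw [_root_.zpow_add, zpow_one, Mp2Z.mul_root, ih]
    exact one_mul 1
  | pred n ih =>
    rw [_root_.zpow_sub, zpow_one, Mp2Z.mul_root, ih, one_mul, Mp2Z.inv_root]
    exact inv_one

theorem Mp2Z.T_zpow_mat (n : ℤ) : (Mp2Z.T ^ n).mat = ModularGroup.T ^ n :=
  map_zpow Mp2Z.matHom Mp2Z.T n

/-- The bottom row `(c, d)` of the chosen representative of a coset. -/
noncomputable def botRow (γ : Coset) : Fin 2 → ℤ := fun i => γ.out.mat 1 i

theorem botRow_ne_zero (γ : Coset) : botRow γ ≠ 0 := by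
  intro h
  have h0 : γ.out.mat 1 0 = 0 := congrFun h 0
  have h1 : γ.out.mat 1 1 = 0 := congrFun h 1
  have := γ.out.mat.det_coe
  rw [det_fin_two, h0, h1] at this
  simp at this

theorem one_le_norm_botRow (γ : Coset) : 1 ≤ ‖botRow γ‖ := by
  rw [EisensteinSeries.norm_eq_max_natAbs]
  have h := botRow_ne_zero γ
  have h2 : botRow γ 0 ≠ 0 ∨ botRow γ 1 ≠ 0 := by
    by_contra! h3
    exact h (by funext i; fin_cases i <;> simp [h3])
  have : 1 ≤ max (botRow γ 0).natAbs (botRow γ 1).natAbs := by omega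
  exact_mod_cast this

theorem SL2_eq_T_zpow_mul {g h : SL(2, ℤ)} (h0 : g 1 0 = h 1 0) (h1 : g 1 1 = h 1 1) :
    ∃ n : ℤ, h = ModularGroup.T ^ n * g := by
  have hg := g.det_coe
  have hh := h.det_coe
  rw [det_fin_two] at hg hh
  refine ⟨h 0 1 * g 0 0 - h 0 0 * g 0 1, ?_⟩
  refine Matrix.SpecialLinearGroup.ext _ _ fun i j => ?_
  rw [Matrix.SpecialLinearGroup.coe_mul, ModularGroup.coe_T_zpow]
  fin_cases i <;> fin_cases j <;> simp [mul_apply, Fin.sum_univ_two, h0, h1]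
  · rw [h0, h1] at hg
    linear_combination g 0 0 * hh - h 0 0 * hg
  · rw [h0, h1] at hg
    linear_combination g 0 1 * hh - h 0 1 * hg

theorem coset_eq_of_botRow_eq {γ γ' : Coset} (h : botRow γ = botRow γ')
    (hr : γ.out.root UpperHalfPlane.I = γ'.out.root UpperHalfPlane.I) : γ = γ' := by
  obtain ⟨n, hn⟩ := SL2_eq_T_zpow_mul (congrFun h 0) (congrFun h 1)
  set g := γ.out with hg
  set g' := γ'.out with hg'
  set k : Mp2Z := g' * (Mp2Z.T ^ n * g)⁻¹ with hk
  have hkg : g' = k * (Mp2Z.T ^ n * g) := by rw [hk, inv_mul_cancel_right]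
  have hkm : k.mat = 1 := by
    rw [hk, Mp2Z.mul_mat, Mp2Z.inv_mat, Mp2Z.mul_mat, Mp2Z.T_zpow_mat, hn, mul_inv_cancel]
  have hk1 : k = 1 := by
    refine (Mp2Z.eq_of_mat_eq_one k hkm).resolve_right fun h4 => ?_
    have h5 : g'.root UpperHalfPlane.I = -g.root UpperHalfPlane.I := by
      rw [hkg, h4, Mp2Z.mul_root, Mp2Z.S_pow_four_root, Mp2Z.mul_root, Mp2Z.T_zpow_root]
      ring
    rw [h5] at hr
    exact g.root_ne_zero _ (self_eq_neg.1 hr)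
  rw [hk1, one_mul] at hkg
  rw [← Quotient.out_eq γ, ← Quotient.out_eq γ']
  refine Quotient.sound (QuotientGroup.rightRel_apply.2 ?_)
  rw [← hg, ← hg', hkg, mul_inv_cancel_right]
  exact Subgroup.zpow_mem_zpowers _ _

/-- The weight by which the series over the cosets are compared. -/
noncomputable def cosetWeight (γ : Coset) : ℝ := 1 / ‖botRow γ‖ ^ 4

theorem cosetWeight_nonneg (γ : Coset) : 0 ≤ cosetWeight γ := by
  rw [cosetWeight]; positivity

theorem summable_one_div_norm_pow_four : Summable fun x : Fin 2 → ℤ => 1 / ‖x‖ ^ 4 := by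
  refine (EisensteinSeries.summable_one_div_norm_rpow (k := 4) (by norm_num)).congr fun x => ?_
  rw [Real.rpow_neg (norm_nonneg _), one_div, ← Real.rpow_natCast]
  norm_num

/-- Each pair `(c, d)` comes from at most two cosets, which differ in the sign of the root. -/
theorem summable_cosetWeight : Summable cosetWeight := by
  classical
  have h2 : Summable fun p : (Fin 2 → ℤ) × Bool => 1 / ‖p.1‖ ^ 4 := by
    have hs : Summable fun _ : Bool => (1 : ℝ) := Summable.of_finite
    have := summable_one_div_norm_pow_four.mul_of_nonneg hs (fun x => by positivity)
      (fun _ => zero_le_one)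
    simpa only [mul_one] using this
  let s : Coset → ℂ := fun γ =>
    ((botRow γ 0 : ℂ) * (UpperHalfPlane.I : ℍ) + (botRow γ 1 : ℂ)) ^ (1 / 2 : ℂ)
  let f : Coset → (Fin 2 → ℤ) × Bool := fun γ =>
    (botRow γ, decide (γ.out.root UpperHalfPlane.I = s γ))
  have hs : ∀ γ, γ.out.root UpperHalfPlane.I = s γ ∨ γ.out.root UpperHalfPlane.I = -s γ := by
    intro γ
    refine sq_eq_sq_iff_eq_or_eq_neg.1 ?_
    rw [γ.out.sq, ← Complex.cpow_nat_mul]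
    simp [botRow]
  have hf : Function.Injective f := by
    intro γ γ' h
    simp only [f, Prod.mk.injEq] at h
    have hss : s γ = s γ' := by simp only [s, h.1]
    refine coset_eq_of_botRow_eq h.1 ?_
    have h3 := decide_eq_decide.1 h.2
    by_cases h4 : γ.out.root UpperHalfPlane.I = s γ
    · rw [h4, h3.1 h4, hss]
    · rw [(hs γ).resolve_left h4, (hs γ').resolve_left (fun h5 => h4 (h3.2 h5)), hss]
  exact (h2.comp_injective hf :)

theorem norm_denom_ge (γ : Coset) (τ : ℍ) :
    EisensteinSeries.r τ * ‖botRow γ‖ ≤ ‖(γ.out.mat 1 0 : ℂ) * τ + γ.out.mat 1 1‖ :=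
  EisensteinSeries.r_mul_max_le τ (botRow_ne_zero γ)

theorem weilRep_mem_unitary (g : Mp2Z) : weilRep g ∈ unitaryGroup (ZMod 2) ℂ := by
  have hg : g ∈ Subgroup.closure ({Mp2Z.S, Mp2Z.T} : Set Mp2Z) := by
    rw [Mp2Z.closure_S_T]; trivial
  induction hg using Subgroup.closure_induction with
  | mem x hx =>
    rw [mem_unitaryGroup_iff']
    rcases hx with rfl | rfl
    · have hI : ‖Complex.I ^ (1 / 2 : ℂ)‖ = 1 := by
        have : ‖Complex.I ^ (1 / 2 : ℂ)‖ ^ 2 = 1 := by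
          rw [← norm_pow, ← Complex.cpow_nat_mul]; simp
        exact (pow_eq_one_iff_of_nonneg (norm_nonneg _) two_ne_zero).1 this
      have hc : star (Complex.I ^ (1 / 2 : ℂ) / (√2 : ℝ)) * (Complex.I ^ (1 / 2 : ℂ) / (√2 : ℝ)) =
          1 / 2 := by
        rw [Complex.star_def, Complex.conj_mul', norm_div, hI, Complex.norm_real,
          Real.norm_of_nonneg (Real.sqrt_nonneg _)]
        norm_cast
        rw [div_pow, Real.sq_sqrt (by norm_num)]
        norm_num
      have hs : star signMat = signMat := by
        ext i j
        rw [star_apply]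
        rcases zmod_two_cases i with rfl | rfl <;> rcases zmod_two_cases j with rfl | rfl <;>
          simp [signMat]
      rw [weilRep_S, weilS_eq, star_smul, hs, smul_mul_smul_comm, hc, signMat_sq, smul_smul]
      norm_num
    · rw [weilRep_T, weilT_eq]
      have hs : star (diagTwo (-Complex.I)) = diagTwo Complex.I := by
        ext i j
        rw [star_apply]
        rcases zmod_two_cases i with rfl | rfl <;> rcases zmod_two_cases j with rfl | rfl <;>
          simp [diagTwo]
      rw [hs, diagTwo_mul _ _ (by simp)]
  | one => rw [map_one]; exact one_mem _
  | mul x y _ _ hx hy => rw [map_mul]; exact mul_mem hx hy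
  | inv x _ hx =>
    have h1 : weilRep x⁻¹ * weilRep x = 1 := by rw [← map_mul, inv_mul_cancel, map_one]
    have h2 : weilRep x * star (weilRep x) = 1 := mem_unitaryGroup_iff.1 hx
    have h3 : weilRep x⁻¹ = star (weilRep x) := left_inv_eq_right_inv h1 h2
    rw [h3]
    exact Unitary.star_mem hx

/-- The vector `ϱ_L(g)⁻¹ e_D`. -/
noncomputable def weilVec (D : ℕ) (g : Mp2Z) : ZMod 2 → ℂ :=
  weilRep g⁻¹ *ᵥ Pi.single (D : ZMod 2) 1

theorem norm_weilVec_le (D : ℕ) (g : Mp2Z) : ‖weilVec D g‖ ≤ 1 := by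
  refine (pi_norm_le_iff_of_nonneg zero_le_one).2 fun i => ?_
  rw [weilVec, mulVec_single_one]
  exact entry_norm_bound_of_unitary (weilRep_mem_unitary _) _ _

/-- The scalar factor of `e(-Dτ/4) e_D | g`. -/
noncomputable def holFactor (D : ℕ) (g : Mp2Z) (τ : ℍ) : ℂ :=
  (g.root τ) ^ (-3 : ℤ) * e (-(D * ((g.mat • τ : ℍ) : ℂ) / 4))

theorem slash_holSeed (D : ℕ) (g : Mp2Z) (τ : ℍ) :
    slash (holSeed D) g τ = holFactor D g τ • weilVec D g := by
  rw [slash, holSeed, mulVec_smul, smul_smul]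
  rfl

theorem slash_nonholSeed (D : ℕ) (w : ℝ) (g : Mp2Z) (τ : ℍ) :
    slash (nonholSeed D w) g τ =
      ((calK w (D * (g.mat • τ : ℍ).im) : ℂ) * holFactor D g τ) • weilVec D g := by
  rw [slash, nonholSeed, mulVec_smul, smul_comm, mul_smul]
  congr 1
  exact slash_holSeed D g τ

theorem norm_root_sq (g : Mp2Z) (τ : ℍ) :
    ‖g.root τ‖ ^ 2 = ‖(g.mat 1 0 : ℂ) * τ + g.mat 1 1‖ := by
  rw [← norm_pow, g.sq]

theorem im_smul_eq (g : SL(2, ℤ)) (τ : ℍ) :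
    (g • τ : ℍ).im = τ.im / ‖(g 1 0 : ℂ) * τ + g 1 1‖ ^ 2 := by
  rw [ModularGroup.im_smul_eq_div_normSq, Complex.normSq_eq_norm_sq, ModularGroup.denom_apply]

theorem norm_holFactor (D : ℕ) (g : Mp2Z) (τ : ℍ) :
    ‖holFactor D g τ‖ = (‖g.root τ‖ ^ 3)⁻¹ * Real.exp (Real.pi / 2 * (D * (g.mat • τ : ℍ).im)) := by
  rw [holFactor, norm_mul, norm_zpow, e, Complex.norm_exp]
  congr 1
  congr 1
  simp
  ring

end KM

/-! ### Bounds for the kernel at complex arguments near the real axis -/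

namespace KM

open Complex

theorem norm_div_sub_one_le {a b : ℂ} {κ : ℝ} (hb : b ≠ 0) (h : ‖a - b‖ ≤ κ * ‖b‖) :
    ‖a / b - 1‖ ≤ κ := by
  have : a / b - 1 = (a - b) / b := by field_simp
  rw [this, norm_div, div_le_iff₀ (norm_pos_iff.2 hb)]
  exact h

theorem re_mem_of_norm_sub_one_le {q : ℂ} {κ : ℝ} (h : ‖q - 1‖ ≤ κ) :
    1 - κ ≤ q.re ∧ q.re ≤ 1 + κ := by
  have h1 := (abs_re_le_norm (q - 1)).trans h
  rw [sub_re, one_re, abs_le] at h1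
  constructor <;> linarith [h1.1, h1.2]

theorem one_sub_le_norm_one_add {x : ℂ} {κ : ℝ} (h : ‖x‖ ≤ κ) : 1 - κ ≤ ‖1 + x‖ := by
  have := norm_sub_norm_le (1 : ℂ) (-x)
  rw [norm_one, norm_neg, sub_neg_eq_add] at this
  linarith

theorem exists_eq_mul_one_add {w w₀ : ℂ} {κ : ℝ} (hw₀ : w₀ ≠ 0) (h : ‖w - w₀‖ ≤ κ * ‖w₀‖) :
    ∃ x : ℂ, ‖x‖ ≤ κ ∧ w = w₀ * (1 + x) :=
  ⟨w / w₀ - 1, norm_div_sub_one_le hw₀ h, by field_simp; ring⟩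

section Kernel

variable {w₀ q : ℝ} {w s : ℂ}

theorem re_div_of_near (hw₀ : w₀ ≠ 0) (hq : 0 < q) (hw : ‖w - w₀‖ ≤ 1 / 100 * |w₀|)
    (hs : ‖s - q‖ ≤ 1 / 25 * q) : ∃ θ : ℝ, 9 / 10 ≤ θ ∧ θ ≤ 11 / 10 ∧ (w / s).re = w₀ / q * θ := by
  have hq0 : (q : ℂ) ≠ 0 := by exact_mod_cast hq.ne'
  obtain ⟨x, hx, rfl⟩ := exists_eq_mul_one_add (w := w) (w₀ := w₀) (by exact_mod_cast hw₀)
    (by simpa using hw)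
  obtain ⟨t, ht, rfl⟩ := exists_eq_mul_one_add (w := s) (w₀ := q) hq0
    (by simpa [abs_of_pos hq] using hs)
  have h1 := one_sub_le_norm_one_add ht
  have h2 : ‖(1 + x) / (1 + t) - 1‖ ≤ 1 / 10 := by
    refine norm_div_sub_one_le (fun h => ?_) ?_
    · rw [h, norm_zero] at h1; norm_num at h1
    · have : 1 + x - (1 + t) = x - t := by ring
      rw [this]
      linarith [norm_sub_le x t]
  obtain ⟨h3, h4⟩ := re_mem_of_norm_sub_one_le h2
  refine ⟨((1 + x) / (1 + t)).re, by linarith, by linarith, ?_⟩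
  rw [mul_div_mul_comm, ← ofReal_div, re_ofReal_mul]

theorem norm_exp_kernel_le (hw₀ : w₀ ≠ 0) (hq : 0 < q) (hw : ‖w - w₀‖ ≤ 1 / 100 * |w₀|)
    (hs : ‖s - q‖ ≤ 1 / 25 * q) (hV : ‖s ^ 2 - (q : ℂ) ^ 2‖ ≤ 1 / 25 * q ^ 2) :
    ‖exp (-Real.pi * (w / s - s) ^ 2)‖ ≤ Real.exp (Real.pi *
      (-(93 / 100) * (w₀ ^ 2 / q ^ 2) + 2 * w₀ + 2 / 100 * |w₀| - 96 / 100 * q ^ 2)) := by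
  have hq0 : (q : ℂ) ≠ 0 := by exact_mod_cast hq.ne'
  have hs0 : s ≠ 0 := by
    rintro rfl
    rw [zero_sub, norm_neg, norm_real, Real.norm_of_nonneg hq.le] at hs
    linarith
  have hre : (w - w₀).re ≤ 1 / 100 * |w₀| := (re_le_norm _).trans hw
  rw [sub_re, ofReal_re] at hre
  have hVre : -(1 / 25 * q ^ 2) ≤ (s ^ 2 - (q : ℂ) ^ 2).re :=
    (abs_le.1 ((abs_re_le_norm _).trans hV)).1
  rw [sub_re, ← ofReal_pow, ofReal_re] at hVre
  obtain ⟨x, hx, hwx⟩ := exists_eq_mul_one_add (w := w) (w₀ := w₀) (by exact_mod_cast hw₀)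
    (by simpa using hw)
  obtain ⟨y, hy, hsy⟩ := exists_eq_mul_one_add (w := s ^ 2) (w₀ := (q : ℂ) ^ 2)
    (pow_ne_zero 2 hq0) (by simpa [abs_of_pos hq] using hV)
  have h1 := one_sub_le_norm_one_add hy
  have h2 : ‖(1 + x) ^ 2 / (1 + y) - 1‖ ≤ 7 / 100 := by
    refine norm_div_sub_one_le (fun h => ?_) ?_
    · rw [h, norm_zero] at h1; norm_num at h1
    · have hx' : ‖x‖ ≤ 1 / 100 := by linarith
      have h3 : (1 + x) ^ 2 - (1 + y) = 2 * x + x ^ 2 - y := by ring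
      have h4 : ‖2 * x + x ^ 2 - y‖ ≤ 2 * ‖x‖ + ‖x‖ ^ 2 + ‖y‖ := by
        refine (norm_sub_le _ _).trans (add_le_add_left ((norm_add_le _ _).trans ?_) _)
        rw [norm_mul, norm_pow, norm_ofNat]
      have h5 : ‖x‖ ^ 2 ≤ (1 / 100) ^ 2 := by gcongr
      rw [h3]
      linarith
  have h6 : (w ^ 2 / s ^ 2).re = w₀ ^ 2 / q ^ 2 * ((1 + x) ^ 2 / (1 + y)).re := by
    rw [hwx, hsy, mul_pow, mul_div_mul_comm, ← ofReal_pow, ← ofReal_pow, ← ofReal_div,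
      re_ofReal_mul]
  have h7 : 93 / 100 * (w₀ ^ 2 / q ^ 2) ≤ (w ^ 2 / s ^ 2).re := by
    rw [h6, mul_comm]
    have := (re_mem_of_norm_sub_one_le h2).1
    gcongr
    linarith
  have h8 : (-Real.pi * (w / s - s) ^ 2 : ℂ) = (-Real.pi : ℝ) * (w ^ 2 / s ^ 2 - 2 * w + s ^ 2) := by
    push_cast; field_simp; ring
  rw [norm_exp, h8, re_ofReal_mul, neg_mul, ← mul_neg]
  refine Real.exp_le_exp.2 (mul_le_mul_of_nonneg_left ?_ Real.pi_pos.le)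
  have h9 : (2 * w).re = 2 * w.re := by simp
  rw [add_re, sub_re, h9]
  linarith

theorem norm_one_div_kernel_le (hq : 0 < q) (hs : ‖s - q‖ ≤ 1 / 25 * q) :
    ‖1 / (2 * Real.pi * s)‖ ≤ 1 / q := by
  have h1 : 24 / 25 * q ≤ ‖s‖ := by
    have := norm_sub_norm_le (q : ℂ) s
    rw [norm_sub_rev, norm_real, Real.norm_of_nonneg hq.le] at this
    linarith
  rw [norm_div, norm_one, norm_mul, norm_mul, norm_ofNat, norm_real,
    Real.norm_of_nonneg Real.pi_pos.le]
  refine one_div_le_one_div_of_le hq ?_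
  nlinarith [Real.pi_gt_three]

/-- For positive `w₀` the kernel near `w₀` has Gaussian decay, except when `w₀ ≤ 2 V₀`, where
`kerPlus = kerMinus + 1` with a small first summand; here `V₀ = q²`. -/
theorem norm_kerPlus_le (hw₀ : 0 < w₀) (hq : 0 < q) (hw : ‖w - w₀‖ ≤ 1 / 100 * |w₀|)
    (hs : ‖s - q‖ ≤ 1 / 25 * q) (hV : ‖s ^ 2 - (q : ℂ) ^ 2‖ ≤ 1 / 25 * q ^ 2) {B : ℝ} (hB : 0 ≤ B)
    (hB1 : w₀ ≤ 2 * q ^ 2 → 1 ≤ B) :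
    ‖kerPlus w s‖ ≤ Real.exp (Real.pi *
      (-(93 / 100) * (w₀ ^ 2 / q ^ 2) + 2 * w₀ + 2 / 100 * |w₀| - 96 / 100 * q ^ 2)) *
      (1 / q + 1) + B := by
  have h1 := norm_exp_kernel_le hw₀.ne' hq hw hs hV
  have h2 := norm_one_div_kernel_le hq hs
  have hs1 := (abs_le.1 ((abs_re_le_norm _).trans hs))
  rw [sub_re, ofReal_re] at hs1
  obtain ⟨θ, hθ1, hθ2, hθ⟩ := re_div_of_near hw₀.ne' hq hw hs
  rcases le_or_gt 0 (w / s - s).re with hre | hre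
  · refine le_add_of_le_of_nonneg ?_ hB
    rw [kerPlus, norm_mul]
    refine mul_le_mul h1 ((norm_add_le _ _).trans ?_) (norm_nonneg _) (Real.exp_pos _).le
    linarith [norm_gaussTail_le hre]
  · have h3 : w₀ ≤ 2 * q ^ 2 := by
      rw [sub_re, hθ] at hre
      have h4 : w₀ / q * θ ≤ 26 / 25 * q := by linarith [hs1.2]
      have h5 : w₀ / q * (9 / 10) ≤ w₀ / q * θ := by gcongr
      have h6 : w₀ / q * (9 / 10) ≤ 26 / 25 * q := h5.trans h4
      rw [div_mul_eq_mul_div, div_le_iff₀ hq] at h6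
      nlinarith [sq_nonneg q]
    rw [kerPlus_eq]
    refine (norm_add_le _ _).trans (add_le_add ?_ (by rw [norm_one]; exact hB1 h3))
    rw [kerMinus, norm_mul]
    refine mul_le_mul h1 ((norm_sub_le _ _).trans ?_) (norm_nonneg _) (Real.exp_pos _).le
    have := norm_gaussTail_le (z := -(w / s - s)) (by rw [neg_re]; linarith)
    linarith

/-- `kerMinus = kerPlus - 1` has Gaussian decay, except when `V₀ = q²` is at most `1.2 w₀`, where only
the first summand is small. The exception does not occur for negative `w₀`. -/
theorem norm_kerMinus_le (hw₀ : w₀ ≠ 0) (hq : 0 < q) (hw : ‖w - w₀‖ ≤ 1 / 100 * |w₀|)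
    (hs : ‖s - q‖ ≤ 1 / 25 * q) (hV : ‖s ^ 2 - (q : ℂ) ^ 2‖ ≤ 1 / 25 * q ^ 2) {B : ℝ} (hB : 0 ≤ B)
    (hB1 : q ^ 2 ≤ 12 / 10 * w₀ → 1 ≤ B) :
    ‖kerMinus w s‖ ≤ Real.exp (Real.pi *
      (-(93 / 100) * (w₀ ^ 2 / q ^ 2) + 2 * w₀ + 2 / 100 * |w₀| - 96 / 100 * q ^ 2)) *
      (1 / q + 1) + B := by
  have h1 := norm_exp_kernel_le hw₀ hq hw hs hV
  have h2 := norm_one_div_kernel_le hq hs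
  have hs1 := (abs_le.1 ((abs_re_le_norm _).trans hs))
  rw [sub_re, ofReal_re] at hs1
  obtain ⟨θ, hθ1, hθ2, hθ⟩ := re_div_of_near hw₀ hq hw hs
  rcases le_or_gt (w / s - s).re 0 with hre | hre
  · refine le_add_of_le_of_nonneg ?_ hB
    rw [kerMinus, norm_mul]
    refine mul_le_mul h1 ((norm_sub_le _ _).trans ?_) (norm_nonneg _) (Real.exp_pos _).le
    have := norm_gaussTail_le (z := -(w / s - s)) (by rw [neg_re]; linarith)
    linarith
  · have h3 : q ^ 2 ≤ 12 / 10 * w₀ := by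
      rw [sub_re, hθ] at hre
      have h4 : 24 / 25 * q ≤ w₀ / q * θ := by linarith [hs1.1]
      have h6 : 24 / 25 * q * q ≤ w₀ * θ := by
        have h5 : w₀ / q * θ * q = w₀ * θ := by field_simp
        rw [← h5]
        gcongr
      have hw₀' : 0 < w₀ := by
        by_contra! hn
        nlinarith [mul_pos hq hq]
      nlinarith
    have h4 : kerMinus w s = kerPlus w s - 1 := by rw [kerPlus_eq]; ring
    rw [h4]
    refine (norm_sub_le _ _).trans (add_le_add ?_ (by rw [norm_one]; exact hB1 h3))
    rw [kerPlus, norm_mul]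
    refine mul_le_mul h1 ((norm_add_le _ _).trans ?_) (norm_nonneg _) (Real.exp_pos _).le
    linarith [norm_gaussTail_le hre.le]

/-- The exponential growth of `e(-Dτ/4)` is beaten by the decay of the kernel: here `V = q²`. -/
theorem kernel_exponent_le (w₀ : ℝ) (hq : 0 < q) :
    Real.pi * (-(93 / 100) * (w₀ ^ 2 / q ^ 2) + 2 * w₀ + 2 / 100 * |w₀| - 96 / 100 * q ^ 2) +
      Real.pi * (52 / 100 * q ^ 2) ≤
    Real.pi * (2 * w₀ - 9 / 10 * |w₀|) - Real.pi / 10 * (w₀ ^ 2 / q ^ 2) := by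
  have hV : 0 < q ^ 2 := by positivity
  set V := q ^ 2
  have h1 : 92 / 100 * |w₀| ≤ 83 / 100 * (w₀ ^ 2 / V) + 44 / 100 * V := by
    rw [← sq_abs w₀]
    set a := |w₀|
    have h2 : 83 / 100 * (a ^ 2 / V) + 44 / 100 * V - 92 / 100 * a =
        (83 / 100 * a ^ 2 + 44 / 100 * V ^ 2 - 92 / 100 * a * V) / V := by field_simp
    have h3 : 0 ≤ (83 / 100 * a ^ 2 + 44 / 100 * V ^ 2 - 92 / 100 * a * V) / V := by
      refine div_nonneg ?_ hV.le
      nlinarith [sq_nonneg (a - 46 / 83 * V), sq_nonneg V]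
    linarith
  have h4 : 0 ≤ Real.pi * (83 / 100 * (w₀ ^ 2 / V) + 44 / 100 * V - 92 / 100 * |w₀|) :=
    mul_nonneg Real.pi_pos.le (by linarith)
  linarith

end Kernel

end KM

/-! ### Holomorphic continuation of the terms of the series to a ball in `ℂ³` -/

namespace KM

open Complex UpperHalfPlane Metric Set
open scoped Manifold MatrixGroups

/-- The continuation of `τ = u + iv` to complex `u` and `v`. -/
noncomputable def tauC (z : ℂ × ℂ × ℂ) : ℂ := z.1 + Complex.I * z.2.1

/-- The continuation of `τ̄ = u - iv`. It is independent of `tauC` for complex `u` and `v`. -/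
noncomputable def tauBarC (z : ℂ × ℂ × ℂ) : ℂ := z.1 - Complex.I * z.2.1

/-- `cτ + d` as a function of the complex number `τ`. -/
noncomputable def linDenom (g : Mp2Z) (t : ℂ) : ℂ := (g.mat 1 0 : ℂ) * t + g.mat 1 1

/-- The continuation of `D Im(γτ) = Dv / ((cτ + d)(cτ̄ + d))`. -/
noncomputable def imC (D : ℕ) (g : Mp2Z) (z : ℂ × ℂ × ℂ) : ℂ :=
  D * z.2.1 / (linDenom g (tauC z) * linDenom g (tauBarC z))

/-- The continuation of `√(D Im(γτ))`. -/
noncomputable def sqrtImC (D : ℕ) (g : Mp2Z) (z : ℂ × ℂ × ℂ) : ℂ := exp (log (imC D g z) / 2)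

theorem sqrtImC_sq {D : ℕ} {g : Mp2Z} {z : ℂ × ℂ × ℂ} (h : imC D g z ≠ 0) :
    sqrtImC D g z ^ 2 = imC D g z := by
  rw [sqrtImC, ← exp_nat_mul]
  push_cast
  rw [mul_div_cancel₀ _ two_ne_zero, exp_log h]

theorem sqrtImC_re_nonneg (D : ℕ) (g : Mp2Z) (z : ℂ × ℂ × ℂ) : 0 ≤ (sqrtImC D g z).re := by
  rw [sqrtImC, exp_re]
  refine mul_nonneg (Real.exp_pos _).le (Real.cos_nonneg_of_mem_Icc ?_)
  have h : (log (imC D g z) / 2).im = (imC D g z).arg / 2 := by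
    rw [div_ofNat_im, log_im]
  rw [h]
  have h1 := neg_pi_lt_arg (imC D g z)
  have h2 := arg_le_pi (imC D g z)
  constructor <;> linarith

/-- The square root of a number close to `q²` that lies in the right half plane is close to `q`. -/
theorem norm_sub_le_of_sq_near {s : ℂ} {q κ : ℝ} (hq : 0 < q) (hs : 0 ≤ s.re)
    (h : ‖s ^ 2 - (q : ℂ) ^ 2‖ ≤ κ * q ^ 2) : ‖s - q‖ ≤ κ * q := by
  have h1 : q ≤ ‖s + q‖ := by
    refine le_trans ?_ (re_le_norm _)
    rw [add_re, ofReal_re]; linarith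
  have h2 : s ^ 2 - (q : ℂ) ^ 2 = (s + q) * (s - q) := by ring
  rw [h2, norm_mul] at h
  have h3 : q * ‖s - q‖ ≤ q * (κ * q) := by
    calc q * ‖s - q‖ ≤ ‖s + q‖ * ‖s - q‖ := by gcongr
      _ ≤ κ * q ^ 2 := h
      _ = q * (κ * q) := by ring
  exact le_of_mul_le_mul_left h3 hq

section Real

variable (D : ℕ) (g : Mp2Z) (p : ℝ × ℝ × ℝ)

theorem tauC_realIncl : tauC (realIncl p) = ⟨p.1, p.2.1⟩ := by
  rw [tauC, realIncl_apply]
  apply Complex.ext <;> simp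

theorem tauOf_coe {p : ℝ × ℝ × ℝ} (hp : 0 < p.2.1) : ((tauOf p : ℍ) : ℂ) = ⟨p.1, p.2.1⟩ := by
  rw [tauOf, ofComplex_apply_of_im_pos (by exact hp)]

theorem ofComplex_tauC_realIncl : ofComplex (tauC (realIncl p)) = tauOf p := by
  rw [tauC_realIncl, tauOf]

theorem tauBarC_realIncl : tauBarC (realIncl p) = (starRingEnd ℂ) ⟨p.1, p.2.1⟩ := by
  rw [tauBarC, realIncl_apply]
  apply Complex.ext <;> simp

theorem linDenom_conj (t : ℂ) : linDenom g ((starRingEnd ℂ) t) = (starRingEnd ℂ) (linDenom g t) := by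
  simp [linDenom]

variable {p}

theorem imC_realIncl (hp : 0 < p.2.1) :
    imC D g (realIncl p) = ((D * (g.mat • tauOf p : ℍ).im : ℝ) : ℂ) := by
  have him : (tauOf p).im = p.2.1 := by rw [← coe_im, tauOf_coe hp]
  rw [imC, tauC_realIncl, tauBarC_realIncl, linDenom_conj, mul_conj', im_smul_eq, tauOf_coe hp, him,
    realIncl_apply, linDenom]
  push_cast
  rw [mul_div_assoc]

theorem imC_realIncl_pos {D : ℕ} (hD : 0 < D) : 0 < (D * (g.mat • tauOf p : ℍ).im : ℝ) :=
  mul_pos (by exact_mod_cast hD) (UpperHalfPlane.im_pos _)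

theorem sqrtImC_realIncl {D : ℕ} (hD : 0 < D) (hp : 0 < p.2.1) :
    sqrtImC D g (realIncl p) = ((√(D * (g.mat • tauOf p : ℍ).im) : ℝ) : ℂ) := by
  rw [sqrtImC, imC_realIncl D g hp]
  set x : ℝ := D * (g.mat • tauOf p : ℍ).im with hx
  have hx0 : 0 < x := imC_realIncl_pos g hD
  rw [← ofReal_log hx0.le]
  have : √x = Real.exp (Real.log x / 2) := by
    rw [Real.exp_half, Real.exp_log hx0]
  rw [this]
  push_cast
  rfl

end Real

/-- The continuation of the scalar factor of `e(-Dτ/4) e_D | g`. -/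
noncomputable def holFactorC (D : ℕ) (g : Mp2Z) (z : ℂ × ℂ × ℂ) : ℂ :=
  holFactor D g (ofComplex (tauC z))

/-- The continuation of the scalar factor of `𝒦_w(Dv) e(-Dτ/4) e_D | g` at `w = sy > 0`. -/
noncomputable def termPlus (D : ℕ) (g : Mp2Z) (s : ℝ) (z : ℂ × ℂ × ℂ) : ℂ :=
  kerPlus (s * z.2.2) (sqrtImC D g z) * holFactorC D g z

/-- The continuation of the scalar factor of `𝒦_w(Dv) e(-Dτ/4) e_D | g` at `w = sy < 0`, and of
`(𝒦_w(Dv) - 1) e(-Dτ/4) e_D | g` at `w = sy > 0`. -/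
noncomputable def termMinus (D : ℕ) (g : Mp2Z) (s : ℝ) (z : ℂ × ℂ × ℂ) : ℂ :=
  kerMinus (s * z.2.2) (sqrtImC D g z) * holFactorC D g z

theorem termPlus_eq (D : ℕ) (g : Mp2Z) (s : ℝ) (z : ℂ × ℂ × ℂ) :
    termPlus D g s z = termMinus D g s z + holFactorC D g z := by
  rw [termPlus, termMinus, kerPlus_eq]; ring

theorem slash_holSeed_tauOf (D : ℕ) (g : Mp2Z) (p : ℝ × ℝ × ℝ) :
    slash (holSeed D) g (tauOf p) = holFactorC D g (realIncl p) • weilVec D g := by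
  rw [slash_holSeed, holFactorC, ofComplex_tauC_realIncl]

theorem slash_nonholSeed_of_pos {D : ℕ} (hD : 0 < D) (g : Mp2Z) {s : ℝ} {p : ℝ × ℝ × ℝ}
    (hp : 0 < p.2.1) (hs : 0 < s * p.2.2) :
    slash (nonholSeed D (s * p.2.2)) g (tauOf p) = termPlus D g s (realIncl p) • weilVec D g := by
  rw [slash_nonholSeed, calK_of_pos hs (imC_realIncl_pos g hD), termPlus, holFactorC,
    ofComplex_tauC_realIncl, sqrtImC_realIncl g hD hp, realIncl_apply, ofReal_mul]

theorem slash_nonholSeed_of_neg {D : ℕ} (hD : 0 < D) (g : Mp2Z) {s : ℝ} {p : ℝ × ℝ × ℝ}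
    (hp : 0 < p.2.1) (hs : s * p.2.2 < 0) :
    slash (nonholSeed D (s * p.2.2)) g (tauOf p) = termMinus D g s (realIncl p) • weilVec D g := by
  rw [slash_nonholSeed, calK_of_neg hs (imC_realIncl_pos g hD), termMinus, holFactorC,
    ofComplex_tauC_realIncl, sqrtImC_realIncl g hD hp, realIncl_apply, ofReal_mul]

section Near

variable {D : ℕ} {g : Mp2Z} {p : ℝ × ℝ × ℝ} {δ : ℝ} {z : ℂ × ℂ × ℂ}

theorem norm_tauC_sub_le (hz : z ∈ ball (realIncl p) δ) :
    ‖tauC z - ⟨p.1, p.2.1⟩‖ ≤ 2 * δ ∧ ‖tauBarC z - (starRingEnd ℂ) ⟨p.1, p.2.1⟩‖ ≤ 2 * δ ∧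
      ‖z.2.1 - p.2.1‖ ≤ δ ∧ ‖z.2.2 - p.2.2‖ ≤ δ := by
  rw [mem_ball, dist_eq_norm] at hz
  have h1 : ‖z.1 - p.1‖ ≤ δ := (norm_fst_le (z - realIncl p)).trans hz.le
  have h2 : ‖z.2.1 - p.2.1‖ ≤ δ :=
    ((norm_fst_le (z - realIncl p).2).trans (norm_snd_le (z - realIncl p))).trans hz.le
  have h3 : ‖z.2.2 - p.2.2‖ ≤ δ :=
    ((norm_snd_le (z - realIncl p).2).trans (norm_snd_le (z - realIncl p))).trans hz.le
  refine ⟨?_, ?_, h2, h3⟩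
  · rw [← tauC_realIncl]
    have : tauC z - tauC (realIncl p) = (z.1 - p.1) + Complex.I * (z.2.1 - p.2.1) := by
      simp only [tauC, realIncl_apply]; ring
    rw [this]
    refine (norm_add_le _ _).trans ?_
    rw [norm_mul, norm_I]
    linarith
  · rw [← tauBarC_realIncl]
    have : tauBarC z - tauBarC (realIncl p) = (z.1 - p.1) - Complex.I * (z.2.1 - p.2.1) := by
      simp only [tauBarC, realIncl_apply]; ring
    rw [this]
    refine (norm_sub_le _ _).trans ?_
    rw [norm_mul, norm_I]
    linarith

theorem norm_linDenom_sub_le (g : Mp2Z) {t t₀ : ℂ} (h : ‖t - t₀‖ ≤ 1 / 100 * |t₀.im|) :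
    ‖linDenom g t - linDenom g t₀‖ ≤ 1 / 100 * ‖linDenom g t₀‖ := by
  have h1 : linDenom g t - linDenom g t₀ = (g.mat 1 0 : ℂ) * (t - t₀) := by
    simp only [linDenom]; ring
  have h2 : |(g.mat 1 0 : ℝ)| * |t₀.im| ≤ ‖linDenom g t₀‖ := by
    rw [← abs_mul]
    refine le_trans (le_of_eq ?_) (abs_im_le_norm _)
    simp [linDenom]
  rw [h1, norm_mul]
  have h3 : ‖(g.mat 1 0 : ℂ)‖ = |(g.mat 1 0 : ℝ)| := by simp
  rw [h3]
  calc |(g.mat 1 0 : ℝ)| * ‖t - t₀‖ ≤ |(g.mat 1 0 : ℝ)| * (1 / 100 * |t₀.im|) := by gcongr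
    _ = 1 / 100 * (|(g.mat 1 0 : ℝ)| * |t₀.im|) := by ring
    _ ≤ _ := by gcongr

theorem linDenom_ne_zero (g : Mp2Z) {t : ℂ} (ht : t.im ≠ 0) : linDenom g t ≠ 0 := by
  rcases lt_or_gt_of_ne ht with h | h
  · have h1 : 0 < ((starRingEnd ℂ) t).im := by rw [conj_im]; linarith
    have h2 := g.root_ne_zero ⟨_, h1⟩
    have h3 : linDenom g ((starRingEnd ℂ) t) = g.root ⟨_, h1⟩ ^ 2 := (g.sq ⟨_, h1⟩).symm
    rw [linDenom_conj] at h3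
    intro h4
    rw [h4, map_zero] at h3
    exact h2 (by simpa using h3.symm)
  · have h3 : linDenom g t = g.root ⟨_, h⟩ ^ 2 := (g.sq ⟨_, h⟩).symm
    rw [h3]
    exact pow_ne_zero 2 (g.root_ne_zero _)

/-- On a ball around a real point whose radius is small compared to `v`, the continuations of `cτ + d`
and of `D Im(γτ)` have small relative distance from their values at the centre, uniformly in `γ`. -/
theorem near_imC (hp : 0 < p.2.1) (hδ : 200 * δ ≤ p.2.1) (hz : z ∈ ball (realIncl p) δ) :
    0 < (tauC z).im ∧
    ‖linDenom g (tauC z) - linDenom g (tauOf p)‖ ≤ 1 / 100 * ‖linDenom g (tauOf p)‖ ∧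
    D * (g.mat • ofComplex (tauC z) : ℍ).im ≤ 104 / 100 * (D * (g.mat • tauOf p : ℍ).im) ∧
    ‖imC D g z - (D * (g.mat • tauOf p : ℍ).im : ℝ)‖ ≤ 1 / 25 * (D * (g.mat • tauOf p : ℍ).im) := by
  obtain ⟨h1, h2, h3, -⟩ := norm_tauC_sub_le hz
  have h1' := (abs_le.1 ((abs_im_le_norm _).trans h1))
  have him : (tauC z - ⟨p.1, p.2.1⟩).im = (tauC z).im - p.2.1 := rfl
  rw [him] at h1'
  have hpos : 0 < (tauC z).im := by linarith [h1'.1]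
  have hv : (tauOf p).im = p.2.1 := by rw [← coe_im, tauOf_coe hp]
  have hA := norm_linDenom_sub_le g (t := tauC z) (t₀ := ⟨p.1, p.2.1⟩) (by
    rw [abs_of_pos (show (0 : ℝ) < (⟨p.1, p.2.1⟩ : ℂ).im from hp)]
    show _ ≤ 1 / 100 * p.2.1
    linarith)
  have hA' := norm_linDenom_sub_le g (t := tauBarC z) (t₀ := (starRingEnd ℂ) ⟨p.1, p.2.1⟩) (by
    rw [conj_im, abs_neg, abs_of_pos (show (0 : ℝ) < (⟨p.1, p.2.1⟩ : ℂ).im from hp)]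
    show _ ≤ 1 / 100 * p.2.1
    linarith)
  have hA0 := linDenom_ne_zero g (t := ⟨p.1, p.2.1⟩) hp.ne'
  have hA0' := linDenom_ne_zero g (t := (starRingEnd ℂ) ⟨p.1, p.2.1⟩) (by
    rw [conj_im]; exact (neg_neg_of_pos hp).ne)
  obtain ⟨x, hx, hxe⟩ := exists_eq_mul_one_add hA0 hA
  obtain ⟨x', hx', hxe'⟩ := exists_eq_mul_one_add hA0' hA'
  have hp0 : (p.2.1 : ℂ) ≠ 0 := by exact_mod_cast hp.ne'
  obtain ⟨y, hy, hye⟩ := exists_eq_mul_one_add (κ := 1 / 100) hp0 (h3.trans (by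
    rw [norm_real, Real.norm_of_nonneg hp.le]; linarith))
  have hn := one_sub_le_norm_one_add hx
  have hn' := one_sub_le_norm_one_add hx'
  refine ⟨hpos, by rw [tauOf_coe hp]; exact hA, ?_, ?_⟩
  · rw [im_smul_eq, im_smul_eq, hv, tauOf_coe hp, ofComplex_apply_of_im_pos hpos]
    have e1 : (g.mat 1 0 : ℂ) * ((⟨tauC z, hpos⟩ : ℍ) : ℂ) + (g.mat 1 1 : ℂ) =
      linDenom g (tauC z) := rfl
    have e2 : (g.mat 1 0 : ℂ) * (⟨p.1, p.2.1⟩ : ℂ) + (g.mat 1 1 : ℂ) =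
      linDenom g ⟨p.1, p.2.1⟩ := rfl
    have e3 : (⟨tauC z, hpos⟩ : ℍ).im = (tauC z).im := rfl
    rw [e1, e2, e3, hxe, norm_mul]
    have hNpos : 0 < ‖linDenom g ⟨p.1, p.2.1⟩‖ := norm_pos_iff.2 hA0
    set N := ‖linDenom g ⟨p.1, p.2.1⟩‖
    have h5 : (tauC z).im ≤ 101 / 100 * p.2.1 := by linarith [h1'.2]
    have h6 : (99 / 100) ^ 2 ≤ ‖1 + x‖ ^ 2 := by
      have : (99 / 100 : ℝ) ≤ ‖1 + x‖ := by linarith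
      gcongr
    have h7 : (tauC z).im / (N * ‖1 + x‖) ^ 2 ≤ 104 / 100 * (p.2.1 / N ^ 2) := by
      rw [mul_pow, div_le_iff₀ (by positivity)]
      have : 104 / 100 * (p.2.1 / N ^ 2) * (N ^ 2 * ‖1 + x‖ ^ 2) =
        104 / 100 * p.2.1 * ‖1 + x‖ ^ 2 := by field_simp
      rw [this]
      nlinarith
    calc _ ≤ (D : ℝ) * (104 / 100 * (p.2.1 / N ^ 2)) := by gcongr
      _ = _ := by ring
  · rw [← imC_realIncl D g hp]
    have hV0 : imC D g (realIncl p) = D * p.2.1 /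
        (linDenom g ⟨p.1, p.2.1⟩ * linDenom g ((starRingEnd ℂ) ⟨p.1, p.2.1⟩)) := by
      rw [imC, tauC_realIncl, tauBarC_realIncl, realIncl_apply]
    have hVz : imC D g z = imC D g (realIncl p) * ((1 + y) / ((1 + x) * (1 + x'))) := by
      rw [hV0, imC, hxe, hxe', hye, div_mul_div_comm]
      congr 1 <;> ring
    have hnn : (99 / 100) * (99 / 100) ≤ ‖(1 + x) * (1 + x')‖ := by
      rw [norm_mul]
      have h8 : (99 / 100 : ℝ) ≤ ‖1 + x‖ := by linarith
      have h9 : (99 / 100 : ℝ) ≤ ‖1 + x'‖ := by linarith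
      gcongr
    have hq : ‖(1 + y) / ((1 + x) * (1 + x')) - 1‖ ≤ 1 / 25 := by
      refine norm_div_sub_one_le (fun h => ?_) ?_
      · rw [h, norm_zero] at hnn; norm_num at hnn
      · have e4 : 1 + y - (1 + x) * (1 + x') = y - (x + x' + x * x') := by ring
        have h10 : ‖x * x'‖ ≤ 1 / 100 * (1 / 100) := by
          rw [norm_mul]; gcongr
        rw [e4]
        have := norm_sub_le y (x + x' + x * x')
        have := norm_add_le (x + x') (x * x')
        have := norm_add_le x x'
        linarith
    have e5 : imC D g z - imC D g (realIncl p) =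
        imC D g (realIncl p) * ((1 + y) / ((1 + x) * (1 + x')) - 1) := by rw [hVz]; ring
    rw [e5, norm_mul, mul_comm]
    have e6 : ‖imC D g (realIncl p)‖ = D * (g.mat • tauOf p : ℍ).im := by
      rw [imC_realIncl D g hp, norm_real, Real.norm_of_nonneg]
      exact mul_nonneg (Nat.cast_nonneg _) (UpperHalfPlane.im_pos _).le
    rw [e6]
    exact mul_le_mul_of_nonneg_right hq (mul_nonneg (Nat.cast_nonneg _) (UpperHalfPlane.im_pos _).le)

theorem imC_re_pos (hD : 0 < D) (hp : 0 < p.2.1) (hδ : 200 * δ ≤ p.2.1)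
    (hz : z ∈ ball (realIncl p) δ) : 0 < (imC D g z).re := by
  obtain ⟨-, -, -, h⟩ := near_imC (D := D) (g := g) hp hδ hz
  have h1 := (abs_le.1 ((abs_re_le_norm _).trans h)).1
  rw [sub_re, ofReal_re] at h1
  linarith [imC_realIncl_pos g (p := p) hD]

/-! ### Holomorphy of the terms -/

theorem differentiableOn_holFactor (D : ℕ) (g : Mp2Z) :
    DifferentiableOn ℂ (fun t => holFactor D g (ofComplex t)) {t | 0 < t.im} := by
  have h1 : DifferentiableOn ℂ (g.root ∘ ofComplex) {t | 0 < t.im} := mdifferentiable_iff.1 g.holo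
  have h2 : DifferentiableOn ℂ ((fun τ : ℍ => ((g.mat • τ : ℍ) : ℂ)) ∘ ofComplex) {t | 0 < t.im} :=
    mdifferentiable_iff.1 (mdifferentiable_coe.comp (Mp2Z.mdiff_smul g.mat))
  have h3 : DifferentiableOn ℂ
      (fun t => e (-(D * (((fun τ : ℍ => ((g.mat • τ : ℍ) : ℂ)) ∘ ofComplex) t) / 4)))
      {t | 0 < t.im} :=
    ((((h2.const_mul (D : ℂ)).div_const 4).neg).const_mul _).cexp
  exact (h1.zpow (Or.inl fun t _ => g.root_ne_zero _)).mul h3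

theorem contDiff_tauC : ContDiff ℂ ∞ tauC := by unfold tauC; fun_prop

theorem contDiff_tauBarC : ContDiff ℂ ∞ tauBarC := by unfold tauBarC; fun_prop

theorem contDiffAt_holFactorC (D : ℕ) (g : Mp2Z) {z : ℂ × ℂ × ℂ} (hz : 0 < (tauC z).im) :
    ContDiffAt ℂ ∞ (holFactorC D g) z := by
  have ho : IsOpen {t : ℂ | 0 < t.im} := isOpen_lt continuous_const continuous_im
  have h1 : ContDiffAt ℂ ∞ (fun t => holFactor D g (ofComplex t)) (tauC z) :=
    ((differentiableOn_holFactor D g).contDiffOn ho).contDiffAt (ho.mem_nhds hz)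
  exact h1.comp z contDiff_tauC.contDiffAt

theorem contDiffAt_sqrtImC (hD : 0 < D) (hp : 0 < p.2.1) (hδ : 200 * δ ≤ p.2.1)
    (hz : z ∈ ball (realIncl p) δ) : ContDiffAt ℂ ∞ (sqrtImC D g) z := by
  have h1 := imC_re_pos (g := g) hD hp hδ hz
  have hne : linDenom g (tauC z) * linDenom g (tauBarC z) ≠ 0 := by
    intro h
    rw [imC, h, div_zero] at h1
    exact lt_irrefl _ h1
  have h2 : ContDiffAt ℂ ∞ (imC D g) z := by
    refine ContDiffAt.div (contDiffAt_const.mul (by fun_prop)) ?_ hne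
    have h3 := contDiff_tauC.contDiffAt (x := z)
    have h4 := contDiff_tauBarC.contDiffAt (x := z)
    exact ((contDiffAt_const.mul h3).add contDiffAt_const).mul
      ((contDiffAt_const.mul h4).add contDiffAt_const)
  exact (((contDiffAt_log (Or.inl h1)).comp z h2).div_const 2).cexp

theorem contDiffAt_gaussTail (x : ℂ) : ContDiffAt ℂ ∞ gaussTail x :=
  differentiable_gaussTail.contDiff.contDiffAt

theorem contDiffAt_term (hD : 0 < D) (hp : 0 < p.2.1) (hδ : 200 * δ ≤ p.2.1) (s : ℝ)
    (hz : z ∈ ball (realIncl p) δ) :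
    ContDiffAt ℂ ∞ (termPlus D g s) z ∧ ContDiffAt ℂ ∞ (termMinus D g s) z := by
  have h1 := contDiffAt_holFactorC D g (near_imC (D := D) (g := g) hp hδ hz).1
  have h2 := contDiffAt_sqrtImC (g := g) hD hp hδ hz
  have hs0 : sqrtImC D g z ≠ 0 := exp_ne_zero _
  have ha : ContDiffAt ℂ ∞ (fun z : ℂ × ℂ × ℂ => s * z.2.2 / sqrtImC D g z - sqrtImC D g z) z :=
    ((contDiffAt_const.mul (by fun_prop)).div h2 hs0).sub h2
  have he : ContDiffAt ℂ ∞ (fun z : ℂ × ℂ × ℂ =>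
      exp (-Real.pi * (s * z.2.2 / sqrtImC D g z - sqrtImC D g z) ^ 2)) z :=
    (contDiffAt_const.mul (ha.pow 2)).cexp
  have hi : ContDiffAt ℂ ∞ (fun z : ℂ × ℂ × ℂ => 1 / (2 * Real.pi * sqrtImC D g z)) z :=
    contDiffAt_const.div (contDiffAt_const.mul h2)
      (mul_ne_zero (mul_ne_zero two_ne_zero (by exact_mod_cast Real.pi_ne_zero)) hs0)
  have hg1 := (contDiffAt_gaussTail _).comp z ha
  have hg2 := (contDiffAt_gaussTail _).comp z ha.neg
  exact ⟨(he.mul (hi.add hg1)).mul h1, (he.mul (hi.sub hg2)).mul h1⟩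

end Near

end KM

/-! ### Uniform bounds for the terms -/

namespace KM

open Complex UpperHalfPlane Metric Set
open scoped MatrixGroups

theorem exp_neg_le_two_div_sq {y : ℝ} (hy : 0 < y) : Real.exp (-y) ≤ 2 / y ^ 2 := by
  have := Real.pow_div_factorial_le_exp y hy.le 2
  rw [Real.exp_neg, inv_eq_one_div, div_le_div_iff₀ (Real.exp_pos _) (by positivity)]
  norm_num [Nat.factorial] at this
  linarith

theorem exp_neg_le_six_div_cube {y : ℝ} (hy : 0 < y) : Real.exp (-y) ≤ 6 / y ^ 3 := by
  have := Real.pow_div_factorial_le_exp y hy.le 3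
  rw [Real.exp_neg, inv_eq_one_div, div_le_div_iff₀ (Real.exp_pos _) (by positivity)]
  norm_num [Nat.factorial] at this
  linarith

theorem gauss_decay_le {α β x : ℝ} (hα : 0 ≤ α) (hβ : 0 < β) (hx : 0 < x) :
    (α * x + 1) * Real.exp (-(β * x ^ 2)) ≤
      (α * (2 / β ^ 2 + 6 / β ^ 3) + 2 / β ^ 2) * (1 / x ^ 4) := by
  have h2 := exp_neg_le_two_div_sq (y := β * x ^ 2) (by positivity)
  have h3 := exp_neg_le_six_div_cube (y := β * x ^ 2) (by positivity)
  set E := Real.exp (-(β * x ^ 2))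
  have hE : 0 < E := Real.exp_pos _
  have e2 : x ^ 4 * E ≤ 2 / β ^ 2 := by
    calc x ^ 4 * E ≤ x ^ 4 * (2 / (β * x ^ 2) ^ 2) := by gcongr
      _ = 2 / β ^ 2 := by field_simp
  have e3 : x ^ 6 * E ≤ 6 / β ^ 3 := by
    calc x ^ 6 * E ≤ x ^ 6 * (6 / (β * x ^ 2) ^ 3) := by gcongr
      _ = 6 / β ^ 3 := by field_simp
  have h5 : x ^ 5 ≤ x ^ 4 + x ^ 6 := by
    nlinarith [mul_nonneg (pow_nonneg hx.le 4) (sq_nonneg (x - 1)), pow_pos hx 4, pow_pos hx 5]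
  have e5 : x ^ 5 * E ≤ 2 / β ^ 2 + 6 / β ^ 3 := by
    calc x ^ 5 * E ≤ (x ^ 4 + x ^ 6) * E := by gcongr
      _ ≤ _ := by rw [add_mul]; exact add_le_add e2 e3
  rw [mul_one_div, le_div_iff₀ (by positivity)]
  calc (α * x + 1) * E * x ^ 4 = α * (x ^ 5 * E) + x ^ 4 * E := by ring
    _ ≤ _ := by gcongr

/-- A bound for `|cτ + d|^{-3/2}` in terms of a lower bound `r` for `|cτ₀ + d|`. -/
noncomputable def holConst (r : ℝ) : ℝ := ((√r / 2) ^ 3)⁻¹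

/-- A bound for `x⁴ (x / √v₁ + 1) exp(-π q₀ x² / 10)`. -/
noncomputable def gaussConst (v₁ q₀ : ℝ) : ℝ :=
  1 / √v₁ * (2 / (Real.pi / 10 * q₀) ^ 2 + 6 / (Real.pi / 10 * q₀) ^ 3) +
    2 / (Real.pi / 10 * q₀) ^ 2

theorem holConst_nonneg (r : ℝ) : 0 ≤ holConst r := by rw [holConst]; positivity

theorem gaussConst_nonneg (v₁ : ℝ) {q₀ : ℝ} (hq₀ : 0 < q₀) : 0 ≤ gaussConst v₁ q₀ := by
  have := Real.pi_pos
  rw [gaussConst]; positivity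

section Terms

variable {D : ℕ} {γ : Coset} {p : ℝ × ℝ × ℝ} {δ r v₁ v₂ q₀ s : ℝ} {z : ℂ × ℂ × ℂ}

theorem norm_linDenom_ge (hr : r ≤ EisensteinSeries.r (tauOf p)) :
    r * ‖botRow γ‖ ≤ ‖linDenom γ.out (tauOf p)‖ :=
  (mul_le_mul_of_nonneg_right hr (norm_nonneg _)).trans (norm_denom_ge γ (tauOf p))

theorem le_norm_linDenom (hr0 : 0 < r) (hr : r ≤ EisensteinSeries.r (tauOf p)) :
    r ≤ ‖linDenom γ.out (tauOf p)‖ :=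
  (le_mul_of_one_le_right hr0.le (one_le_norm_botRow γ)).trans (norm_linDenom_ge hr)

theorem one_div_pow_four_le (hr0 : 0 < r) (hr : r ≤ EisensteinSeries.r (tauOf p)) :
    1 / ‖linDenom γ.out (tauOf p)‖ ^ 4 ≤ 1 / r ^ 4 * cosetWeight γ := by
  have h1 := one_le_norm_botRow γ
  rw [cosetWeight, one_div_mul_one_div, ← mul_pow]
  refine one_div_le_one_div_of_le (by positivity) ?_
  have := norm_linDenom_ge (γ := γ) hr
  gcongr

theorem im_smul_tauOf (g : Mp2Z) (hp : 0 < p.2.1) :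
    (g.mat • tauOf p : ℍ).im = p.2.1 / ‖linDenom g (tauOf p)‖ ^ 2 := by
  have hv : (tauOf p).im = p.2.1 := by rw [← coe_im, tauOf_coe hp]
  rw [im_smul_eq, hv]
  rfl

/-- `(D Im(γτ))²` is bounded by the summable weight. -/
theorem sq_im_smul_le (hp : 0 < p.2.1) (hv₂ : p.2.1 ≤ v₂) (hr0 : 0 < r)
    (hr : r ≤ EisensteinSeries.r (tauOf p)) :
    (D * (γ.out.mat • tauOf p : ℍ).im) ^ 2 ≤ D ^ 2 * (v₂ ^ 2 / r ^ 4) * cosetWeight γ := by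
  rw [im_smul_tauOf _ hp]
  have h := one_div_pow_four_le (γ := γ) hr0 hr
  calc (D * (p.2.1 / ‖linDenom γ.out (tauOf p)‖ ^ 2)) ^ 2
      = D ^ 2 * p.2.1 ^ 2 * (1 / ‖linDenom γ.out (tauOf p)‖ ^ 4) := by ring
    _ ≤ D ^ 2 * v₂ ^ 2 * (1 / r ^ 4 * cosetWeight γ) := by gcongr
    _ = _ := by ring

theorem norm_holFactorC_le (hp : 0 < p.2.1) (hδ : 200 * δ ≤ p.2.1)
    (hz : z ∈ ball (realIncl p) δ) (hr0 : 0 < r) (hr : r ≤ EisensteinSeries.r (tauOf p)) :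
    ‖holFactorC D γ.out z‖ ≤
      holConst r * Real.exp (Real.pi * (52 / 100 * (D * (γ.out.mat • tauOf p : ℍ).im))) := by
  obtain ⟨hpos, h1, h2, -⟩ := near_imC (D := D) (g := γ.out) hp hδ hz
  have hX := le_norm_linDenom (γ := γ) hr0 hr
  rw [holFactorC, norm_holFactor, holConst]
  refine mul_le_mul ?_ ?_ (Real.exp_pos _).le (by positivity)
  · have h3 : (√r / 2) ^ 2 ≤ ‖γ.out.root (ofComplex (tauC z))‖ ^ 2 := by
      rw [norm_root_sq, ofComplex_apply_of_im_pos hpos, div_pow, Real.sq_sqrt hr0.le]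
      have e1 : (γ.out.mat 1 0 : ℂ) * ((⟨tauC z, hpos⟩ : ℍ) : ℂ) + (γ.out.mat 1 1 : ℂ) =
        linDenom γ.out (tauC z) := rfl
      rw [e1]
      have h4 := norm_sub_norm_le (linDenom γ.out (tauOf p)) (linDenom γ.out (tauC z))
      rw [norm_sub_rev] at h4
      linarith
    have h5 : √r / 2 ≤ ‖γ.out.root (ofComplex (tauC z))‖ :=
      le_of_sq_le_sq h3 (norm_nonneg _)
    have h6 : 0 < √r / 2 := by positivity
    gcongr
  · refine Real.exp_le_exp.2 ?_
    have := mul_le_mul_of_nonneg_left h2 Real.pi_pos.le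
    linarith

/-- The common part of the estimates: what the exponentially decaying part of the kernel and the
remaining bounded part `B` contribute. -/
theorem norm_mul_holFactorC_le {κ : ℂ} {B : ℝ} (hD : 0 < D) (hv₁ : 0 < v₁) (hp : v₁ ≤ p.2.1)
    (hδ : 200 * δ ≤ p.2.1) (hz : z ∈ ball (realIncl p) δ) (hr0 : 0 < r)
    (hr : r ≤ EisensteinSeries.r (tauOf p)) (hq₀ : 0 < q₀)
    (hq : q₀ ≤ (s * p.2.2) ^ 2 / (D * p.2.1))
    (hκ : ‖κ‖ ≤ Real.exp (Real.pi *
      (-(93 / 100) * ((s * p.2.2) ^ 2 / √(D * (γ.out.mat • tauOf p : ℍ).im) ^ 2) + 2 * (s * p.2.2) +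
        2 / 100 * |s * p.2.2| - 96 / 100 * √(D * (γ.out.mat • tauOf p : ℍ).im) ^ 2)) *
      (1 / √(D * (γ.out.mat • tauOf p : ℍ).im) + 1) + B) :
    ‖κ * holFactorC D γ.out z‖ ≤ holConst r * (gaussConst v₁ q₀ * (1 / r ^ 4)) *
      Real.exp (Real.pi * (2 * (s * p.2.2) - 9 / 10 * |s * p.2.2|)) * cosetWeight γ +
      holConst r * (B * Real.exp (Real.pi * (52 / 100 * (D * (γ.out.mat • tauOf p : ℍ).im)))) := by
  have hp0 : 0 < p.2.1 := hv₁.trans_le hp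
  have hH := norm_holFactorC_le (D := D) (γ := γ) hp0 hδ hz hr0 hr
  have hVpos := imC_realIncl_pos γ.out (p := p) hD
  have hVeq : (D * (γ.out.mat • tauOf p : ℍ).im : ℝ) =
    D * p.2.1 / ‖linDenom γ.out (tauOf p)‖ ^ 2 := by rw [im_smul_tauOf _ hp0, mul_div_assoc]
  set V : ℝ := D * (γ.out.mat • tauOf p : ℍ).im
  have hsq : √V ^ 2 = V := Real.sq_sqrt hVpos.le
  have hexp := kernel_exponent_le (q := √V) (s * p.2.2) (Real.sqrt_pos.2 hVpos)
  rw [hsq] at hκ hexp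
  set w₀ := s * p.2.2
  have hX := le_norm_linDenom (γ := γ) hr0 hr
  have hX4 := one_div_pow_four_le (γ := γ) hr0 hr
  set X := ‖linDenom γ.out (tauOf p)‖
  have hX0 : 0 < X := hr0.trans_le hX
  have hD1 : (1 : ℝ) ≤ D := by exact_mod_cast hD
  have h1 : 1 / √V ≤ 1 / √v₁ * X := by
    have h2 : √v₁ / X ≤ √V := by
      rw [hVeq, Real.sqrt_div' _ (by positivity), Real.sqrt_sq hX0.le]
      gcongr
      nlinarith
    calc 1 / √V ≤ 1 / (√v₁ / X) := one_div_le_one_div_of_le (by positivity) h2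
      _ = _ := by field_simp
  have h3 : q₀ * X ^ 2 ≤ w₀ ^ 2 / V := by
    have : w₀ ^ 2 / V = w₀ ^ 2 / (D * p.2.1) * X ^ 2 := by rw [hVeq]; field_simp
    rw [this]
    gcongr
  set F := Real.exp (Real.pi * (-(93 / 100) * (w₀ ^ 2 / V) + 2 * w₀ + 2 / 100 * |w₀| - 96 / 100 * V))
  have h4 : F * Real.exp (Real.pi * (52 / 100 * V)) ≤
      Real.exp (Real.pi * (2 * w₀ - 9 / 10 * |w₀|)) * Real.exp (-(Real.pi / 10 * q₀ * X ^ 2)) := by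
    rw [← Real.exp_add, ← Real.exp_add]
    refine Real.exp_le_exp.2 (hexp.trans ?_)
    have : Real.pi / 10 * (q₀ * X ^ 2) ≤ Real.pi / 10 * (w₀ ^ 2 / V) :=
      mul_le_mul_of_nonneg_left h3 (by have := Real.pi_pos; positivity)
    linarith
  have h5 := gauss_decay_le (α := 1 / √v₁) (β := Real.pi / 10 * q₀) (x := X) (by positivity)
    (by have := Real.pi_pos; positivity) hX0
  rw [← gaussConst] at h5
  have hg := gaussConst_nonneg v₁ hq₀
  rw [norm_mul]
  calc ‖κ‖ * ‖holFactorC D γ.out z‖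
      ≤ (F * (1 / √V + 1) + B) * (holConst r * Real.exp (Real.pi * (52 / 100 * V))) :=
        mul_le_mul hκ hH (norm_nonneg _) ((norm_nonneg _).trans hκ)
    _ = holConst r * ((F * Real.exp (Real.pi * (52 / 100 * V))) * (1 / √V + 1)) +
        holConst r * (B * Real.exp (Real.pi * (52 / 100 * V))) := by ring
    _ ≤ holConst r * ((Real.exp (Real.pi * (2 * w₀ - 9 / 10 * |w₀|)) *
          Real.exp (-(Real.pi / 10 * q₀ * X ^ 2))) * (1 / √v₁ * X + 1)) +
        holConst r * (B * Real.exp (Real.pi * (52 / 100 * V))) := by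
        have := holConst_nonneg r
        gcongr
    _ = holConst r * Real.exp (Real.pi * (2 * w₀ - 9 / 10 * |w₀|)) * ((1 / √v₁ * X + 1) *
          Real.exp (-(Real.pi / 10 * q₀ * X ^ 2))) +
        holConst r * (B * Real.exp (Real.pi * (52 / 100 * V))) := by ring
    _ ≤ holConst r * Real.exp (Real.pi * (2 * w₀ - 9 / 10 * |w₀|)) *
          (gaussConst v₁ q₀ * (1 / r ^ 4 * cosetWeight γ)) +
        holConst r * (B * Real.exp (Real.pi * (52 / 100 * V))) := by
        have := holConst_nonneg r
        have h6 := h5.trans (mul_le_mul_of_nonneg_left hX4 hg)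
        gcongr
    _ = _ := by ring

/-- The variables `w` and `√V` stay close to their values at the centre of the ball. -/
theorem near_kernel_args (hD : 0 < D) (hp : 0 < p.2.1) (hy : 0 < p.2.2) (hδ : 200 * δ ≤ p.2.1)
    (hδ' : 100 * δ ≤ p.2.2) (hz : z ∈ ball (realIncl p) δ) :
    ‖(s * z.2.2 : ℂ) - (s * p.2.2 : ℝ)‖ ≤ 1 / 100 * |s * p.2.2| ∧
    ‖sqrtImC D γ.out z - (√(D * (γ.out.mat • tauOf p : ℍ).im) : ℝ)‖ ≤
      1 / 25 * √(D * (γ.out.mat • tauOf p : ℍ).im) ∧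
    ‖sqrtImC D γ.out z ^ 2 - ((√(D * (γ.out.mat • tauOf p : ℍ).im) : ℝ) : ℂ) ^ 2‖ ≤
      1 / 25 * √(D * (γ.out.mat • tauOf p : ℍ).im) ^ 2 := by
  obtain ⟨-, -, -, h4⟩ := norm_tauC_sub_le hz
  obtain ⟨-, -, -, hV⟩ := near_imC (D := D) (g := γ.out) hp hδ hz
  have hVpos := imC_realIncl_pos γ.out (p := p) hD
  have hne : imC D γ.out z ≠ 0 := by
    intro h
    have := imC_re_pos (g := γ.out) hD hp hδ hz
    rw [h, zero_re] at this
    exact lt_irrefl _ this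
  set V : ℝ := D * (γ.out.mat • tauOf p : ℍ).im
  have h3 : ‖sqrtImC D γ.out z ^ 2 - ((√V : ℝ) : ℂ) ^ 2‖ ≤ 1 / 25 * √V ^ 2 := by
    rw [sqrtImC_sq hne, ← ofReal_pow, Real.sq_sqrt hVpos.le]
    exact hV
  refine ⟨?_, norm_sub_le_of_sq_near (Real.sqrt_pos.2 hVpos) (sqrtImC_re_nonneg _ _ _) h3, h3⟩
  have e1 : (s * z.2.2 : ℂ) - (s * p.2.2 : ℝ) = s * (z.2.2 - p.2.2) := by push_cast; ring
  rw [e1, norm_mul, norm_real, Real.norm_eq_abs, abs_mul, abs_of_pos hy]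
  calc |s| * ‖z.2.2 - p.2.2‖ ≤ |s| * (1 / 100 * p.2.2) := by gcongr; linarith
    _ = _ := by ring

theorem norm_termMinus_le_of_neg (hD : 0 < D) (hv₁ : 0 < v₁) (hp : v₁ ≤ p.2.1) (hy : 0 < p.2.2)
    (hδ : 200 * δ ≤ p.2.1) (hδ' : 100 * δ ≤ p.2.2) (hz : z ∈ ball (realIncl p) δ) (hr0 : 0 < r)
    (hr : r ≤ EisensteinSeries.r (tauOf p)) (hq₀ : 0 < q₀)
    (hq : q₀ ≤ (s * p.2.2) ^ 2 / (D * p.2.1)) (hs : s < 0) :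
    ‖termMinus D γ.out s z‖ ≤ holConst r * (gaussConst v₁ q₀ * (1 / r ^ 4)) *
      Real.exp (2 * Real.pi * (s * p.2.2)) * cosetWeight γ := by
  have hp0 : 0 < p.2.1 := hv₁.trans_le hp
  have hVpos := imC_realIncl_pos γ.out (p := p) hD
  have hw : s * p.2.2 < 0 := mul_neg_of_neg_of_pos hs hy
  obtain ⟨h1, h2, h3⟩ := near_kernel_args (γ := γ) (s := s) hD hp0 hy hδ hδ' hz
  have hκ := norm_kerMinus_le hw.ne (Real.sqrt_pos.2 hVpos) h1 h2 h3 le_rfl (fun h => by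
    rw [Real.sq_sqrt hVpos.le] at h; linarith)
  refine (norm_mul_holFactorC_le hD hv₁ hp hδ hz hr0 hr hq₀ hq hκ).trans ?_
  rw [zero_mul, mul_zero, add_zero]
  have hg := gaussConst_nonneg v₁ hq₀
  have hh := holConst_nonneg r
  have hc := cosetWeight_nonneg γ
  refine mul_le_mul_of_nonneg_right
    (mul_le_mul_of_nonneg_left (Real.exp_le_exp.2 ?_) (by positivity)) hc
  rw [abs_of_neg hw]
  nlinarith [Real.pi_pos]

/-- The constant in the estimate of the terms for positive `w`. -/
noncomputable def termConst (v₁ v₂ r q₀ w₁ v₀ : ℝ) : ℝ :=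
  holConst r * (gaussConst v₁ q₀ * (1 / r ^ 4)) +
    holConst r * (v₂ ^ 2 / r ^ 4 * (4 / w₁ ^ 2 * Real.exp (Real.pi * (52 / 100 * v₀)) + 1 / v₀ ^ 2))

theorem norm_termPlus_le {w₁ v₀ : ℝ} (hD : 0 < D) (hv₁ : 0 < v₁) (hp : v₁ ≤ p.2.1)
    (hv₂ : p.2.1 ≤ v₂) (hy : 0 < p.2.2)
    (hδ : 200 * δ ≤ p.2.1) (hδ' : 100 * δ ≤ p.2.2) (hz : z ∈ ball (realIncl p) δ) (hr0 : 0 < r)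
    (hr : r ≤ EisensteinSeries.r (tauOf p)) (hq₀ : 0 < q₀)
    (hq : q₀ ≤ (s * p.2.2) ^ 2 / (D * p.2.1)) (hw₁ : 0 < w₁) (hw : w₁ ≤ s * p.2.2)
    (hV : D * (γ.out.mat • tauOf p : ℍ).im ≤ v₀) :
    ‖termPlus D γ.out s z‖ ≤ termConst v₁ v₂ r q₀ w₁ v₀ * D ^ 2 *
      Real.exp (11 / 10 * Real.pi * (s * p.2.2)) * cosetWeight γ := by
  have hp0 : 0 < p.2.1 := hv₁.trans_le hp
  have hVpos := imC_realIncl_pos γ.out (p := p) hD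
  have hw0 : 0 < s * p.2.2 := hw₁.trans_le hw
  have hVsq := sq_im_smul_le (D := D) (γ := γ) hp0 hv₂ hr0 hr
  obtain ⟨h1, h2, h3⟩ := near_kernel_args (γ := γ) (s := s) hD hp0 hy hδ hδ' hz
  have hκ := norm_kerPlus_le hw0 (Real.sqrt_pos.2 hVpos) h1 h2 h3
    (B := (2 * (D * (γ.out.mat • tauOf p : ℍ).im) / (s * p.2.2)) ^ 2) (sq_nonneg _) (fun h => by
      rw [Real.sq_sqrt hVpos.le] at h
      exact one_le_pow₀ ((one_le_div hw0).2 h))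
  refine (norm_mul_holFactorC_le hD hv₁ hp hδ hz hr0 hr hq₀ hq hκ).trans ?_
  have hg := gaussConst_nonneg v₁ hq₀
  have hh := holConst_nonneg r
  have hc := cosetWeight_nonneg γ
  have hD1 : (1 : ℝ) ≤ D ^ 2 := one_le_pow₀ (by exact_mod_cast hD)
  set V : ℝ := D * (γ.out.mat • tauOf p : ℍ).im
  rw [abs_of_pos hw0]
  set w₀ := s * p.2.2
  have e1 : Real.pi * (2 * w₀ - 9 / 10 * w₀) = 11 / 10 * Real.pi * w₀ := by ring
  rw [e1]
  have hE : 1 ≤ Real.exp (11 / 10 * Real.pi * w₀) :=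
    Real.one_le_exp (by have := Real.pi_pos; positivity)
  set E := Real.exp (11 / 10 * Real.pi * w₀)
  have hB : (2 * V / w₀) ^ 2 * Real.exp (Real.pi * (52 / 100 * V)) ≤
      D ^ 2 * (v₂ ^ 2 / r ^ 4 * (4 / w₁ ^ 2 * Real.exp (Real.pi * (52 / 100 * v₀)))) * E *
        cosetWeight γ := by
    have hpi := Real.pi_pos
    calc (2 * V / w₀) ^ 2 * Real.exp (Real.pi * (52 / 100 * V))
        = V ^ 2 * (4 / w₀ ^ 2 * Real.exp (Real.pi * (52 / 100 * V))) := by ring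
      _ ≤ (D ^ 2 * (v₂ ^ 2 / r ^ 4) * cosetWeight γ) *
          (4 / w₁ ^ 2 * Real.exp (Real.pi * (52 / 100 * v₀))) := by gcongr
      _ = D ^ 2 * (v₂ ^ 2 / r ^ 4 * (4 / w₁ ^ 2 * Real.exp (Real.pi * (52 / 100 * v₀)))) * 1 *
        cosetWeight γ := by ring
      _ ≤ _ := by gcongr
  calc holConst r * (gaussConst v₁ q₀ * (1 / r ^ 4)) * E * cosetWeight γ +
        holConst r * ((2 * V / w₀) ^ 2 * Real.exp (Real.pi * (52 / 100 * V)))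
      ≤ holConst r * (gaussConst v₁ q₀ * (1 / r ^ 4)) * D ^ 2 * E * cosetWeight γ +
        holConst r * (D ^ 2 * (v₂ ^ 2 / r ^ 4 * (4 / w₁ ^ 2 *
          Real.exp (Real.pi * (52 / 100 * v₀)) + 1 / v₀ ^ 2)) * E * cosetWeight γ) := by
        refine add_le_add ?_ (mul_le_mul_of_nonneg_left (hB.trans ?_) hh)
        · have : holConst r * (gaussConst v₁ q₀ * (1 / r ^ 4)) ≤
              holConst r * (gaussConst v₁ q₀ * (1 / r ^ 4)) * D ^ 2 :=
            le_mul_of_one_le_right (by positivity) hD1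
          gcongr
        · gcongr
          exact le_add_of_nonneg_right (by positivity)
    _ = _ := by rw [termConst]; ring

theorem norm_termMinus_le_of_pos {w₁ v₀ : ℝ} (hD : 0 < D) (hv₁ : 0 < v₁) (hp : v₁ ≤ p.2.1)
    (hv₂ : p.2.1 ≤ v₂) (hy : 0 < p.2.2)
    (hδ : 200 * δ ≤ p.2.1) (hδ' : 100 * δ ≤ p.2.2) (hz : z ∈ ball (realIncl p) δ) (hr0 : 0 < r)
    (hr : r ≤ EisensteinSeries.r (tauOf p)) (hq₀ : 0 < q₀)
    (hq : q₀ ≤ (s * p.2.2) ^ 2 / (D * p.2.1)) (hw₁ : 0 < w₁) (hw : w₁ ≤ s * p.2.2)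
    (hv₀ : 0 < v₀) (hV : v₀ ≤ D * (γ.out.mat • tauOf p : ℍ).im) :
    ‖termMinus D γ.out s z‖ ≤ termConst v₁ v₂ r q₀ w₁ v₀ * D ^ 2 *
      Real.exp (11 / 10 * Real.pi * (s * p.2.2)) * cosetWeight γ := by
  have hp0 : 0 < p.2.1 := hv₁.trans_le hp
  have hVpos := imC_realIncl_pos γ.out (p := p) hD
  have hw0 : 0 < s * p.2.2 := hw₁.trans_le hw
  have hVsq := sq_im_smul_le (D := D) (γ := γ) hp0 hv₂ hr0 hr
  obtain ⟨h1, h2, h3⟩ := near_kernel_args (γ := γ) (s := s) hD hp0 hy hδ hδ' hz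
  -- `B` undoes the growth of `e(-Dτ/4)`; it is at least `1` in the range `V ≤ 1.2 w₀`.
  have hκ := norm_kerMinus_le hw0.ne' (Real.sqrt_pos.2 hVpos) h1 h2 h3
    (B := (D * (γ.out.mat • tauOf p : ℍ).im / v₀) ^ 2 *
      (Real.exp (11 / 10 * Real.pi * (s * p.2.2)) *
        Real.exp (-(Real.pi * (52 / 100 * (D * (γ.out.mat • tauOf p : ℍ).im))))))
    (by positivity) (fun h => by
      rw [Real.sq_sqrt hVpos.le] at h
      refine one_le_mul_of_one_le_of_one_le (one_le_pow₀ ((one_le_div hv₀).2 hV)) ?_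
      rw [← Real.exp_add]
      refine Real.one_le_exp ?_
      have := mul_le_mul_of_nonneg_left h Real.pi_pos.le
      have := mul_pos Real.pi_pos hw0
      linarith)
  refine (norm_mul_holFactorC_le hD hv₁ hp hδ hz hr0 hr hq₀ hq hκ).trans ?_
  have hg := gaussConst_nonneg v₁ hq₀
  have hh := holConst_nonneg r
  have hc := cosetWeight_nonneg γ
  have hD1 : (1 : ℝ) ≤ D ^ 2 := one_le_pow₀ (by exact_mod_cast hD)
  set V : ℝ := D * (γ.out.mat • tauOf p : ℍ).im
  rw [abs_of_pos hw0]
  set w₀ := s * p.2.2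
  have e1 : Real.pi * (2 * w₀ - 9 / 10 * w₀) = 11 / 10 * Real.pi * w₀ := by ring
  rw [e1]
  have hE : 0 < Real.exp (11 / 10 * Real.pi * w₀) := Real.exp_pos _
  set E := Real.exp (11 / 10 * Real.pi * w₀)
  have hB : (V / v₀) ^ 2 * (E * Real.exp (-(Real.pi * (52 / 100 * V)))) *
      Real.exp (Real.pi * (52 / 100 * V)) ≤
      D ^ 2 * (v₂ ^ 2 / r ^ 4 * (1 / v₀ ^ 2)) * E * cosetWeight γ := by
    calc _ = V ^ 2 * (1 / v₀ ^ 2 * E) *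
          (Real.exp (-(Real.pi * (52 / 100 * V))) * Real.exp (Real.pi * (52 / 100 * V))) := by ring
      _ = V ^ 2 * (1 / v₀ ^ 2 * E) := by rw [← Real.exp_add, neg_add_cancel, Real.exp_zero, mul_one]
      _ ≤ (D ^ 2 * (v₂ ^ 2 / r ^ 4) * cosetWeight γ) * (1 / v₀ ^ 2 * E) := by gcongr
      _ = _ := by ring
  calc holConst r * (gaussConst v₁ q₀ * (1 / r ^ 4)) * E * cosetWeight γ +
        holConst r * ((V / v₀) ^ 2 * (E * Real.exp (-(Real.pi * (52 / 100 * V)))) *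
          Real.exp (Real.pi * (52 / 100 * V)))
      ≤ holConst r * (gaussConst v₁ q₀ * (1 / r ^ 4)) * D ^ 2 * E * cosetWeight γ +
        holConst r * (D ^ 2 * (v₂ ^ 2 / r ^ 4 * (4 / w₁ ^ 2 *
          Real.exp (Real.pi * (52 / 100 * v₀)) + 1 / v₀ ^ 2)) * E * cosetWeight γ) := by
        refine add_le_add ?_ (mul_le_mul_of_nonneg_left (hB.trans ?_) hh)
        · have : holConst r * (gaussConst v₁ q₀ * (1 / r ^ 4)) ≤
              holConst r * (gaussConst v₁ q₀ * (1 / r ^ 4)) * D ^ 2 :=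
            le_mul_of_one_le_right (by positivity) hD1
          gcongr
        · gcongr
          exact le_add_of_nonneg_left (by positivity)
    _ = _ := by rw [termConst]; ring

end Terms

end KM

/-! ### The series and their derivatives near a point -/

namespace KM

open Complex UpperHalfPlane Metric Set Filter Topology
open scoped MatrixGroups

/-- The point `p = (u, v, y)` satisfies `v₁ ≤ v ≤ v₂` and `y ≥ y₁`, and `|cτ + d| ≥ r` for all coprime
`c, d`; on a compact set such bounds hold uniformly. -/
structure LocalBounds (v₁ v₂ r y₁ : ℝ) (p : ℝ × ℝ × ℝ) : Prop where
  v₁_pos : 0 < v₁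
  r_pos : 0 < r
  y₁_pos : 0 < y₁
  v₁_le : v₁ ≤ p.2.1
  le_v₂ : p.2.1 ≤ v₂
  y₁_le : y₁ ≤ p.2.2
  r_le : r ≤ EisensteinSeries.r (tauOf p)

/-- A radius that is small compared to `v` and `y`. -/
noncomputable def nearRadius (v₁ y₁ : ℝ) : ℝ := min (v₁ / 200) (y₁ / 100)

theorem nearRadius_pos {v₁ y₁ : ℝ} (hv : 0 < v₁) (hy : 0 < y₁) : 0 < nearRadius v₁ y₁ :=
  lt_min (by positivity) (by positivity)

namespace LocalBounds

variable {v₁ v₂ r y₁ : ℝ} {p : ℝ × ℝ × ℝ}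

theorem im_pos (h : LocalBounds v₁ v₂ r y₁ p) : 0 < p.2.1 := h.v₁_pos.trans_le h.v₁_le

theorem y_pos (h : LocalBounds v₁ v₂ r y₁ p) : 0 < p.2.2 := h.y₁_pos.trans_le h.y₁_le

theorem radius_le (h : LocalBounds v₁ v₂ r y₁ p) : 200 * nearRadius v₁ y₁ ≤ p.2.1 := by
  have := min_le_left (v₁ / 200) (y₁ / 100)
  have := h.v₁_le
  rw [nearRadius]; linarith

theorem radius_le' (h : LocalBounds v₁ v₂ r y₁ p) : 100 * nearRadius v₁ y₁ ≤ p.2.2 := by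
  have := min_le_right (v₁ / 200) (y₁ / 100)
  have := h.y₁_le
  rw [nearRadius]; linarith

theorem mem_of_mem_ball (h : LocalBounds v₁ v₂ r y₁ p) {q : ℝ × ℝ × ℝ}
    (hq : q ∈ ball p (nearRadius v₁ y₁)) :
    realIncl q ∈ ball (realIncl p) (nearRadius v₁ y₁) ∧ 0 < q.2.1 ∧ 0 < q.2.2 := by
  rw [mem_ball, dist_eq_norm] at hq
  have h1 : |q.2.1 - p.2.1| ≤ ‖q - p‖ :=
    (norm_fst_le (q - p).2).trans (norm_snd_le (q - p))
  have h2 : |q.2.2 - p.2.2| ≤ ‖q - p‖ :=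
    (norm_snd_le (q - p).2).trans (norm_snd_le (q - p))
  have h3 := h.radius_le
  have h4 := h.radius_le'
  have h5 := h.im_pos
  have h6 := h.y_pos
  refine ⟨?_, ?_, ?_⟩
  · rw [mem_ball, dist_eq_norm, ← map_sub, norm_realIncl_apply]
    exact hq
  · linarith [(abs_le.1 h1).1]
  · linarith [(abs_le.1 h2).1]

end LocalBounds

theorem tauOf_coords (τ : ℍ) (y : ℝ) : tauOf (coords (τ, y)) = τ := by
  have h2 : (⟨τ.re, τ.im⟩ : ℂ) = τ := rfl
  simp only [tauOf, coords, h2, ofComplex_apply]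

theorem truncSet_finite (D : ℕ) (τ : ℍ) {v₀ : ℝ} (hv₀ : 0 < v₀) : (truncSet D v₀ τ).Finite := by
  have h0 := EisensteinSeries.r_pos τ
  have hs := (summable_cosetWeight.mul_left
    ((D : ℝ) ^ 2 * (τ.im ^ 2 / EisensteinSeries.r τ ^ 4))).tendsto_cofinite_zero
  have h1 := hs.eventually (gt_mem_nhds (show (0 : ℝ) < v₀ ^ 2 by positivity))
  refine Set.Finite.subset (eventually_cofinite.1 h1) fun γ (hγ : v₀ ≤ _) => ?_
  have h2 := sq_im_smul_le (D := D) (γ := γ) (p := coords (τ, 1)) (v₂ := τ.im)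
    (r := EisensteinSeries.r τ) τ.im_pos le_rfl h0 (by rw [tauOf_coords])
  rw [tauOf_coords] at h2
  rw [mem_ofPred_eq, not_lt]
  refine le_trans ?_ h2
  gcongr

/-- A series over the cosets whose scalar factors continue to holomorphic functions on a ball, with
bounds proportional to the summable weight. -/
theorem exists_norm_iteratedFDeriv_coset_sum_le (k : ℕ) {R : ℝ} (hR : 0 < R) : ∃ B : ℝ, 0 ≤ B ∧
    ∀ {D : ℕ} {G : Coset → ℂ × ℂ × ℂ → ℂ} {M : ℝ} {p : ℝ × ℝ × ℝ},
      (∀ γ, ContDiffOn ℂ ∞ (G γ) (ball (realIncl p) R)) →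
      (∀ γ, ∀ z ∈ ball (realIncl p) R, ‖G γ z‖ ≤ M * cosetWeight γ) →
      (∀ z ∈ ball (realIncl p) R, Summable fun γ => G γ z • weilVec D γ.out) ∧
      ContDiffAt ℝ ∞ (fun q => (1 / 4 : ℂ) • ∑' γ, G γ (realIncl q) • weilVec D γ.out) p ∧
      ‖iteratedFDeriv ℝ k
        (fun q => (1 / 4 : ℂ) • ∑' γ, G γ (realIncl q) • weilVec D γ.out) p‖ ≤ B * M := by
  obtain ⟨B, hB, h⟩ := exists_norm_iteratedFDeriv_tsum_le k hR
  refine ⟨B * ∑' γ, cosetWeight γ, mul_nonneg hB (tsum_nonneg cosetWeight_nonneg),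
    fun {D G M p} hG hM => ?_⟩
  have hM' : ∀ γ, ∀ z ∈ ball (realIncl p) R, ‖G γ z • weilVec D γ.out‖ ≤ M * cosetWeight γ := by
    intro γ z hz
    rw [norm_smul]
    exact (mul_le_of_le_one_right (norm_nonneg _) (norm_weilVec_le _ _)).trans (hM γ z hz)
  have hs := summable_cosetWeight.mul_left M
  have h1 := h (F := fun γ z => (1 / 4 : ℂ) • (G γ z • weilVec D γ.out))
    (fun γ => by have := hG γ; fun_prop) (fun γ z hz => by
      rw [norm_smul]
      refine (mul_le_of_le_one_left (norm_nonneg _) ?_).trans (hM' γ z hz)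
      norm_num) hs
  have e1 : (fun q => ∑' γ, (1 / 4 : ℂ) • (G γ (realIncl q) • weilVec D γ.out)) =
      fun q => (1 / 4 : ℂ) • ∑' γ, G γ (realIncl q) • weilVec D γ.out := by
    funext q
    exact tsum_const_smul'' _
  rw [e1, tsum_mul_left] at h1
  refine ⟨fun z hz => .of_norm_bounded hs fun γ => hM' γ z hz, h1.1, h1.2.trans (le_of_eq ?_)⟩
  ring

/-- The estimate for positive `w = sy`: the terms with `D Im(γτ) ≥ v₀` contribute the kernel minus
`1`, the other terms contribute the kernel itself. -/
theorem exists_bound_of_pos (k : ℕ) {v₁ v₂ r y₁ q₀ w₁ v₀ : ℝ} (hv₁ : 0 < v₁) (hy₁ : 0 < y₁)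
    (hq₀ : 0 < q₀) (hw₁ : 0 < w₁) (hv₀ : 0 < v₀) : ∃ C : ℝ, 0 ≤ C ∧
    ∀ {D : ℕ} {s : ℝ} {p : ℝ × ℝ × ℝ}, 0 < D → LocalBounds v₁ v₂ r y₁ p →
      q₀ ≤ (s * p.2.2) ^ 2 / (D * p.2.1) → w₁ ≤ s * p.2.2 →
      (Summable fun γ : Coset => slash (nonholSeed D (s * p.2.2)) γ.out (tauOf p)) ∧
      ContDiffAt ℝ ∞ (fun q => gTilde D (tauOf q) (s * q.2.2) -
        truncPoincare D v₀ (tauOf p) (tauOf q)) p ∧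
      ‖iteratedFDeriv ℝ k (fun q => gTilde D (tauOf q) (s * q.2.2) -
        truncPoincare D v₀ (tauOf p) (tauOf q)) p‖ ≤
        C * D ^ 2 * Real.exp (11 / 10 * Real.pi * (s * p.2.2)) := by
  classical
  have hR := nearRadius_pos hv₁ hy₁
  obtain ⟨B, hB, h⟩ := exists_norm_iteratedFDeriv_coset_sum_le k hR
  refine ⟨B * |termConst v₁ v₂ r q₀ w₁ v₀|, by positivity, fun {D s p} hD hp hq hw => ?_⟩
  set t := truncSet D v₀ (tauOf p) with ht
  have htf : t.Finite := truncSet_finite D (tauOf p) hv₀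
  have hs : 0 < s := pos_of_mul_pos_left (hw₁.trans_le hw) hp.y_pos.le
  obtain ⟨h1, h2, h3⟩ := h (D := D) (p := p)
    (G := fun γ z => if γ ∈ t then termMinus D γ.out s z else termPlus D γ.out s z)
    (M := |termConst v₁ v₂ r q₀ w₁ v₀| * D ^ 2 * Real.exp (11 / 10 * Real.pi * (s * p.2.2)))
    (fun γ z hz => by
      have := contDiffAt_term (g := γ.out) hD hp.im_pos hp.radius_le s hz
      by_cases hγ : γ ∈ t
      · simp only [hγ, if_true]; exact this.2.contDiffWithinAt
      · simp only [hγ, if_false]; exact this.1.contDiffWithinAt)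
    (fun γ z hz => by
      have hle : termConst v₁ v₂ r q₀ w₁ v₀ * D ^ 2 *
          Real.exp (11 / 10 * Real.pi * (s * p.2.2)) * cosetWeight γ ≤
          |termConst v₁ v₂ r q₀ w₁ v₀| * D ^ 2 *
          Real.exp (11 / 10 * Real.pi * (s * p.2.2)) * cosetWeight γ := by
        have := cosetWeight_nonneg γ
        have := le_abs_self (termConst v₁ v₂ r q₀ w₁ v₀)
        gcongr
      refine le_trans ?_ hle
      by_cases hγ : γ ∈ t
      · simp only [hγ, if_true]
        exact norm_termMinus_le_of_pos hD hv₁ hp.v₁_le hp.le_v₂ hp.y_pos hp.radius_le hp.radius_le'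
          hz hp.r_pos hp.r_le hq₀ hq hw₁ hw hv₀ hγ
      · simp only [hγ, if_false]
        refine norm_termPlus_le hD hv₁ hp.v₁_le hp.le_v₂ hp.y_pos hp.radius_le hp.radius_le'
          hz hp.r_pos hp.r_le hq₀ hq hw₁ hw (le_of_lt (not_le.1 hγ)))
  have hterm : ∀ q : ℝ × ℝ × ℝ, 0 < q.2.1 → 0 < q.2.2 → ∀ γ : Coset,
      slash (nonholSeed D (s * q.2.2)) γ.out (tauOf q) =
        (if γ ∈ t then termMinus D γ.out s (realIncl q) else termPlus D γ.out s (realIncl q)) •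
          weilVec D γ.out + t.indicator (fun γ => slash (holSeed D) γ.out (tauOf q)) γ := by
    intro q hq1 hq2 γ
    rw [slash_nonholSeed_of_pos hD γ.out hq1 (mul_pos hs hq2)]
    by_cases hγ : γ ∈ t
    · rw [if_pos hγ, indicator_of_mem hγ, slash_holSeed_tauOf, termPlus_eq, add_smul]
    · rw [if_neg hγ, indicator_of_notMem hγ, add_zero]
  have hind : ∀ q : ℝ × ℝ × ℝ,
      Summable (t.indicator (fun γ : Coset => slash (holSeed D) γ.out (tauOf q))) := fun q =>
    summable_of_hasFiniteSupport (htf.subset support_indicator_subset)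
  have hev : (fun q => gTilde D (tauOf q) (s * q.2.2) -
      truncPoincare D v₀ (tauOf p) (tauOf q)) =ᶠ[𝓝 p] fun q => (1 / 4 : ℂ) • ∑' γ : Coset,
        (if γ ∈ t then termMinus D γ.out s (realIncl q) else termPlus D γ.out s (realIncl q)) •
          weilVec D γ.out := by
    filter_upwards [ball_mem_nhds p hR] with q hq
    obtain ⟨hq1, hq2, hq3⟩ := hp.mem_of_mem_ball hq
    rw [gTilde, truncPoincare, ← smul_sub]
    congr 1
    rw [tsum_congr (hterm q hq2 hq3), (h1 _ hq1).tsum_add (hind q), ← ht,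
      ← tsum_subtype t (fun γ : Coset => slash (holSeed D) γ.out (tauOf q)), add_sub_cancel_right]
  refine ⟨?_, h2.congr_of_eventuallyEq hev, ?_⟩
  · have := (h1 _ (mem_ball_self hR)).add (hind p)
    exact this.congr fun γ => (hterm p hp.im_pos hp.y_pos γ).symm
  · rw [(EventuallyEq.iteratedFDeriv ℝ hev k).eq_of_nhds]
    refine h3.trans (le_of_eq ?_)
    ring

/-- The estimate for negative `w = sy`. -/
theorem exists_bound_of_neg (k : ℕ) {v₁ v₂ r y₁ q₀ : ℝ} (hv₁ : 0 < v₁) (hy₁ : 0 < y₁)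
    (hq₀ : 0 < q₀) : ∃ C : ℝ, 0 ≤ C ∧
    ∀ {D : ℕ} {s : ℝ} {p : ℝ × ℝ × ℝ}, 0 < D → LocalBounds v₁ v₂ r y₁ p →
      q₀ ≤ (s * p.2.2) ^ 2 / (D * p.2.1) → s < 0 →
      (Summable fun γ : Coset => slash (nonholSeed D (s * p.2.2)) γ.out (tauOf p)) ∧
      ContDiffAt ℝ ∞ (gTildeReal D s) p ∧
      ‖iteratedFDeriv ℝ k (gTildeReal D s) p‖ ≤ C * Real.exp (2 * Real.pi * (s * p.2.2)) := by
  have hR := nearRadius_pos hv₁ hy₁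
  obtain ⟨B, hB, h⟩ := exists_norm_iteratedFDeriv_coset_sum_le k hR
  have hg := gaussConst_nonneg v₁ hq₀
  have hh := holConst_nonneg r
  refine ⟨B * (holConst r * (gaussConst v₁ q₀ * (1 / r ^ 4))), by positivity,
    fun {D s p} hD hp hq hs => ?_⟩
  obtain ⟨h1, h2, h3⟩ := h (D := D) (p := p) (G := fun γ z => termMinus D γ.out s z)
    (M := holConst r * (gaussConst v₁ q₀ * (1 / r ^ 4)) * Real.exp (2 * Real.pi * (s * p.2.2)))
    (fun γ z hz =>
      (contDiffAt_term (g := γ.out) hD hp.im_pos hp.radius_le s hz).2.contDiffWithinAt)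
    (fun γ z hz => norm_termMinus_le_of_neg hD hv₁ hp.v₁_le hp.y_pos hp.radius_le hp.radius_le'
      hz hp.r_pos hp.r_le hq₀ hq hs)
  have hev : gTildeReal D s =ᶠ[𝓝 p] fun q => (1 / 4 : ℂ) • ∑' γ : Coset,
      termMinus D γ.out s (realIncl q) • weilVec D γ.out := by
    filter_upwards [ball_mem_nhds p hR] with q hq
    obtain ⟨-, hq2, hq3⟩ := hp.mem_of_mem_ball hq
    rw [gTildeReal, gTilde]
    congr 1
    exact tsum_congr fun γ =>
      slash_nonholSeed_of_neg hD γ.out hq2 (mul_neg_of_neg_of_pos hs hq3)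
  refine ⟨?_, h2.congr_of_eventuallyEq hev, ?_⟩
  · exact (h1 _ (mem_ball_self hR)).congr fun γ =>
      (slash_nonholSeed_of_neg hD γ.out hp.im_pos (mul_neg_of_neg_of_pos hs hp.y_pos)).symm
  · rw [(EventuallyEq.iteratedFDeriv ℝ hev k).eq_of_nhds]
    refine h3.trans (le_of_eq ?_)
    ring

end KM

/-! ### Smoothness, and uniform estimates on compact sets -/

namespace KM

open Complex UpperHalfPlane Metric Set Filter Topology

theorem localBounds_self {p : ℝ × ℝ × ℝ} (hv : 0 < p.2.1) (hy : 0 < p.2.2) :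
    LocalBounds p.2.1 p.2.1 (EisensteinSeries.r (tauOf p)) p.2.2 p :=
  ⟨hv, EisensteinSeries.r_pos _, hy, le_rfl, le_rfl, le_rfl, le_rfl⟩

theorem summable_slash_nonholSeed {D : ℕ} (hD : 0 < D) (τ : ℍ) {w : ℝ} (hw : w ≠ 0) :
    Summable fun γ : Coset => slash (nonholSeed D w) γ.out τ := by
  have hp := localBounds_self (p := coords (τ, 1)) τ.im_pos one_pos
  have hq₀ : 0 < (w * (coords (τ, 1)).2.2) ^ 2 / (D * (coords (τ, 1)).2.1) := by
    have h1 : 0 < (D : ℝ) := by exact_mod_cast hD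
    have h2 := hp.im_pos
    have h3 : w * (coords (τ, 1)).2.2 ≠ 0 := mul_ne_zero hw one_ne_zero
    positivity
  have e1 : w * (coords (τ, 1)).2.2 = w := mul_one w
  have e2 := tauOf_coords τ 1
  rcases lt_or_gt_of_ne hw with hneg | hpos
  · obtain ⟨C, -, h⟩ := exists_bound_of_neg (v₂ := (coords (τ, 1)).2.1)
      (r := EisensteinSeries.r (tauOf (coords (τ, 1)))) 0 hp.v₁_pos hp.y₁_pos hq₀
    have := (h hD hp le_rfl hneg).1
    rwa [e1, e2] at this
  · obtain ⟨C, -, h⟩ := exists_bound_of_pos (v₂ := (coords (τ, 1)).2.1)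
      (r := EisensteinSeries.r (tauOf (coords (τ, 1)))) 0 hp.v₁_pos hp.y₁_pos hq₀ hpos one_pos
    have := (h hD hp le_rfl e1.ge).1
    rwa [e1, e2] at this

theorem contDiffAt_gTildeReal {D : ℕ} (hD : 0 < D) {s : ℝ} (hs : s ≠ 0) {p : ℝ × ℝ × ℝ}
    (hv : 0 < p.2.1) (hy : 0 < p.2.2) : ContDiffAt ℝ ∞ (gTildeReal D s) p := by
  have hp := localBounds_self hv hy
  have hD' : 0 < (D : ℝ) := by exact_mod_cast hD
  have hq₀ : 0 < (s * p.2.2) ^ 2 / (D * p.2.1) := by positivity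
  rcases lt_or_gt_of_ne hs with hneg | hpos
  · obtain ⟨C, -, h⟩ := exists_bound_of_neg (v₂ := p.2.1)
      (r := EisensteinSeries.r (tauOf p)) 0 hp.v₁_pos hp.y₁_pos hq₀
    exact (h hD hp le_rfl hneg).2.1
  · have hr := EisensteinSeries.r_pos (tauOf p)
    -- a threshold above all values `D Im(γτ)`, so that nothing is truncated
    set v₀ : ℝ := D * p.2.1 / EisensteinSeries.r (tauOf p) ^ 2 + 1 with hv₀
    have hv₀' : 0 < v₀ := by positivity
    have hempty : truncSet D v₀ (tauOf p) = ∅ := by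
      refine eq_empty_of_forall_notMem fun γ (hγ : v₀ ≤ _) => ?_
      have hX := le_norm_linDenom (γ := γ) (p := p) hr le_rfl
      rw [im_smul_tauOf _ hv, ← mul_div_assoc] at hγ
      have : D * p.2.1 / ‖linDenom γ.out (tauOf p)‖ ^ 2 ≤
          D * p.2.1 / EisensteinSeries.r (tauOf p) ^ 2 := by gcongr
      linarith
    obtain ⟨C, -, h⟩ := exists_bound_of_pos (v₂ := p.2.1)
      (r := EisensteinSeries.r (tauOf p)) 0 hp.v₁_pos hp.y₁_pos hq₀ (mul_pos hpos hy) hv₀'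
    have h2 := (h hD hp le_rfl le_rfl).2.1
    have e1 : (fun q : ℝ × ℝ × ℝ => gTilde D (tauOf q) (s * q.2.2) -
        truncPoincare D v₀ (tauOf p) (tauOf q)) = gTildeReal D s := by
      funext q
      rw [truncPoincare, hempty, tsum_empty, smul_zero, sub_zero, gTildeReal]
    rwa [e1] at h2

theorem exists_localBounds {K : Set (ℍ × ℝ)} (hK : IsCompact K) (hne : K.Nonempty)
    (hpos : ∀ p ∈ K, 0 < p.2) : ∃ v₂ r y₁ : ℝ, 0 < minIm K ∧ 0 < v₂ ∧ 0 < y₁ ∧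
      ∀ p ∈ K, LocalBounds (minIm K) v₂ r y₁ (coords p) := by
  have hcim : Continuous fun p : ℍ × ℝ => p.1.im := UpperHalfPlane.continuous_im.comp continuous_fst
  have hIm := hK.image hcim
  have hmem := hIm.sInf_mem (hne.image _)
  have hv₁ : 0 < minIm K := by
    obtain ⟨p, -, hp⟩ := hmem
    rw [minIm, ← hp]
    exact p.1.im_pos
  obtain ⟨v₂, hv₂⟩ := hIm.bddAbove
  obtain ⟨p₀, hp₀, hmin⟩ := hK.exists_isMinOn hne continuous_snd.continuousOn
  obtain ⟨A, B, hB, hAB⟩ := subset_verticalStrip_of_isCompact (hK.image continuous_fst)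
  refine ⟨v₂, EisensteinSeries.r ⟨⟨A, B⟩, hB⟩, p₀.2, hv₁, ?_, hpos p₀ hp₀, fun p hp => ?_⟩
  · exact p₀.1.im_pos.trans_le (hv₂ (mem_image_of_mem _ hp₀))
  · exact
      { v₁_pos := hv₁
        r_pos := EisensteinSeries.r_pos _
        y₁_pos := hpos p₀ hp₀
        v₁_le := csInf_le hIm.bddBelow (mem_image_of_mem _ hp)
        le_v₂ := hv₂ (mem_image_of_mem _ hp)
        y₁_le := hmin hp
        r_le := by
          obtain ⟨τ, y⟩ := p
          rw [tauOf_coords]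
          exact EisensteinSeries.r_lower_bound_on_verticalStrip _ hB (hAB (mem_image_of_mem _ hp)) }

theorem abs_kronecker_le_one (D : ℤ) (n : ℕ) : |kronecker D n| ≤ 1 := by
  have h1 : ∀ x : ZMod 8, |ZMod.χ₈ x| ≤ 1 := by decide
  rw [kronecker, abs_mul, abs_pow]
  refine mul_le_one₀ (pow_le_one₀ (abs_nonneg _) (h1 _)) (abs_nonneg _) ?_
  rcases jacobiSym.trichotomy D (n / 2 ^ n.factorization 2) with h | h | h <;> rw [h] <;> simp

/-- A power of `m` is absorbed by a small part of the exponential. -/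
theorem pow_six_mul_exp_le {y₁ y m : ℝ} (hy₁ : 0 < y₁) (hy : y₁ ≤ y) (hm : 0 ≤ m) :
    m ^ 6 * Real.exp (11 / 10 * Real.pi * (m * y)) ≤
      720 / (4 / 10 * Real.pi * y₁) ^ 6 * Real.exp (3 / 2 * Real.pi * m * y) := by
  have hpi := Real.pi_pos
  have hy0 : 0 < y := hy₁.trans_le hy
  have h1 := Real.pow_div_factorial_le_exp (4 / 10 * Real.pi * (m * y)) (by positivity) 6
  have h2 : m ^ 6 ≤ 720 / (4 / 10 * Real.pi * y₁) ^ 6 * Real.exp (4 / 10 * Real.pi * (m * y)) := by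
    rw [div_mul_eq_mul_div, le_div_iff₀ (by positivity)]
    calc m ^ 6 * (4 / 10 * Real.pi * y₁) ^ 6 = (4 / 10 * Real.pi * (m * y₁)) ^ 6 := by ring
      _ ≤ (4 / 10 * Real.pi * (m * y)) ^ 6 := by gcongr
      _ = 720 * ((4 / 10 * Real.pi * (m * y)) ^ 6 / (Nat.factorial 6 : ℕ)) := by
        norm_num [Nat.factorial]; ring
      _ ≤ _ := by gcongr
  calc _ ≤ 720 / (4 / 10 * Real.pi * y₁) ^ 6 * Real.exp (4 / 10 * Real.pi * (m * y)) *
        Real.exp (11 / 10 * Real.pi * (m * y)) := by gcongr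
    _ = _ := by
      rw [mul_assoc, ← Real.exp_add]
      ring_nf

theorem exists_bound_twistedSumAt (k : ℕ) {D : ℕ} (hD : 0 < D) {K : Set (ℍ × ℝ)}
    (hK : IsCompact K) (hpos : ∀ p ∈ K, 0 < p.2) : ∃ C : ℝ, 0 ≤ C ∧
    ∀ m : ℕ, 0 < m → ∀ p ∈ K,
      ‖iteratedFDeriv ℝ k (twistedSumAt D (minIm K) m p.1) (coords p)‖ ≤
        C * Real.exp (3 / 2 * Real.pi * m * p.2) := by
  rcases K.eq_empty_or_nonempty with rfl | hne
  · exact ⟨0, le_rfl, fun m _ p hp => absurd hp (notMem_empty p)⟩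
  obtain ⟨v₂, r, y₁, hv₁, hv₂, hy₁, hK'⟩ := exists_localBounds hK hne hpos
  have hDR : 0 < (D : ℝ) := by exact_mod_cast hD
  obtain ⟨C, hC, h⟩ := exists_bound_of_pos (v₂ := v₂) (r := r) k hv₁ hy₁
    (q₀ := y₁ ^ 2 / (D * v₂)) (by positivity) hy₁ hv₁
  have hpi := Real.pi_pos
  refine ⟨C * D ^ 2 * (720 / (4 / 10 * Real.pi * y₁) ^ 6), by positivity, fun m hm p hp => ?_⟩
  have hb := hK' p hp
  have hyp : y₁ ≤ p.2 := hb.y₁_le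
  have hy0 : 0 < p.2 := hy₁.trans_le hyp
  have hp0 : 0 < (coords p).2.1 := hb.im_pos
  have hm1 : (1 : ℝ) ≤ m := by exact_mod_cast hm
  have hterm := fun (n : ℕ) (hn : n ∈ m.divisors) => by
    have hn0 : 0 < n := Nat.pos_of_mem_divisors hn
    have hnm : (n : ℝ) ≤ m := by exact_mod_cast Nat.divisor_le hn
    have hnR : 0 < (n : ℝ) := by exact_mod_cast hn0
    refine (h (D := D * n ^ 2) (s := m) (Nat.mul_pos hD (pow_pos hn0 2)) hb ?_ ?_).2
    · -- `(my)² / (Dn²v) ≥ y₁² / (D v₂)` since `n ≤ m`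
      push_cast
      rw [div_le_div_iff₀ (by positivity) (by positivity)]
      have h1 : (coords p).2.1 ≤ v₂ := hb.le_v₂
      have h2 : y₁ ≤ (coords p).2.2 := hyp
      have h3 : y₁ ^ 2 * (n ^ 2 * (coords p).2.1) ≤ (coords p).2.2 ^ 2 * (m ^ 2 * v₂) := by gcongr
      calc y₁ ^ 2 * (D * n ^ 2 * (coords p).2.1)
          = D * (y₁ ^ 2 * (n ^ 2 * (coords p).2.1)) := by ring
        _ ≤ D * ((coords p).2.2 ^ 2 * (m ^ 2 * v₂)) := by gcongr
        _ = _ := by ring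
    · exact hyp.trans (le_mul_of_one_le_left hy0.le hm1)
  have hτ : tauOf (coords p) = p.1 := tauOf_coords p.1 p.2
  rw [hτ] at hterm
  have hsum : twistedSumAt D (minIm K) m p.1 = fun q => ∑ n ∈ m.divisors,
      ((kronecker D (m / n) : ℂ) * n) • (gTilde (D * n ^ 2) (tauOf q) (m * q.2.2) -
        truncPoincare (D * n ^ 2) (minIm K) p.1 (tauOf q)) := rfl
  have hcd : ∀ n ∈ m.divisors, ContDiffAt ℝ k (fun q : ℝ × ℝ × ℝ =>
      gTilde (D * n ^ 2) (tauOf q) (m * q.2.2) -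
        truncPoincare (D * n ^ 2) (minIm K) p.1 (tauOf q)) (coords p) :=
    fun n hn => (hterm n hn).1.of_le (mod_cast le_top)
  rw [hsum, iteratedFDeriv_fun_sum_apply fun n hn => (hcd n hn).const_smul _]
  have hE : 0 < Real.exp (11 / 10 * Real.pi * (m * p.2)) := Real.exp_pos _
  have hone : ∀ n ∈ m.divisors, ‖iteratedFDeriv ℝ k (fun q : ℝ × ℝ × ℝ =>
      ((kronecker D (m / n) : ℂ) * n) • (gTilde (D * n ^ 2) (tauOf q) (m * q.2.2) -
        truncPoincare (D * n ^ 2) (minIm K) p.1 (tauOf q))) (coords p)‖ ≤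
      C * D ^ 2 * m ^ 5 * Real.exp (11 / 10 * Real.pi * (m * p.2)) := by
    intro n hn
    have hnm : (n : ℝ) ≤ m := by exact_mod_cast Nat.divisor_le hn
    rw [iteratedFDeriv_const_smul_apply' (hcd n hn), norm_smul]
    have h1 : ‖(kronecker D (m / n) : ℂ) * n‖ ≤ m := by
      rw [norm_mul, norm_natCast, norm_intCast]
      have : |(kronecker D (m / n) : ℝ)| ≤ 1 := by exact_mod_cast abs_kronecker_le_one D (m / n)
      exact (mul_le_of_le_one_left (Nat.cast_nonneg n) this).trans hnm
    have h2 := (hterm n hn).2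
    have h3 : C * ((D * n ^ 2 : ℕ) : ℝ) ^ 2 * Real.exp (11 / 10 * Real.pi * (m * (coords p).2.2)) ≤
        C * D ^ 2 * m ^ 4 * Real.exp (11 / 10 * Real.pi * (m * p.2)) := by
      have e1 : ((D * n ^ 2 : ℕ) : ℝ) ^ 2 = D ^ 2 * n ^ 4 := by push_cast; ring
      have e2 : (coords p).2.2 = p.2 := rfl
      rw [e1, e2, ← mul_assoc]
      gcongr
    calc _ ≤ (m : ℝ) * (C * D ^ 2 * m ^ 4 * Real.exp (11 / 10 * Real.pi * (m * p.2))) :=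
          mul_le_mul h1 (h2.trans h3) (norm_nonneg _) (Nat.cast_nonneg _)
      _ = _ := by ring
  have hcard : ((m.divisors.card : ℕ) : ℝ) ≤ m := by exact_mod_cast Nat.card_divisors_le_self m
  calc _ ≤ ∑ n ∈ m.divisors, C * D ^ 2 * m ^ 5 * Real.exp (11 / 10 * Real.pi * (m * p.2)) :=
        norm_sum_le_of_le _ hone
    _ = m.divisors.card * (C * D ^ 2 * m ^ 5 * Real.exp (11 / 10 * Real.pi * (m * p.2))) := by
        rw [Finset.sum_const, nsmul_eq_mul]
    _ ≤ m * (C * D ^ 2 * m ^ 5 * Real.exp (11 / 10 * Real.pi * (m * p.2))) := by gcongr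
    _ = C * D ^ 2 * (m ^ 6 * Real.exp (11 / 10 * Real.pi * (m * p.2))) := by ring
    _ ≤ C * D ^ 2 * (720 / (4 / 10 * Real.pi * y₁) ^ 6 *
        Real.exp (3 / 2 * Real.pi * m * p.2)) := by
        have := pow_six_mul_exp_le hy₁ hyp (Nat.cast_nonneg m)
        gcongr
    _ = _ := by ring

theorem exists_bound_gTildeReal (k : ℕ) {D : ℕ} (hD : 0 < D) {K : Set (ℍ × ℝ)}
    (hK : IsCompact K) (hpos : ∀ p ∈ K, 0 < p.2) : ∃ C : ℝ, 0 ≤ C ∧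
    ∀ m : ℤ, m < 0 → ∀ p ∈ K,
      ‖iteratedFDeriv ℝ k (gTildeReal D m) (coords p)‖ ≤ C * Real.exp (2 * Real.pi * m * p.2) := by
  rcases K.eq_empty_or_nonempty with rfl | hne
  · exact ⟨0, le_rfl, fun m _ p hp => absurd hp (notMem_empty p)⟩
  obtain ⟨v₂, r, y₁, hv₁, hv₂, hy₁, hK'⟩ := exists_localBounds hK hne hpos
  have hDR : 0 < (D : ℝ) := by exact_mod_cast hD
  obtain ⟨C, hC, h⟩ := exists_bound_of_neg (v₂ := v₂) (r := r) k hv₁ hy₁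
    (q₀ := y₁ ^ 2 / (D * v₂)) (by positivity)
  refine ⟨C, hC, fun m hm p hp => ?_⟩
  have hb := hK' p hp
  have hm1 : (1 : ℝ) ≤ (m : ℝ) ^ 2 := by
    have : (1 : ℤ) ≤ m ^ 2 := by nlinarith
    exact_mod_cast this
  have h1 := (h hD hb (s := m) ?_ (by exact_mod_cast hm)).2.2
  · refine h1.trans (le_of_eq ?_)
    rw [mul_assoc (2 * Real.pi)]
    rfl
  · have h0 := hb.im_pos
    have h2 := hb.le_v₂
    have h3 := hb.y₁_le
    rw [mul_pow]
    calc y₁ ^ 2 / (D * v₂) ≤ (coords p).2.2 ^ 2 / (D * (coords p).2.1) := by gcongr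
      _ ≤ _ := by
        gcongr
        exact le_mul_of_one_le_left (sq_nonneg _) hm1

end KM

theorem mainTheorem12 :
    -- the series are absolutely convergent, the truncated series are finite, and everything is smooth
    (∀ D : ℕ, KM.IsPosDisc D →
      (∀ (τ : UpperHalfPlane) (w : ℝ), w ≠ 0 →
        Summable fun γ : KM.Coset => KM.slash (KM.nonholSeed D w) γ.out τ) ∧
      (∀ (τ : UpperHalfPlane) (v₀ : ℝ), 0 < v₀ → (KM.truncSet D v₀ τ).Finite) ∧
      (∀ s : ℝ, s ≠ 0 → ContDiffOn ℝ ∞ (KM.gTildeReal D s)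
        {p : ℝ × ℝ × ℝ | 0 < p.2.1 ∧ 0 < p.2.2})) ∧
    -- the growth estimates
    (∀ D : ℕ, KM.IsPosDisc D → ∀ K : Set (UpperHalfPlane × ℝ), IsCompact K → (∀ p ∈ K, 0 < p.2) →
      (∃ C : ℝ, ∀ᶠ m : ℕ in Filter.atTop, ∀ p ∈ K,
        ‖KM.twistedSum D (KM.minIm K) m p.1 p.2‖ ≤
          C * (m : ℝ) ^ 4 * Real.exp (3 / 2 * Real.pi * m * p.2)) ∧
      (∃ C : ℝ, ∀ᶠ m : ℤ in Filter.atBot, ∀ p ∈ K,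
        ‖KM.gTilde D p.1 (m * p.2)‖ ≤
          C * (m : ℝ) ^ 2 * Real.exp (2 * Real.pi * m * p.2))) ∧
    -- the estimates for all iterated partial derivatives of order `k` in `u`, `v`, `y`
    (∀ k : ℕ, ∃ N : ℕ, ∀ D : ℕ, KM.IsPosDisc D →
      ∀ K : Set (UpperHalfPlane × ℝ), IsCompact K → (∀ p ∈ K, 0 < p.2) →
      (∃ C : ℝ, ∀ᶠ m : ℕ in Filter.atTop, ∀ p ∈ K,
        ‖iteratedFDeriv ℝ k (KM.twistedSumAt D (KM.minIm K) m p.1) (KM.coords p)‖ ≤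
          C * (m : ℝ) ^ N * Real.exp (3 / 2 * Real.pi * m * p.2)) ∧
      (∃ C : ℝ, ∀ᶠ m : ℤ in Filter.atBot, ∀ p ∈ K,
        ‖iteratedFDeriv ℝ k (KM.gTildeReal D m) (KM.coords p)‖ ≤
          C * |(m : ℝ)| ^ N * Real.exp (2 * Real.pi * m * p.2))) := by
  refine ⟨fun D hD => ⟨fun τ w hw => KM.summable_slash_nonholSeed hD.1 τ hw,
    fun τ v₀ hv₀ => KM.truncSet_finite D τ hv₀, fun s hs p hp =>
      (KM.contDiffAt_gTildeReal hD.1 hs hp.1 hp.2).contDiffWithinAt⟩,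
    fun D hD K hK hpos => ⟨?_, ?_⟩, fun k => ⟨0, fun D hD K hK hpos => ⟨?_, ?_⟩⟩⟩
  · obtain ⟨C, hC, h⟩ := KM.exists_bound_twistedSumAt 0 hD.1 hK hpos
    refine ⟨C, ?_⟩
    filter_upwards [Filter.eventually_ge_atTop 1] with m hm p hp
    have h1 := h m hm p hp
    rw [norm_iteratedFDeriv_zero, KM.twistedSumAt_coords] at h1
    refine h1.trans (mul_le_mul_of_nonneg_right ?_ (Real.exp_pos _).le)
    exact le_mul_of_one_le_right hC (one_le_pow₀ (by exact_mod_cast hm))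
  · obtain ⟨C, hC, h⟩ := KM.exists_bound_gTildeReal 0 hD.1 hK hpos
    refine ⟨C, ?_⟩
    filter_upwards [Filter.eventually_le_atBot (-1)] with m hm p hp
    have h1 := h m (by omega) p hp
    rw [norm_iteratedFDeriv_zero, KM.gTildeReal, KM.tauOf_coords] at h1
    refine h1.trans (mul_le_mul_of_nonneg_right ?_ (Real.exp_pos _).le)
    have h2 : (1 : ℤ) ≤ m ^ 2 := by nlinarith
    exact le_mul_of_one_le_right hC (by exact_mod_cast h2)
  · obtain ⟨C, -, h⟩ := KM.exists_bound_twistedSumAt k hD.1 hK hpos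
    refine ⟨C, ?_⟩
    filter_upwards [Filter.eventually_ge_atTop 1] with m hm p hp
    rw [pow_zero, mul_one]
    exact h m hm p hp
  · obtain ⟨C, -, h⟩ := KM.exists_bound_gTildeReal k hD.1 hK hpos
    refine ⟨C, ?_⟩
    filter_upwards [Filter.eventually_le_atBot (-1)] with m hm p hp
    rw [pow_zero, mul_one]
    exact h m (by omega) p hp
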